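/- Let $\mathscr S=(\mathscr S_{n,\pm})_{n\ge 0}$ be an irreducible subfactor planar algebra, that is, a spherical shaded planar $*$-algebra over $\mathbb C$ with $\dim\mathscr S_{n,\pm}<\infty$ for all $n$ and $\dim\mathscr S_{0,\pm}=\dim\mathscr S_{1,\pm}=1$, whose Markov trace induces a positive definite inner product on every $\mathscr S_{n,\pm}$. Write $\mathscr S_n=\mathscr S_{n,+}$, let $\delta$ be the value of a closed circle and $tr$ the unnormalized Markov trace on $\mathscr S_2$. For $a,b\in\mathscr S_2$ let $a'$ be the contragredient of $a$ (rotation by $180^\circ$), let $a*b$ be the coproduct ($a$ to the left of $b$, with the two right boundary points of $a$ joined to the two left boundary points of $b$), and let $1\boxdot a\in\mathscr S_3$ be the one-click rotation of $a$ with one vertical string added on the left, so that $(1\boxdot a)(1\boxdot b)=1\boxdot(a*b)$; put $\mathscr S_{1,3}=\{1\boxdot z : z\in\mathscr S_2\}\subset\mathscr S_3$. A biprojection is a nonzero projection $R\in\mathscr S_2$ such that $1\boxdot R$ is a multiple of a projection in $\mathscr S_{1,3}$; the biprojection generated by $y\in\mathscr S_2$ is the smallest biprojection $R$ with $RyR=y$.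 Let $A\in\mathscr S_2$ be a positive operator and let $P$ be the biprojection generated by $A$. Then for every $Q\in\mathscr S_2$ such that $1\boxdot Q$ is a minimal projection in $\mathscr S_{1,3}$, the following are equivalent: (1) $Q*P*Q=\frac{tr(P)}{\delta}Q$; (2) $Q*A*Q=\frac{tr(A)}{\delta}Q$; (3) $Q*A=A*Q=\frac{tr(A)}{\delta}Q$; (4) $Q*(A+A')*Q=\frac{tr(A+A')}{\delta}Q$. Consequently, $\frac{\delta}{tr(P)}\,(1\boxdot P)$ is the spectral projection of the self-adjoint operator $1\boxdot(A+A')$ at the point $\|1\boxdot(A+A')\|$, where $\|\cdot\|$ is the operator norm of the finite-dimensional $C^*$-algebra $\mathscr S_3$. -/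

import Mathlib

open scoped ComplexOrder

namespace SubfactorPA

/-! ### Planar tangles

Shaded planar tangles up to isotopy, as combinatorial maps on the sphere.  A tangle is drawn in an
outer disc and has finitely many input discs (indexed by `ι`).  Every disc has an even number of
marked boundary points, joined by disjoint strings (there may also be closed strings); the
complement of the discs and strings falls into regions, which are shaded in a checkerboard way. -/

/-- The type of a box space: `2 * n` boundary points, and the shading of the region at the
distinguished interval. `⟨n, false⟩` is `(n, +)` (unshaded), `⟨n, true⟩` is `(n, -)` (shaded). -/
structure Color where
  n : ℕ
  shaded : Bool

variable {ι : Type} (c : ι → Color) (c₀ : Color)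

/-- The discs of a tangle: `none` is the outer disc, `some i` the input discs. -/
def discColor : Option ι → Color
  | none => c₀
  | some i => c i

/-- Marked boundary points, numbered clockwise on each disc, starting after the distinguished
interval. -/
abbrev Point : Type := Σ d : Option ι, Fin (2 * (discColor c c₀ d).n)

/-- Boundary intervals: interval `j` precedes the point `j` and interval `j + 1` follows it.
Both `0` and `2 * n` denote the distinguished interval. -/
abbrev Interval : Type := Σ d : Option ι, Fin (2 * (discColor c c₀ d).n + 1)

/-- The pieces from which the boundary circles of the regions are made: boundary intervals of
discs, and the two sides of each string; `(s, false)` is the unshaded side of the string `s`, and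
`(s, true)` the shaded one. -/
abbrev Edge (Str : Type) : Type := Interval c c₀ ⊕ (Str × Bool)

variable {c c₀}

/-- The shading of the region touching a boundary interval (`true` is shaded). -/
def Interval.shade (I : Interval c c₀) : Bool :=
  xor (discColor c c₀ I.1).shaded I.2.val.bodd

/-- The interval just before a point. -/
def Point.before (p : Point c c₀) : Interval c c₀ := ⟨p.1, p.2.castSucc⟩

/-- The interval just after a point. -/
def Point.after (p : Point c c₀) : Interval c c₀ := ⟨p.1, p.2.succ⟩

/-- Orient all strings so that the shaded side is on the right. `p.isSource` tells whether the
string at `p` starts at `p`. At an input disc the string leaves the disc outwards, with the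
interval after `p` on its right; at the outer disc it leaves inwards, with the interval before `p`
on its right. -/
def Point.isSource (p : Point c c₀) : Bool :=
  match p.1 with
  | none => p.before.shade
  | some _ => p.after.shade

/-- The shading of an edge. -/
def Edge.shade {Str : Type} : Edge c c₀ Str → Bool
  | Sum.inl I => Interval.shade I
  | Sum.inr x => x.2

/-- Consecutive edges on the boundary circle of a region: at a marked point, each adjacent interval
is continued by the side of the string of the same shading. The last clause identifies the two
names of the distinguished interval. -/
inductive Corner {Str : Type} (str : Point c c₀ → Str) : Edge c c₀ Str → Edge c c₀ Str → Prop
  | before (p : Point c c₀) :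
      Corner str (Sum.inl p.before) (Sum.inr (str p, Interval.shade p.before))
  | after (p : Point c c₀) :
      Corner str (Sum.inl p.after) (Sum.inr (str p, Interval.shade p.after))
  | close (d : Option ι) :
      Corner str (Sum.inl ⟨d, 0⟩) (Sum.inl ⟨d, Fin.last _⟩)

variable (c c₀)

/-- A diagram: a set of strings, a set of regions, the string at each marked point, and the region
along each edge. -/
structure Tangle where
  Str : Type
  Reg : Type
  str : Point c c₀ → Str
  reg : Edge c c₀ Str → Reg

variable {c c₀}

namespace Tangle

/-- The diagram is drawn on the sphere, that is, it is a shaded planar tangle. Gluing genus zero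
regions to the discs and strings gives a closed oriented surface; it is a sphere if and only if it
is connected and its Euler characteristic `#discs - #arcs + ∑ (2 - #boundary circles)`, summed
over the regions, equals two. -/
structure IsPlanar (T : Tangle c c₀) : Prop where
  finite_discs : Finite ι
  finite_str : Finite T.Str
  finite_reg : Finite T.Reg
  /-- a string is closed, or it is an arc with one source and one target -/
  ends : ∀ s : T.Str, (∀ p, T.str p ≠ s) ∨
    ((∃! p, T.str p = s ∧ p.isSource = true) ∧ (∃! p, T.str p = s ∧ p.isSource = false))
  /-- a boundary circle lies on one region -/
  corner : ∀ e e', Corner T.str e e' → T.reg e = T.reg e'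
  /-- every region is either shaded or unshaded -/
  shading : ∃ sh : T.Reg → Bool, ∀ e, sh (T.reg e) = e.shade
  /-- any two regions are joined by a path that crosses strings -/
  connected : ∀ r r' : T.Reg, Relation.EqvGen
    (fun a b => ∃ s, a = T.reg (Sum.inr (s, false)) ∧ b = T.reg (Sum.inr (s, true))) r r'
  euler : Nat.card (Option ι) + 2 * Nat.card T.Reg =
    2 + Nat.card {s : T.Str // ∃ p, T.str p = s} + Nat.card (Quot (Corner T.str))

/-- Reflection of a diagram (reversing the order of the points on each disc). -/
def mirror (T : Tangle c c₀) : Tangle c c₀ where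
  Str := T.Str
  Reg := T.Reg
  str p := T.str ⟨p.1, p.2.rev⟩
  reg
    | Sum.inl I => T.reg (Sum.inl ⟨I.1, I.2.rev⟩)
    | Sum.inr x => T.reg (Sum.inr x)

/-- Isotopy, with a renumbering `σ` of the input discs. -/
def IsIsotopic {ι' : Type} (σ : ι' ≃ ι) (T' : Tangle (fun i => c (σ i)) c₀) (T : Tangle c c₀) :
    Prop :=
  ∃ (f : T'.Str ≃ T.Str) (g : T'.Reg ≃ T.Reg),
    (∀ j, f (T'.str ⟨none, j⟩) = T.str ⟨none, j⟩) ∧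
    (∀ i j, f (T'.str ⟨some i, j⟩) = T.str ⟨some (σ i), j⟩) ∧
    (∀ j, g (T'.reg (Sum.inl ⟨none, j⟩)) = T.reg (Sum.inl ⟨none, j⟩)) ∧
    (∀ i j, g (T'.reg (Sum.inl ⟨some i, j⟩)) = T.reg (Sum.inl ⟨some (σ i), j⟩)) ∧
    (∀ s b, g (T'.reg (Sum.inr (s, b))) = T.reg (Sum.inr (f s, b)))

/-- Isotopy on the sphere of diagrams without outer boundary points: the same as isotopy, except
that the outer disc may sit in different regions. -/
def IsSphericallyIsotopic {a b : Bool} (T : Tangle c ⟨0, a⟩) (T' : Tangle c ⟨0, b⟩) : Prop :=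
  ∃ (f : T.Str ≃ T'.Str) (g : T.Reg ≃ T'.Reg),
    (∀ i j, f (T.str ⟨some i, j⟩) = T'.str ⟨some i, j⟩) ∧
    (∀ i j, g (T.reg (Sum.inl ⟨some i, j⟩)) = T'.reg (Sum.inl ⟨some i, j⟩)) ∧
    (∀ s b, g (T.reg (Sum.inr (s, b))) = T'.reg (Sum.inr (f s, b)))

section gluing

variable {κ : ι → Type} {d : ∀ i, κ i → Color}

/-- When `S i` is placed into the `i`-th input disc of `T`, strings are joined at the marked
points. -/
inductive StrGlue (T : Tangle c c₀) (S : ∀ i, Tangle (d i) (c i)) :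
    T.Str ⊕ (Σ i, (S i).Str) → T.Str ⊕ (Σ i, (S i).Str) → Prop
  | mk (i : ι) (j : Fin (2 * (c i).n)) :
      StrGlue T S (Sum.inl (T.str ⟨some i, j⟩)) (Sum.inr ⟨i, (S i).str ⟨none, j⟩⟩)

/-- When `S i` is placed into the `i`-th input disc of `T`, regions are joined along the boundary
intervals. -/
inductive RegGlue (T : Tangle c c₀) (S : ∀ i, Tangle (d i) (c i)) :
    T.Reg ⊕ (Σ i, (S i).Reg) → T.Reg ⊕ (Σ i, (S i).Reg) → Prop
  | mk (i : ι) (j : Fin (2 * (c i).n + 1)) :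
      RegGlue T S (Sum.inl (T.reg (Sum.inl ⟨some i, j⟩)))
        (Sum.inr ⟨i, (S i).reg (Sum.inl ⟨none, j⟩)⟩)

/-- `U` is the tangle obtained by placing, for each `i`, the tangle `S i` into the `i`-th input disc
of `T` (matching the distinguished intervals) and erasing the boundaries of these discs: its
strings and regions are those of `T` and of all the `S i`, joined as above. -/
def IsGluing (T : Tangle c c₀) (S : ∀ i, Tangle (d i) (c i))
    (U : Tangle (fun p : (Σ i, κ i) => d p.1 p.2) c₀) : Prop :=
  ∃ (f : T.Str ⊕ (Σ i, (S i).Str) → U.Str) (g : T.Reg ⊕ (Σ i, (S i).Reg) → U.Reg),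
    Function.Surjective f ∧ (∀ x y, f x = f y ↔ Relation.EqvGen (StrGlue T S) x y) ∧
    Function.Surjective g ∧ (∀ x y, g x = g y ↔ Relation.EqvGen (RegGlue T S) x y) ∧
    (∀ j, U.str ⟨none, j⟩ = f (Sum.inl (T.str ⟨none, j⟩))) ∧
    (∀ i k j, U.str ⟨some ⟨i, k⟩, j⟩ = f (Sum.inr ⟨i, (S i).str ⟨some k, j⟩⟩)) ∧
    (∀ j, U.reg (Sum.inl ⟨none, j⟩) = g (Sum.inl (T.reg (Sum.inl ⟨none, j⟩)))) ∧
    (∀ i k j, U.reg (Sum.inl ⟨some ⟨i, k⟩, j⟩) =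
      g (Sum.inr ⟨i, (S i).reg (Sum.inl ⟨some k, j⟩)⟩)) ∧
    (∀ s b, U.reg (Sum.inr (f (Sum.inl s), b)) = g (Sum.inl (T.reg (Sum.inr (s, b))))) ∧
    (∀ i s b, U.reg (Sum.inr (f (Sum.inr ⟨i, s⟩), b)) =
      g (Sum.inr ⟨i, (S i).reg (Sum.inr (s, b))⟩))

end gluing

/-- The diagram with given strings whose regions are as small as possible, subject to the condition
that intervals related by `same` lie on the same region. If the union of the discs and strings is
connected, `same` can be left empty: every boundary circle bounds its own region. -/
def ofStrings (Str : Type) (str : Point c c₀ → Str) (same : Interval c c₀ → Interval c c₀ → Prop) :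
    Tangle c c₀ where
  Str := Str
  Reg := Quot fun e e' : Edge c c₀ Str =>
    Corner str e e' ∨ ∃ I I', e = Sum.inl I ∧ e' = Sum.inl I' ∧ same I I'
  str := str
  reg := Quot.mk _

/-- All distinguished intervals lie on the same region. -/
def sameBase (I I' : Interval c c₀) : Prop := I.2.val = 0 ∧ I'.2.val = 0

/-- No condition. -/
def sameNone (_ _ : Interval c c₀) : Prop := False

/-- The identity tangle. -/
def ident (a : Color) : Tangle (fun _ : Unit => a) a :=
  ofStrings (Fin (2 * a.n))
    (fun p => match p with
      | ⟨none, j⟩ => j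
      | ⟨some _, j⟩ => j)
    sameBase

/-- The empty tangle, without input discs and strings. -/
def empty (b : Bool) : Tangle (fun i : Empty => i.elim) ⟨0, b⟩ where
  Str := Empty
  Reg := Unit
  str p := match p with
    | ⟨none, j⟩ => (Nat.not_lt_zero _ j.2).elim
    | ⟨some i, _⟩ => i.elim
  reg _ := ()

/-- A closed circle in an unshaded region. -/
def circle : Tangle (fun i : Empty => i.elim) ⟨0, false⟩ where
  Str := Unit
  Reg := Bool
  str _ := ()
  reg
    | Sum.inl _ => false
    | Sum.inr x => x.2

end Tangle

/-! An `n`-box is drawn as a rectangle with the distinguished interval on the left: the points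
`0, …, n - 1` are on the top from left to right, and `n, …, 2 * n - 1` are on the bottom from right
to left. -/

/-- Position of a point of an `n`-box, from the left. -/
def column {n : ℕ} (j : Fin (2 * n)) : Fin n :=
  if h : j.val < n then ⟨j.val, h⟩ else ⟨2 * n - 1 - j.val, by omega⟩

/-- Whether a point of an `n`-box is on the top. -/
def isTop {n : ℕ} (j : Fin (2 * n)) : Bool := decide (j.val < n)

namespace Tangle

/-- The multiplication tangle: the input `0` below, the input `1` on top of it. The strings at level
`0` join the lower input to the bottom, those at level `1` join the two inputs, and those at level
`2` join the upper input to the top. -/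
def mul (a : Color) : Tangle (fun _ : Fin 2 => a) a :=
  ofStrings (Fin 3 × Fin a.n)
    (fun p => match p with
      | ⟨none, j⟩ => (if isTop (n := a.n) j then 2 else 0, column (n := a.n) j)
      | ⟨some 0, j⟩ => (if isTop (n := a.n) j then 1 else 0, column (n := a.n) j)
      | ⟨some 1, j⟩ => (if isTop (n := a.n) j then 2 else 1, column (n := a.n) j))
    sameBase

/-- The Markov trace tangle: each point on the top is joined, around the right of the box, to the
point below it. -/
def trace (a : Color) : Tangle (fun _ : Unit => a) ⟨0, a.shaded⟩ :=
  ofStrings (Fin a.n)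
    (fun p => match p with
      | ⟨none, j⟩ => (Nat.not_lt_zero _ j.2).elim
      | ⟨some _, j⟩ => column (n := a.n) j)
    sameBase

/-- The contragredient: rotation of a `2`-box by a half turn. -/
def contra : Tangle (fun _ : Unit => (⟨2, false⟩ : Color)) ⟨2, false⟩ :=
  ofStrings (Fin 4)
    (fun p => match p with
      | ⟨none, j⟩ => (![0, 1, 2, 3] : Fin 4 → Fin 4) j
      | ⟨some _, j⟩ => (![2, 3, 0, 1] : Fin 4 → Fin 4) j)
    sameNone

/-- The coproduct of `2`-boxes: the input `0` on the left, the input `1` on the right; the two right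
points of the left box are joined to the two left points of the right box. -/
def coprod : Tangle (fun _ : Fin 2 => (⟨2, false⟩ : Color)) ⟨2, false⟩ :=
  ofStrings (Fin 6)
    (fun p => match p with
      | ⟨none, j⟩ => (![0, 1, 2, 3] : Fin 4 → Fin 6) j
      | ⟨some 0, j⟩ => (![0, 4, 5, 3] : Fin 4 → Fin 6) j
      | ⟨some 1, j⟩ => (![4, 1, 2, 5] : Fin 4 → Fin 6) j)
    sameNone

/-- A `2`-box, turned counterclockwise by a quarter, with a vertical string added on its left:
the points `0, 1, 2, 3` of the input are at the lower left, upper left, upper right and lower right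
of the turned box. -/
def box : Tangle (fun _ : Unit => (⟨2, false⟩ : Color)) ⟨3, false⟩ :=
  ofStrings (Fin 5)
    (fun p => match p with
      | ⟨none, j⟩ => (![4, 1, 2, 3, 0, 4] : Fin 6 → Fin 5) j
      | ⟨some _, j⟩ => (![0, 1, 2, 3] : Fin 4 → Fin 5) j)
    sameNone

end Tangle

/-! ### Planar algebras -/

universe u

/-- A planar `*`-algebra over `ℂ` with box spaces `V (n, ±)`: every planar tangle acts as a
multilinear map, compatibly with isotopy and gluing, and with an antilinear involution which
corresponds to the reflection of tangles. -/
structure PlanarStarAlgebra (V : Color → Type u) [∀ a, AddCommGroup (V a)] [∀ a, Module ℂ (V a)]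
    where
  act : ∀ {ι : Type} {c : ι → Color} {c₀ : Color} (T : Tangle c c₀), T.IsPlanar →
    MultilinearMap ℂ (fun i => V (c i)) (V c₀)
  act_isotopic : ∀ {ι ι' : Type} {c : ι → Color} {c₀ : Color} (σ : ι' ≃ ι)
    (T' : Tangle (fun i => c (σ i)) c₀) (T : Tangle c c₀) (hT' : T'.IsPlanar) (hT : T.IsPlanar),
    Tangle.IsIsotopic σ T' T →
    ∀ x : ∀ i, V (c i), act T' hT' (fun i => x (σ i)) = act T hT x
  act_ident : ∀ (a : Color) (h : (Tangle.ident a).IsPlanar) (x : V a),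
    act (Tangle.ident a) h (fun _ => x) = x
  act_gluing : ∀ {ι : Type} {c : ι → Color} {c₀ : Color} {κ : ι → Type} {d : ∀ i, κ i → Color}
    (T : Tangle c c₀) (S : ∀ i, Tangle (d i) (c i))
    (U : Tangle (fun p : (Σ i, κ i) => d p.1 p.2) c₀)
    (hT : T.IsPlanar) (hS : ∀ i, (S i).IsPlanar) (hU : U.IsPlanar), Tangle.IsGluing T S U →
    ∀ x : ∀ p : (Σ i, κ i), V (d p.1 p.2),
      act U hU x = act T hT (fun i => act (S i) (hS i) (fun k => x ⟨i, k⟩))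
  star : ∀ {a : Color}, V a →ₗ⋆[ℂ] V a
  star_star : ∀ {a : Color} (x : V a), star (star x) = x
  star_act : ∀ {ι : Type} {c : ι → Color} {c₀ : Color} (T : Tangle c c₀) (hT : T.IsPlanar)
    (hT' : T.mirror.IsPlanar) (x : ∀ i, V (c i)),
    star (act T hT x) = act T.mirror hT' (fun i => star (x i))

namespace PlanarStarAlgebra

variable {V : Color → Type u} [∀ a, AddCommGroup (V a)] [∀ a, Module ℂ (V a)]
  (S : PlanarStarAlgebra V)

open Classical in
/-- The action of a diagram (only meaningful for planar ones). -/
noncomputable def eval {ι : Type} {c : ι → Color} {c₀ : Color} (T : Tangle c c₀) :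
    MultilinearMap ℂ (fun i => V (c i)) (V c₀) :=
  if h : T.IsPlanar then S.act T h else 0

/-- The empty diagram in `V (0, ±)`. -/
noncomputable def emptyBox (b : Bool) : V ⟨0, b⟩ := S.eval (Tangle.empty b) (fun i => i.elim)

/-- The identification of the one-dimensional space `V (0, ±)` with `ℂ` for which the empty diagram
is `1`. -/
noncomputable def scalar {b : Bool} (v : V ⟨0, b⟩) : ℂ :=
  Classical.epsilon fun z : ℂ => z • S.emptyBox b = v

/-- The value of a closed circle. -/
noncomputable def δ : ℂ := S.scalar (S.eval Tangle.circle (fun i => i.elim))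

/-- The product of two `n`-boxes. -/
noncomputable def mul {a : Color} (x y : V a) : V a := S.eval (Tangle.mul a) ![x, y]

/-- The (unnormalized) Markov trace. -/
noncomputable def tr {a : Color} (x : V a) : ℂ := S.scalar (S.eval (Tangle.trace a) (fun _ => x))

/-- An irreducible subfactor planar algebra. -/
structure IsIrreducibleSubfactor : Prop where
  finite : ∀ a : Color, FiniteDimensional ℂ (V a)
  zero_box : ∀ b : Bool, Module.finrank ℂ (V ⟨0, b⟩) = 1
  one_box : ∀ b : Bool, Module.finrank ℂ (V ⟨1, b⟩) = 1
  spherical : ∀ {ι : Type} {c : ι → Color} {a b : Bool} (T : Tangle c ⟨0, a⟩) (T' : Tangle c ⟨0, b⟩)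
    (hT : T.IsPlanar) (hT' : T'.IsPlanar), Tangle.IsSphericallyIsotopic T T' →
    ∀ x : ∀ i, V (c i), S.scalar (S.act T hT x) = S.scalar (S.act T' hT' x)
  positive : ∀ {a : Color} (x : V a), x ≠ 0 → 0 < S.tr (S.mul (S.star x) x)

/-- The contragredient `a'` of a `2`-box. -/
noncomputable def contra (a : V ⟨2, false⟩) : V ⟨2, false⟩ := S.eval Tangle.contra (fun _ => a)

/-- The coproduct `a * b` of two `2`-boxes. -/
noncomputable def coprod (a b : V ⟨2, false⟩) : V ⟨2, false⟩ := S.eval Tangle.coprod ![a, b]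

/-- The element `1 ⊡ a` of the `3`-box space. -/
noncomputable def box (a : V ⟨2, false⟩) : V ⟨3, false⟩ := S.eval Tangle.box (fun _ => a)

/-- Projections of the `*`-algebra of `n`-boxes. -/
def IsProjection {a : Color} (p : V a) : Prop := S.mul p p = p ∧ S.star p = p

/-- Positive operators of the `*`-algebra of `n`-boxes. -/
def IsPositive {a : Color} (x : V a) : Prop := ∃ y : V a, x = S.mul (S.star y) y

/-- A biprojection: a nonzero projection `P` among the `2`-boxes such that `1 ⊡ P` is a multiple of
a projection in the algebra of all `1 ⊡ z`. -/
def IsBiprojection (P : V ⟨2, false⟩) : Prop :=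
  P ≠ 0 ∧ S.IsProjection P ∧
    ∃ (z : ℂ) (R : V ⟨2, false⟩), S.IsProjection (S.box R) ∧ S.box P = z • S.box R

/-- `P` is the biprojection generated by `y`: the smallest biprojection with `P y P = y`. -/
def IsGeneratedBiprojection (P y : V ⟨2, false⟩) : Prop :=
  S.IsBiprojection P ∧ S.mul (S.mul P y) P = y ∧
    ∀ R : V ⟨2, false⟩, S.IsBiprojection R → S.mul (S.mul R y) R = y → S.mul P R = P

/-- `1 ⊡ Q` is a minimal projection in the algebra of all `1 ⊡ z`. -/
def IsMinimalBox (Q : V ⟨2, false⟩) : Prop :=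
  S.IsProjection (S.box Q) ∧ S.box Q ≠ 0 ∧
    ∀ R : V ⟨2, false⟩, S.IsProjection (S.box R) → S.mul (S.box R) (S.box Q) = S.box R →
      S.box R = 0 ∨ S.box R = S.box Q

/-- The operator norm of an `n`-box, acting by left multiplication on the Hilbert space of `n`-boxes
with the inner product given by the Markov trace. -/
noncomputable def opNorm {a : Color} (x : V a) : ℝ :=
  sInf {C : ℝ | 0 ≤ C ∧ ∀ y : V a,
    (S.tr (S.mul (S.star (S.mul x y)) (S.mul x y))).re ≤ C ^ 2 * (S.tr (S.mul (S.star y) y)).re}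

/-- `p` is the spectral projection of the self-adjoint `n`-box `x` at the point `t`: in the action by
left multiplication, it is the orthogonal projection onto the eigenspace of `x` for `t`. -/
def IsSpectralProjection {a : Color} (p x : V a) (t : ℝ) : Prop :=
  S.IsProjection p ∧ ∀ y : V a, S.mul p y = y ↔ S.mul x y = (t : ℂ) • y

end PlanarStarAlgebra

end SubfactorPA

/-! Write w(x) = tr(x)/δ. The quarter turn `box` carries the coproduct to the product of `3`-boxes
and multiplies the trace inner product by δ. So the `2`-boxes, with the coproduct, are a *-algebra
whose unit is the cap-cup diagram, whose adjoint is x ↦ (x*)', and which acts on the Hilbert space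
of `2`-boxes by left convolution. A box Q with `box Q` a projection is a projection of this algebra.

The analytic input comes from a triangle of three `2`-boxes. By sphericality the inner product of
two such triangles is tr((s'*s * x'*x) v v'*). Positivity of the norm says that coproducts of
positive elements are positive. The Cauchy–Schwarz inequality gives ‖a * x‖ ≤ w(a)‖x‖ for positive a
(`Nonneg.norm_co_le`). Here `coprod_one`, a consequence of irreducibility, evaluates a * 1 = w(a)1.
Hence w(a) bounds convolution by a, and the conditions on Q say that this bound is attained on Q.
The equality case of Cauchy–Schwarz gives the equivalence of (2), (3) and (4).

Let b = A + A'. The ergodic averages of (id + b * ·)/(1 + w(b)), applied to the unit of the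
coproduct, converge to the projection e onto the eigenspace of w(b), so e is positive
(`exists_coproj`). A second use of the triangle inequality gives e ≤ μ with μ = ‖e‖²/δ. Comparing
traces forces e(μ - e) = 0 and A(μ - e) = 0, so r = e/μ is a biprojection with rAr = A
(`IsCoproj.exists_isBiproj`). By minimality P ≤ r. Conversely PAP = A implies P * A = w(A)P
(`IsBiproj.co_eq`), so P lies in the eigenspace and e * P = P. The same fact for r and P gives r * P
= w(P)r, whence P = w(P)e. This is the spectral statement, and it yields (4) ⇒ (1). For (1) ⇒ (2),
convolve Q * P = w(P)Q with A and use P * A = w(A)P.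

The diagrammatic identities are reduced to computation. Most tangles are encoded by finite tables,
and planarity and gluing of tables are decidable (`Code.Check`, `Code.Glues`, `ev_glue`). An
identity is proved by gluing both sides to one common table. -/

namespace SubfactorPA

open Relation

/-! ### Connected components of finite graphs -/

/-- Merge the classes of the two ends of an edge. -/
def mergeLabels (L : List ℕ) (e : ℕ × ℕ) : List ℕ :=
  bif L.getD e.1 0 == L.getD e.2 0 then L else
    L.map fun x => bif x == L.getD e.2 0 then L.getD e.1 0 else x

/-- A list of labels of the vertices `0, …, N - 1`, equal exactly on connected components. -/
def labels (N : ℕ) (E : List (ℕ × ℕ)) : List ℕ := E.foldl mergeLabels (List.range N)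

theorem mergeLabels_length (L : List ℕ) (e : ℕ × ℕ) : (mergeLabels L e).length = L.length := by
  unfold mergeLabels
  cases L.getD e.1 0 == L.getD e.2 0 <;> simp

theorem mergeLabels_getD {L : List ℕ} {e : ℕ × ℕ} {x : ℕ} (hx : x < L.length) :
    (mergeLabels L e).getD x 0 =
      if L.getD x 0 = L.getD e.2 0 then L.getD e.1 0 else L.getD x 0 := by
  unfold mergeLabels
  by_cases h' : L.getD e.1 0 = L.getD e.2 0
  · rw [h', beq_self_eq_true, cond_true]
    split_ifs with h
    · exact h
    · rfl
  · rw [beq_eq_false_iff_ne.2 h', cond_false,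
      List.getD_eq_getElem _ _ (by simpa using hx), List.getElem_map, List.getD_eq_getElem _ _ hx]
    by_cases h : L[x] = L.getD e.2 0 <;> simp [h]

/-- One new edge fuses exactly the classes of its two ends, so overwriting one label by the other
keeps the labels faithful to the generated equivalence. -/
theorem merge_iff {α : Type*} {R : α → α → Prop} {l : α → ℕ}
    (hl : ∀ x y, l x = l y ↔ EqvGen R x y) (a b : α) (x y : α) :
    ((if l x = l b then l a else l x) = (if l y = l b then l a else l y)) ↔
      EqvGen (fun u v => R u v ∨ (u = a ∧ v = b)) x y := by
  have mono : ∀ {u v}, l u = l v → EqvGen (fun u v => R u v ∨ (u = a ∧ v = b)) u v := by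
    intro u v h
    exact EqvGen.mono (r := R) (fun _ _ => Or.inl) _ _ ((hl u v).1 h)
  have hab : EqvGen (fun u v => R u v ∨ (u = a ∧ v = b)) a b := EqvGen.rel _ _ (Or.inr ⟨rfl, rfl⟩)
  constructor
  · intro h
    split_ifs at h with h1 h2 h2
    · exact mono (h1.trans h2.symm)
    · exact ((mono h1).trans _ _ _ (hab.symm _ _)).trans _ _ _ (mono h)
    · exact (mono h).trans _ _ _ (hab.trans _ _ _ (mono h2.symm))
    · exact mono h
  · intro h
    induction h with
    | rel u v h =>
      rcases h with h | ⟨rfl, rfl⟩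
      · rw [(hl u v).2 (EqvGen.rel _ _ h)]
      · by_cases h : l u = l v <;> simp [h]
    | refl => rfl
    | symm _ _ _ ih => exact ih.symm
    | trans _ _ _ _ _ ih1 ih2 => exact ih1.trans ih2

/-- This makes a finitely generated equivalence relation computable. It is used for boundary
circles, for regions, for connectedness and for the strings joined by gluing. -/
theorem labels_iff {α : Type*} {enc : α → ℕ} (hinj : Function.Injective enc) {N : ℕ}
    (hN : ∀ x, enc x < N) (E : List (α × α)) (x y : α) :
    (labels N (E.map (Prod.map enc enc))).getD (enc x) 0 =
        (labels N (E.map (Prod.map enc enc))).getD (enc y) 0 ↔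
      EqvGen (fun u v => (u, v) ∈ E) x y := by
  -- The induction needs an arbitrary initial labelling `L`, faithful to the edges `F` that have
  -- already been processed.
  suffices h : ∀ (E F : List (α × α)) (L : List ℕ), L.length = N →
      (∀ x y, L.getD (enc x) 0 = L.getD (enc y) 0 ↔ EqvGen (fun u v => (u, v) ∈ F) x y) →
      ∀ x y, ((E.map (Prod.map enc enc)).foldl mergeLabels L).getD (enc x) 0 =
        ((E.map (Prod.map enc enc)).foldl mergeLabels L).getD (enc y) 0 ↔
      EqvGen (fun u v => (u, v) ∈ F ∨ (u, v) ∈ E) x y by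
    have := h E [] (List.range N) (by simp) (by
      intro x y
      rw [List.getD_eq_getElem _ _ (by simpa using hN x),
        List.getD_eq_getElem _ _ (by simpa using hN y)]
      simp only [List.getElem_range, hinj.eq_iff]
      constructor
      · rintro rfl
        exact EqvGen.refl _
      · intro h
        induction h with
        | rel u v h => simp at h
        | refl => rfl
        | symm _ _ _ ih => exact ih.symm
        | trans _ _ _ _ _ ih1 ih2 => exact ih1.trans ih2) x y
    simpa [labels] using this
  intro E
  induction E with
  | nil => intro F L _ hL x y; simpa using hL x y
  | cons e E ih =>
    intro F L hlen hL x y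
    rw [List.map_cons, List.foldl_cons,
      ih (e :: F) _ (by rw [mergeLabels_length, hlen]) (fun x y => ?_) x y]
    · simp only [List.mem_cons]
      have : (fun u v : α => ((u, v) = e ∨ (u, v) ∈ F) ∨ (u, v) ∈ E) =
          fun u v => (u, v) ∈ F ∨ (u, v) = e ∨ (u, v) ∈ E := by
        ext u v; tauto
      rw [this]
    · rw [mergeLabels_getD (by rw [hlen]; exact hN x), mergeLabels_getD (by rw [hlen]; exact hN y)]
      obtain ⟨a, b⟩ := e
      have := merge_iff (l := fun x => L.getD (enc x) 0) hL a b x y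
      simp only [Prod.map_fst, Prod.map_snd]
      rw [this]
      have : (fun u v : α => (u, v) ∈ F ∨ u = a ∧ v = b) = fun u v => (u, v) ∈ (a, b) :: F := by
        ext u v; simp [or_comm]
      rw [this]

/-- Turns the cardinals of quotients in the Euler formula into lengths of lists, which the kernel
can evaluate. -/
theorem card_quot_of_labels {α : Type*} {r : α → α → Prop} {f : α → ℕ} {E : List α}
    (hE : ∀ x, x ∈ E) (hf : ∀ x y, f x = f y ↔ EqvGen r x y) :
    Nat.card (Quot r) = (E.map f).dedup.length := by
  let F : Quot r → (E.map f).toFinset := Quot.lift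
    (fun x => ⟨f x, by simpa using ⟨x, hE x, rfl⟩⟩)
    (fun x y h => Subtype.ext ((hf x y).2 (EqvGen.rel _ _ h)))
  have hF : Function.Bijective F := by
    constructor
    · rintro ⟨x⟩ ⟨y⟩ h
      exact Quot.eqvGen_sound ((hf x y).1 (congrArg Subtype.val h))
    · rintro ⟨n, hn⟩
      obtain ⟨x, -, rfl⟩ := by simpa using hn
      exact ⟨Quot.mk _ x, rfl⟩
  rw [Nat.card_congr (Equiv.ofBijective F hF), Nat.card_eq_fintype_card, Fintype.card_coe,
    List.card_toFinset]

/-! ### Tangles given by tables -/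

/-- A tangle all of whose input discs have the same colour `b`, given by tables: `m` is the number
of input discs, the strings are numbered `0, …, k`, and the tables `out` and `inp` contain the
strings at the marked points. Two edges lie on the same region if they are joined by corners and by
the pairs in `same`. -/
structure Code (b a : Color) where
  m : ℕ
  k : ℕ
  out : List ℕ
  inp : List (List ℕ)
  same : List (Edge (fun _ : Fin m => b) a (Fin (k + 1)) ×
    Edge (fun _ : Fin m => b) a (Fin (k + 1)))

namespace Code

variable {a b c : Color}

abbrev Pt (C : Code b a) : Type := Point (fun _ : Fin C.m => b) a

abbrev Ed (C : Code b a) : Type := Edge (fun _ : Fin C.m => b) a (Fin (C.k + 1))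

/-- The string at a marked point. -/
def str (C : Code b a) : C.Pt → Fin (C.k + 1)
  | ⟨none, j⟩ => Fin.ofNat _ (C.out.getD j 0)
  | ⟨some i, j⟩ => Fin.ofNat _ ((C.inp.getD i []).getD j 0)

/-- The relation generating the regions. -/
def Rel (C : Code b a) (e e' : C.Ed) : Prop := Corner C.str e e' ∨ (e, e') ∈ C.same

/-- The tangle given by tables. -/
def tangle (C : Code b a) : Tangle (fun _ : Fin C.m => b) a where
  Str := Fin (C.k + 1)
  Reg := Quot C.Rel
  str := C.str
  reg := Quot.mk _

/-- Numbering of the edges. -/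
def enc (C : Code b a) : C.Ed → ℕ
  | Sum.inr (s, x) => 2 * s + x.toNat
  | Sum.inl ⟨none, j⟩ => 2 * (C.k + 1) + j
  | Sum.inl ⟨some i, j⟩ => 2 * (C.k + 1) + (2 * a.n + 1) + ((2 * b.n + 1) * i + j)

def size (C : Code b a) : ℕ := 2 * (C.k + 1) + (2 * a.n + 1) + (2 * b.n + 1) * C.m

theorem enc_lt (C : Code b a) (e : C.Ed) : C.enc e < C.size := by
  rcases e with ⟨_ | i, j⟩ | ⟨s, x⟩
  · have := j.2
    simp only [enc, size, discColor] at *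
    omega
  · have h1 := j.2
    have h2 := i.2
    simp only [enc, size, discColor] at *
    have : (2 * b.n + 1) * (i + 1) ≤ (2 * b.n + 1) * C.m := Nat.mul_le_mul_left _ h2
    rw [mul_add] at this
    omega
  · have := s.2
    have hx : x.toNat < 2 := by cases x <;> simp
    simp only [enc, size]
    omega

theorem enc_injective (C : Code b a) : Function.Injective C.enc := by
  rintro (⟨_ | i, j⟩ | ⟨s, x⟩) (⟨_ | i', j'⟩ | ⟨s', x'⟩) h
  · simp only [enc] at h
    have : j = j' := Fin.ext (by omega)
    rw [this]
  · have := j.2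
    simp only [enc, discColor] at *
    omega
  · have := s'.2
    have hx : x'.toNat < 2 := by cases x' <;> simp
    simp only [enc] at h
    omega
  · have := j'.2
    simp only [enc, discColor] at *
    omega
  · have h1 : j.val < 2 * b.n + 1 := j.2
    have h2 : j'.val < 2 * b.n + 1 := j'.2
    simp only [enc] at h
    have h3 : (2 * b.n + 1) * i.val + j.val = (2 * b.n + 1) * i'.val + j'.val := by omega
    have hi : i.val = i'.val := by
      have := congrArg (· / (2 * b.n + 1)) h3
      simpa [Nat.mul_add_div, Nat.div_eq_of_lt h1, Nat.div_eq_of_lt h2] using this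
    obtain rfl : i = i' := Fin.ext hi
    have : j = j' := Fin.ext (by omega)
    rw [this]
  · have := s'.2
    have hx : x'.toNat < 2 := by cases x' <;> simp
    simp only [enc] at h
    omega
  · have := s.2
    have hx : x.toNat < 2 := by cases x <;> simp
    simp only [enc] at h
    omega
  · have := s.2
    have hx : x.toNat < 2 := by cases x <;> simp
    simp only [enc] at h
    omega
  · have hx : x.toNat < 2 := by cases x <;> simp
    have hx' : x'.toNat < 2 := by cases x' <;> simp
    simp only [enc] at h
    have h1 : s = s' := Fin.ext (by omega)
    have h2 : x = x' := by
      have : x.toNat = x'.toNat := by omega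
      revert this; cases x <;> cases x' <;> simp
    rw [h1, h2]

def discs (C : Code b a) : List (Option (Fin C.m)) := none :: (List.finRange C.m).map some

theorem mem_discs (C : Code b a) (d : Option (Fin C.m)) : d ∈ C.discs := by
  cases d <;> simp [discs]

def pts (C : Code b a) : List C.Pt := C.discs.flatMap fun d => (List.finRange _).map (Sigma.mk d)

theorem mem_pts (C : Code b a) (p : C.Pt) : p ∈ C.pts := by
  simp only [pts, List.mem_flatMap, List.mem_map]
  exact ⟨p.1, C.mem_discs _, p.2, List.mem_finRange _, rfl⟩

def edges (C : Code b a) : List C.Ed :=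
  (List.finRange (C.k + 1)).flatMap (fun s => [Sum.inr (s, false), Sum.inr (s, true)]) ++
    C.discs.flatMap fun d => (List.finRange _).map fun j => Sum.inl ⟨d, j⟩

theorem mem_edges (C : Code b a) (e : C.Ed) : e ∈ C.edges := by
  simp only [edges, List.mem_append, List.mem_flatMap, List.mem_map]
  rcases e with I | ⟨s, x⟩
  · exact Or.inr ⟨I.1, C.mem_discs _, I.2, List.mem_finRange _, rfl⟩
  · exact Or.inl ⟨s, List.mem_finRange _, by cases x <;> simp⟩

/-- The list of corners. -/
def corners (C : Code b a) : List (C.Ed × C.Ed) :=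
  C.pts.flatMap (fun p =>
    [(Sum.inl p.before, Sum.inr (C.str p, Interval.shade p.before)),
     (Sum.inl p.after, Sum.inr (C.str p, Interval.shade p.after))]) ++
  C.discs.map fun d => (Sum.inl ⟨d, 0⟩, Sum.inl ⟨d, Fin.last _⟩)

theorem mem_corners (C : Code b a) (e e' : C.Ed) : (e, e') ∈ C.corners ↔ Corner C.str e e' := by
  simp only [corners, List.mem_append, List.mem_flatMap, List.mem_map, List.mem_cons,
    List.not_mem_nil, or_false, Prod.mk.injEq]
  constructor
  · rintro (⟨p, -, ⟨rfl, rfl⟩ | ⟨rfl, rfl⟩⟩ | ⟨d, -, rfl, rfl⟩)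
    · exact Corner.before p
    · exact Corner.after p
    · exact Corner.close d
  · rintro (p | p | d)
    · exact Or.inl ⟨p, C.mem_pts p, Or.inl ⟨rfl, rfl⟩⟩
    · exact Or.inl ⟨p, C.mem_pts p, Or.inr ⟨rfl, rfl⟩⟩
    · exact Or.inr ⟨d, C.mem_discs d, rfl, rfl⟩

/-- Label of the boundary circle of an edge. -/
def circ (C : Code b a) (e : C.Ed) : ℕ :=
  (labels C.size (C.corners.map (Prod.map C.enc C.enc))).getD (C.enc e) 0

/-- Label of the region of an edge. -/
def lab (C : Code b a) (e : C.Ed) : ℕ :=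
  (labels C.size ((C.corners ++ C.same).map (Prod.map C.enc C.enc))).getD (C.enc e) 0

/-- The sides of the strings. -/
def crossings (C : Code b a) : List (C.Ed × C.Ed) :=
  (List.finRange (C.k + 1)).map fun s => (Sum.inr (s, false), Sum.inr (s, true))

/-- Label of the connected component of an edge. -/
def comp (C : Code b a) (e : C.Ed) : ℕ :=
  (labels C.size (((C.corners ++ C.same) ++ C.crossings).map (Prod.map C.enc C.enc))).getD
    (C.enc e) 0

theorem circ_iff (C : Code b a) (e e' : C.Ed) :
    C.circ e = C.circ e' ↔ EqvGen (Corner C.str) e e' := by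
  rw [circ, circ, labels_iff C.enc_injective C.enc_lt]
  simp only [mem_corners]

theorem lab_iff (C : Code b a) (e e' : C.Ed) : C.lab e = C.lab e' ↔ EqvGen C.Rel e e' := by
  rw [lab, lab, labels_iff C.enc_injective C.enc_lt]
  simp only [List.mem_append, mem_corners]
  rfl

theorem reg_eq_iff (C : Code b a) (e e' : C.Ed) :
    C.tangle.reg e = C.tangle.reg e' ↔ C.lab e = C.lab e' := by
  rw [lab_iff]
  exact Quot.eq

theorem Corner.shade_eq {ι : Type} {c : ι → Color} {c₀ : Color} {Str : Type}
    {str : Point c c₀ → Str} {e e' : Edge c c₀ Str} (h : Corner str e e') :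
    e.shade = e'.shade := by
  rcases h with p | p | d
  · rfl
  · rfl
  · simp [Edge.shade, Interval.shade]

/-- The planarity check. -/
def Check (C : Code b a) : Prop :=
  (∀ s : Fin (C.k + 1), (C.pts.filter fun p => C.str p == s) = [] ∨
    ((C.pts.filter fun p => C.str p == s && p.isSource).length = 1 ∧
    (C.pts.filter fun p => C.str p == s && !p.isSource).length = 1)) ∧
  (∀ q ∈ C.same, q.1.shade = q.2.shade) ∧
  (∀ e ∈ C.edges, C.comp e = C.comp (Sum.inl ⟨none, 0⟩)) ∧
  (C.m + 1 + 2 * (C.edges.map C.lab).dedup.length = 2 +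
    ((List.finRange (C.k + 1)).filter fun s => C.pts.any fun p => C.str p == s).length +
    (C.edges.map C.circ).dedup.length)

instance (C : Code b a) : Decidable C.Check := by unfold Check; infer_instance

theorem existsUnique_of_filter {α : Type*} {l : List α} (hl : ∀ x, x ∈ l) {q : α → Bool}
    (h : (l.filter q).length = 1) : ∃! x, q x = true := by
  obtain ⟨x, hx⟩ := List.length_eq_one_iff.1 h
  refine ⟨x, ?_, fun y hy => ?_⟩
  · have : x ∈ l.filter q := by rw [hx]; simp
    exact (List.mem_filter.1 this).2
  · have : y ∈ l.filter q := List.mem_filter.2 ⟨hl y, hy⟩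
    rw [hx] at this
    simpa using this

/-- Corners and the pairs in `same` preserve the shade, so the shading descends to regions. The
other conditions are read off from the computed labels, and planarity of a concrete table becomes a
kernel computation. -/
theorem isPlanar (C : Code b a) (h : C.Check) : C.tangle.IsPlanar := by
  obtain ⟨h1, h2, h3, h4⟩ := h
  have hshade : ∀ e e', C.Rel e e' → e.shade = e'.shade := by
    rintro e e' (h | h)
    · exact Corner.shade_eq h
    · exact h2 _ h
  refine ⟨inferInstance, inferInstanceAs (Finite (Fin _)), ?_, ?_, ?_, ?_, ?_, ?_⟩
  · have : Finite C.Ed := Finite.of_injective (fun e => (⟨C.enc e, C.enc_lt e⟩ : Fin C.size))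
      fun x y h => C.enc_injective (congrArg Fin.val h)
    exact inferInstanceAs (Finite (Quot _))
  · intro (s : Fin (C.k + 1))
    change (∀ p, C.str p ≠ s) ∨
      (∃! p, C.str p = s ∧ p.isSource = true) ∧ (∃! p, C.str p = s ∧ p.isSource = false)
    rcases h1 s with h | ⟨h, h'⟩
    · left
      intro p hp
      have : p ∈ C.pts.filter fun p => C.str p == s :=
        List.mem_filter.2 ⟨C.mem_pts p, by simpa using hp⟩
      rw [h] at this
      simp at this
    · right
      have := existsUnique_of_filter C.mem_pts h
      have := existsUnique_of_filter C.mem_pts h'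
      simp only [Bool.and_eq_true, beq_iff_eq, Bool.not_eq_true'] at *
      exact ⟨by assumption, by assumption⟩
  · intro e e' h
    exact Quot.sound (Or.inl h)
  · exact ⟨Quot.lift Edge.shade hshade, fun _ => rfl⟩
  · have key : ∀ e e' : C.Ed, EqvGen (fun u v => (u, v) ∈ (C.corners ++ C.same) ++ C.crossings) e e' →
        EqvGen (fun a b => ∃ s, a = C.tangle.reg (Sum.inr (s, false)) ∧
          b = C.tangle.reg (Sum.inr (s, true))) (C.tangle.reg e) (C.tangle.reg e') := by
      intro e e' h
      induction h with
      | rel u v h =>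
        rw [List.mem_append, List.mem_append, mem_corners] at h
        rcases h with h | h
        · rw [show C.tangle.reg u = C.tangle.reg v from Quot.sound h]
          exact EqvGen.refl _
        · simp only [crossings, List.mem_map, Prod.mk.injEq] at h
          obtain ⟨s, -, rfl, rfl⟩ := h
          exact EqvGen.rel _ _ ⟨s, rfl, rfl⟩
      | refl => exact EqvGen.refl _
      | symm _ _ _ ih => exact ih.symm
      | trans _ _ _ _ _ ih1 ih2 => exact ih1.trans _ _ _ ih2
    rintro ⟨e⟩ ⟨e'⟩
    refine key e e' ?_
    rw [← labels_iff C.enc_injective C.enc_lt]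
    exact (h3 e (C.mem_edges e)).trans (h3 e' (C.mem_edges e')).symm
  · have e1 : Nat.card (Option (Fin C.m)) = C.m + 1 := by simp
    have e2 : Nat.card C.tangle.Reg = (C.edges.map C.lab).dedup.length :=
      card_quot_of_labels C.mem_edges C.lab_iff
    have e3 : Nat.card (Quot (Corner C.tangle.str)) = (C.edges.map C.circ).dedup.length :=
      card_quot_of_labels C.mem_edges C.circ_iff
    have e4 : Nat.card {s : Fin (C.k + 1) // ∃ p, C.str p = s} =
        ((List.finRange (C.k + 1)).filter fun s => C.pts.any fun p => C.str p == s).length := by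
      rw [← List.toFinset_card_of_nodup ((List.nodup_finRange _).filter _)]
      refine Nat.subtype_card _ fun s => ?_
      simp only [List.mem_toFinset, List.mem_filter, List.mem_finRange, true_and, List.any_eq_true,
        beq_iff_eq]
      exact ⟨fun ⟨p, _, hp⟩ => ⟨p, hp⟩, fun ⟨p, hp⟩ => ⟨p, C.mem_pts p, hp⟩⟩
    rw [e1, e2, e3]
    exact h4.trans (by rw [← e4]; rfl)

end Code

/-! ### Transport of planarity -/

/-- Generators need to correspond only up to the generated equivalence. This allows different lists
of identifications, and corners whose direction is reversed by a reflection. -/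
theorem exists_quot_equiv {E E' : Type*} {r : E → E → Prop} {r' : E' → E' → Prop} {ψ : E' → E}
    (hψ : Function.Bijective ψ) (h : ∀ u v, r' u v → EqvGen r (ψ u) (ψ v))
    (h' : ∀ e e', r e e' → ∃ u u', ψ u = e ∧ ψ u' = e' ∧ EqvGen r' u u') :
    ∃ g : Quot r' ≃ Quot r, ∀ u, g (Quot.mk r' u) = Quot.mk r (ψ u) := by
  have key : ∀ e e', EqvGen r e e' → ∀ u v, ψ u = e → ψ v = e' → EqvGen r' u v := by
    intro e e' h
    induction h with
    | rel e e' h =>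
      rintro u v hu hv
      obtain ⟨x, y, rfl, rfl, hxy⟩ := h' e e' h
      rwa [hψ.1 hu, hψ.1 hv]
    | refl e =>
      rintro u v rfl hv
      rw [hψ.1 hv]
      exact EqvGen.refl _
    | symm _ _ _ ih => exact fun u v hu hv => (ih v u hv hu).symm
    | trans x y z _ _ ih1 ih2 =>
      intro u v hu hv
      obtain ⟨w, hw⟩ := hψ.2 y
      exact (ih1 u w hu hw).trans _ _ _ (ih2 w v hw hv)
  refine ⟨Equiv.ofBijective (Quot.lift (fun u => Quot.mk r (ψ u))
    fun u v huv => Quot.eqvGen_sound (h u v huv)) ⟨?_, ?_⟩, fun _ => rfl⟩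
  · rintro ⟨u⟩ ⟨v⟩ huv
    exact Quot.eqvGen_sound (key _ _ (Quot.eqvGen_exact huv) u v rfl rfl)
  · rintro ⟨e⟩
    obtain ⟨u, rfl⟩ := hψ.2 e
    exact ⟨Quot.mk _ u, rfl⟩

/-- A common form for renumbering the discs and for reflection. A reflection interchanges the
sources and targets of the strings, which is recorded by `flip`. -/
theorem Tangle.IsPlanar.transfer {ι ι' : Type} {c : ι → Color} {c' : ι' → Color}
    {c₀ c₀' : Color} {T : Tangle c c₀} {T' : Tangle c' c₀'} (hT : T.IsPlanar)
    (σ : ι' ≃ ι) (φ : Point c' c₀' → Point c c₀) (hφ : Function.Bijective φ)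
    (ψ : Edge c' c₀' T'.Str → Edge c c₀ T.Str) (hψ : Function.Bijective ψ)
    (f : T'.Str ≃ T.Str) (g : T'.Reg ≃ T.Reg) (flip : Bool)
    (hstr : ∀ p, f (T'.str p) = T.str (φ p))
    (hsrc : ∀ p, (φ p).isSource = xor flip p.isSource)
    (hreg : ∀ e, g (T'.reg e) = T.reg (ψ e))
    (hshade : ∀ e, (ψ e).shade = e.shade)
    (hside : ∀ s x, ψ (Sum.inr (s, x)) = Sum.inr (f s, x))
    (hc : ∀ u v, Corner T'.str u v → EqvGen (Corner T.str) (ψ u) (ψ v))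
    (hc' : ∀ e e', Corner T.str e e' → ∃ u u', ψ u = e ∧ ψ u' = e' ∧ EqvGen (Corner T'.str) u u') :
    T'.IsPlanar := by
  have corner : ∀ u v, EqvGen (Corner T.str) u v → T.reg u = T.reg v := by
    intro u v h
    induction h with
    | rel u v h => exact hT.corner u v h
    | refl => rfl
    | symm _ _ _ ih => exact ih.symm
    | trans _ _ _ _ _ ih1 ih2 => exact ih1.trans ih2
  have hstr' : ∀ p s, T'.str p = s ↔ T.str (φ p) = f s := by
    intro p s
    rw [← hstr, f.injective.eq_iff]
  have huniq : ∀ (s : T'.Str) (x : Bool), (∃! p, T.str p = f s ∧ p.isSource = x) →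
      ∃! p, T'.str p = s ∧ p.isSource = xor flip x := by
    rintro s x ⟨q, ⟨hq1, hq2⟩, hq⟩
    obtain ⟨p, rfl⟩ := hφ.2 q
    refine ⟨p, ⟨(hstr' p s).2 hq1, ?_⟩, ?_⟩
    · rw [hsrc] at hq2
      rw [← hq2]
      simp
    · rintro p' ⟨h1, h2⟩
      apply hφ.1
      apply hq
      refine ⟨(hstr' p' s).1 h1, ?_⟩
      rw [hsrc, h2]
      simp
  refine ⟨?_, ?_, ?_, ?_, ?_, ?_, ?_, ?_⟩
  · have := hT.finite_discs
    exact Finite.of_equiv _ σ.symm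
  · have := hT.finite_str
    exact Finite.of_equiv _ f.symm
  · have := hT.finite_reg
    exact Finite.of_equiv _ g.symm
  · intro s
    rcases hT.ends (f s) with h | ⟨h1, h2⟩
    · left
      intro p hp
      exact h (φ p) ((hstr' p s).1 hp)
    · right
      have h1 := huniq s _ h1
      have h2 := huniq s _ h2
      cases flip
      · exact ⟨h1, h2⟩
      · exact ⟨h2, h1⟩
  · intro e e' h
    apply g.injective
    rw [hreg, hreg]
    exact corner _ _ (hc _ _ h)
  · obtain ⟨sh, hsh⟩ := hT.shading
    exact ⟨fun r => sh (g r), fun e => by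
      change sh (g (T'.reg e)) = _
      rw [hreg, hsh, hshade]⟩
  · intro r r'
    have key : ∀ x y, EqvGen (fun a b => ∃ s, a = T.reg (Sum.inr (s, false)) ∧
        b = T.reg (Sum.inr (s, true))) x y →
        EqvGen (fun a b => ∃ s, a = T'.reg (Sum.inr (s, false)) ∧
        b = T'.reg (Sum.inr (s, true))) (g.symm x) (g.symm y) := by
      intro x y h
      induction h with
      | rel u v h =>
        obtain ⟨s, rfl, rfl⟩ := h
        refine EqvGen.rel _ _ ⟨f.symm s, ?_, ?_⟩ <;>
        · rw [Equiv.symm_apply_eq, hreg, hside, Equiv.apply_symm_apply]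
      | refl => exact EqvGen.refl _
      | symm _ _ _ ih => exact ih.symm
      | trans _ _ _ _ _ ih1 ih2 => exact ih1.trans _ _ _ ih2
    simpa using key _ _ (hT.connected (g r) (g r'))
  · have e1 : Nat.card (Option ι') = Nat.card (Option ι) := Nat.card_congr σ.optionCongr
    have e2 : Nat.card T'.Reg = Nat.card T.Reg := Nat.card_congr g
    have e3 : Nat.card (Quot (Corner T'.str)) = Nat.card (Quot (Corner T.str)) :=
      Nat.card_congr (exists_quot_equiv hψ hc hc').choose
    have e4 : Nat.card {s : T'.Str // ∃ p, T'.str p = s} =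
        Nat.card {s : T.Str // ∃ p, T.str p = s} := by
      refine Nat.card_congr (f.subtypeEquiv fun s => ?_)
      constructor
      · rintro ⟨p, hp⟩
        exact ⟨φ p, (hstr' p s).1 hp⟩
      · rintro ⟨q, hq⟩
        obtain ⟨p, rfl⟩ := hφ.2 q
        exact ⟨p, (hstr' p s).2 hq⟩
    rw [e1, e2, e3, e4]
    exact hT.euler

section reindex

variable {ι ι' : Type} {c : ι → Color} {c₀ : Color} (σ : ι' ≃ ι)

/-- Renumbering of points. -/
def pointMap : Point (fun i => c (σ i)) c₀ → Point c c₀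
  | ⟨none, j⟩ => ⟨none, j⟩
  | ⟨some i, j⟩ => ⟨some (σ i), j⟩

theorem pointMap_bijective : Function.Bijective (pointMap (c := c) (c₀ := c₀) σ) := by
  constructor
  · rintro ⟨_ | i, j⟩ ⟨_ | i', j'⟩ h
    · have h : (⟨none, j⟩ : Point c c₀) = ⟨none, j'⟩ := h
      rw [sigma_mk_injective h]
    · cases h
    · cases h
    · have h : (⟨some (σ i), j⟩ : Point c c₀) = ⟨some (σ i'), j'⟩ := h
      obtain rfl : i = i' := σ.injective (Option.some.inj (congrArg Sigma.fst h))
      rw [sigma_mk_injective h]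
  · rintro ⟨_ | i, j⟩
    · exact ⟨⟨none, j⟩, rfl⟩
    · obtain ⟨i, rfl⟩ := σ.surjective i
      exact ⟨⟨some i, j⟩, rfl⟩

/-- Renumbering of edges. -/
def edgeMap {Str Str' : Type} (f : Str' → Str) :
    Edge (fun i => c (σ i)) c₀ Str' → Edge c c₀ Str
  | Sum.inl ⟨none, j⟩ => Sum.inl ⟨none, j⟩
  | Sum.inl ⟨some i, j⟩ => Sum.inl ⟨some (σ i), j⟩
  | Sum.inr (s, x) => Sum.inr (f s, x)

theorem edgeMap_bijective {Str Str' : Type} {f : Str' → Str} (hf : Function.Bijective f) :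
    Function.Bijective (edgeMap (c := c) (c₀ := c₀) σ f) := by
  constructor
  · rintro (⟨_ | i, j⟩ | ⟨s, x⟩) (⟨_ | i', j'⟩ | ⟨s', x'⟩) h
    · have h : (⟨none, j⟩ : Interval c c₀) = ⟨none, j'⟩ := Sum.inl_injective h
      rw [sigma_mk_injective h]
    · cases h
    · cases h
    · cases h
    · have h : (⟨some (σ i), j⟩ : Interval c c₀) = ⟨some (σ i'), j'⟩ := Sum.inl_injective h
      obtain rfl : i = i' := σ.injective (Option.some.inj (congrArg Sigma.fst h))
      rw [sigma_mk_injective h]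
    · cases h
    · cases h
    · cases h
    · simp only [edgeMap, Sum.inr.injEq, Prod.mk.injEq] at h
      rw [hf.1 h.1, h.2]
  · rintro (⟨_ | i, j⟩ | ⟨s, x⟩)
    · exact ⟨Sum.inl ⟨none, j⟩, rfl⟩
    · obtain ⟨i, rfl⟩ := σ.surjective i
      exact ⟨Sum.inl ⟨some i, j⟩, rfl⟩
    · obtain ⟨s, rfl⟩ := hf.2 s
      exact ⟨Sum.inr (s, x), rfl⟩

theorem corner_edgeMap {Str Str' : Type} {f : Str' → Str}
    {str' : Point (fun i => c (σ i)) c₀ → Str'} {str : Point c c₀ → Str}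
    (h : ∀ p, f (str' p) = str (pointMap σ p)) {u v : Edge (fun i => c (σ i)) c₀ Str'}
    (huv : Corner str' u v) : Corner str (edgeMap σ f u) (edgeMap σ f v) := by
  rcases huv with p | p | d
  · obtain ⟨_ | i, j⟩ := p
    · have := Corner.before (str := str) ⟨none, j⟩
      rw [show str ⟨none, j⟩ = f (str' ⟨none, j⟩) from (h ⟨_, j⟩).symm] at this
      exact this
    · have := Corner.before (str := str) ⟨some (σ i), j⟩
      rw [show str ⟨some (σ i), j⟩ = f (str' ⟨some i, j⟩) from (h ⟨_, j⟩).symm] at this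
      exact this
  · obtain ⟨_ | i, j⟩ := p
    · have := Corner.after (str := str) ⟨none, j⟩
      rw [show str ⟨none, j⟩ = f (str' ⟨none, j⟩) from (h ⟨_, j⟩).symm] at this
      exact this
    · have := Corner.after (str := str) ⟨some (σ i), j⟩
      rw [show str ⟨some (σ i), j⟩ = f (str' ⟨some i, j⟩) from (h ⟨_, j⟩).symm] at this
      exact this
  · rcases d with _ | i
    · exact Corner.close none
    · exact Corner.close (some (σ i))

theorem exists_corner_edgeMap {Str Str' : Type} {f : Str' → Str}
    {str' : Point (fun i => c (σ i)) c₀ → Str'} {str : Point c c₀ → Str}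
    (h : ∀ p, f (str' p) = str (pointMap σ p)) {e e' : Edge c c₀ Str} (he : Corner str e e') :
    ∃ u u', edgeMap σ f u = e ∧ edgeMap σ f u' = e' ∧ Corner str' u u' := by
  rcases he with p | p | d
  · obtain ⟨p, rfl⟩ := (pointMap_bijective σ).2 p
    refine ⟨_, _, ?_, ?_, Corner.before p⟩
    · rcases p with ⟨_ | i, j⟩ <;> rfl
    · rw [← h]
      rcases p with ⟨_ | i, j⟩ <;> rfl
  · obtain ⟨p, rfl⟩ := (pointMap_bijective σ).2 p
    refine ⟨_, _, ?_, ?_, Corner.after p⟩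
    · rcases p with ⟨_ | i, j⟩ <;> rfl
    · rw [← h]
      rcases p with ⟨_ | i, j⟩ <;> rfl
  · rcases d with _ | i
    · exact ⟨_, _, rfl, rfl, Corner.close none⟩
    · obtain ⟨i, rfl⟩ := σ.surjective i
      exact ⟨_, _, rfl, rfl, Corner.close (some i)⟩

theorem Tangle.IsPlanar.of_isotopic {T' : Tangle (fun i => c (σ i)) c₀} {T : Tangle c c₀}
    (hT : T.IsPlanar) (h : Tangle.IsIsotopic σ T' T) : T'.IsPlanar := by
  obtain ⟨f, g, h1, h2, h3, h4, h5⟩ := h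
  have hstr : ∀ p, f (T'.str p) = T.str (pointMap σ p) := by
    rintro ⟨_ | i, j⟩
    · exact h1 j
    · exact h2 i j
  refine hT.transfer σ (pointMap σ) (pointMap_bijective σ) (edgeMap σ f)
    (edgeMap_bijective σ f.bijective) f g false hstr ?_ ?_ ?_ ?_ ?_ ?_
  · rintro ⟨_ | i, j⟩
    · exact (Bool.false_xor _).symm
    · exact (Bool.false_xor _).symm
  · rintro (⟨_ | i, j⟩ | ⟨s, x⟩)
    · exact h3 j
    · exact h4 i j
    · exact h5 s x
  · rintro (⟨_ | i, j⟩ | ⟨s, x⟩) <;> rfl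
  · intro s x; rfl
  · exact fun u v huv => EqvGen.rel _ _ (corner_edgeMap σ hstr huv)
  · intro e e' he
    obtain ⟨u, u', hu, hu', h⟩ := exists_corner_edgeMap σ hstr he
    exact ⟨u, u', hu, hu', EqvGen.rel _ _ h⟩

/-- Renumbering of the input discs. -/
def Tangle.reindex (T : Tangle c c₀) : Tangle (fun i => c (σ i)) c₀ where
  Str := T.Str
  Reg := T.Reg
  str p := T.str (pointMap σ p)
  reg e := T.reg (edgeMap σ id e)

theorem Tangle.reindex_isIsotopic (T : Tangle c c₀) : IsIsotopic σ (T.reindex σ) T :=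
  ⟨Equiv.refl _, Equiv.refl _, fun _ => rfl, fun _ _ => rfl, fun _ => rfl, fun _ _ => rfl,
    fun _ _ => rfl⟩

end reindex

section mirror

variable {ι : Type} {c : ι → Color} {c₀ : Color}

/-- Reflection of points. -/
def Point.refl (p : Point c c₀) : Point c c₀ := ⟨p.1, p.2.rev⟩

/-- Reflection of edges. -/
def Edge.refl {Str : Type} : Edge c c₀ Str → Edge c c₀ Str
  | Sum.inl I => Sum.inl ⟨I.1, I.2.rev⟩
  | Sum.inr x => Sum.inr x

theorem Point.refl_refl (p : Point c c₀) : p.refl.refl = p := by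
  simp [Point.refl]

theorem Edge.refl_refl {Str : Type} (e : Edge c c₀ Str) : e.refl.refl = e := by
  rcases e with I | x <;> simp [Edge.refl]

/-- The reversal j ↦ 2n - j preserves parity. -/
theorem Interval.shade_rev (d : Option ι) (j : Fin (2 * (discColor c c₀ d).n + 1)) :
    Interval.shade (c := c) (c₀ := c₀) ⟨d, j.rev⟩ = Interval.shade (c := c) (c₀ := c₀) ⟨d, j⟩ := by
  have : (j.rev.val).bodd = j.val.bodd := by
    have h : j.rev.val + j.val = 2 * (discColor c c₀ d).n := by
      have := j.2
      rw [Fin.val_rev]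
      omega
    have := congrArg Nat.bodd h
    simp only [Nat.bodd_add, Nat.bodd_mul, Nat.bodd_two, Bool.false_and] at this
    revert this
    cases j.rev.val.bodd <;> cases j.val.bodd <;> simp
  simp only [Interval.shade, this]

theorem Edge.shade_refl {Str : Type} (e : Edge c c₀ Str) : e.refl.shade = e.shade := by
  rcases e with I | x
  · exact Interval.shade_rev _ _
  · rfl

theorem Point.before_refl (p : Point c c₀) :
    p.refl.before = ⟨p.after.1, p.after.2.rev⟩ := by
  rcases p with ⟨d, j⟩
  simp [Point.refl, Point.before, Point.after, Fin.rev_succ]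

theorem Point.after_refl (p : Point c c₀) :
    p.refl.after = ⟨p.before.1, p.before.2.rev⟩ := by
  rcases p with ⟨d, j⟩
  simp [Point.refl, Point.before, Point.after, Fin.rev_castSucc]

theorem Point.shade_after (p : Point c c₀) : p.after.shade = !p.before.shade := by
  rcases p with ⟨d, j⟩
  simp [Point.before, Point.after, Interval.shade]

/-- Reflection keeps the shades of the intervals but exchanges the interval before a point with the
one after it, and these have opposite shades. -/
theorem Point.isSource_refl (p : Point c c₀) : p.refl.isSource = !p.isSource := by
  have hb : p.refl.before.shade = p.after.shade := by
    rw [Point.before_refl, Interval.shade_rev]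
  have ha : p.refl.after.shade = p.before.shade := by
    rw [Point.after_refl, Interval.shade_rev]
  rcases p with ⟨_ | i, j⟩
  · exact hb.trans (Point.shade_after _)
  · have : ∀ x y : Bool, x = !y → y = !x := by decide
    exact ha.trans (this _ _ (Point.shade_after _))

theorem corner_refl {Str : Type} {str : Point c c₀ → Str} {u v : Edge c c₀ Str}
    (h : Corner (fun p => str p.refl) u v) : EqvGen (Corner str) u.refl v.refl := by
  rcases h with p | p | d
  · have := Corner.after (str := str) p.refl
    rw [Point.after_refl, Interval.shade_rev] at this
    exact EqvGen.rel _ _ this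
  · have := Corner.before (str := str) p.refl
    rw [Point.before_refl, Interval.shade_rev] at this
    exact EqvGen.rel _ _ this
  · have := Corner.close (str := str) d
    simp only [Edge.refl]
    rw [Fin.rev_last, Fin.rev_zero]
    exact (EqvGen.rel _ _ this).symm

theorem Tangle.IsPlanar.mirror {T : Tangle c c₀} (hT : T.IsPlanar) : T.mirror.IsPlanar := by
  refine hT.transfer (T' := T.mirror) (Equiv.refl ι) Point.refl
    (Function.Involutive.bijective Point.refl_refl) Edge.refl
    (Function.Involutive.bijective Edge.refl_refl) (Equiv.refl _) (Equiv.refl _) true ?_ ?_ ?_ ?_ ?_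
    ?_ ?_
  · intro p; rfl
  · intro p
    rw [Point.isSource_refl]
    simp
  · rintro (I | x) <;> rfl
  · exact Edge.shade_refl
  · intro s x; rfl
  · intro u v h
    exact corner_refl h
  · intro e e' h
    refine ⟨e.refl, e'.refl, e.refl_refl, e'.refl_refl, corner_refl (str := T.mirror.str) ?_⟩
    have : (fun p : Point c c₀ => T.mirror.str p.refl) = T.str := by
      funext p
      exact congrArg T.str p.refl_refl
    rw [this]
    exact h

end mirror

/-! ### A decidable criterion for gluing tables -/

namespace Code

variable {a b c : Color}

section gluing

variable (T : Code b a) (S : Fin T.m → Code c b) (U : Code c a)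
  (σ : ∀ i, Fin (S i).m → Fin U.m)

/-- The strings before gluing. -/
abbrev Raw : Type := Fin (T.k + 1) ⊕ (Σ i, Fin ((S i).k + 1))

/-- Numbering of the strings before gluing (when the inner tangles have at most `16` strings). -/
def rawEnc : Raw T S → ℕ
  | Sum.inl s => s
  | Sum.inr ⟨i, s⟩ => T.k + 1 + (16 * i + s)

def raws : List (Raw T S) :=
  (List.finRange _).map Sum.inl ++
    (List.finRange T.m).flatMap fun i => (List.finRange _).map fun s => Sum.inr ⟨i, s⟩

theorem mem_raws (x : Raw T S) : x ∈ raws T S := by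
  rcases x with s | ⟨i, s⟩ <;> simp [raws]

/-- The pairs of strings joined by gluing. -/
def joins : List (Raw T S × Raw T S) :=
  (List.finRange T.m).flatMap fun i => (List.finRange (2 * b.n)).map fun j =>
    (Sum.inl (T.str ⟨some i, j⟩), Sum.inr ⟨i, (S i).str ⟨none, j⟩⟩)

/-- Label of a string after gluing. -/
def rawLab (x : Raw T S) : ℕ :=
  (labels (T.k + 1 + 16 * T.m) ((joins T S).map (Prod.map (rawEnc T S) (rawEnc T S)))).getD
    (rawEnc T S x) 0

/-- The marked points that survive the gluing prescribe which string of `U` contains a given class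
of strings. Only classes that become closed strings have no such point. -/
def anchors : List (ℕ × Fin (U.k + 1)) :=
  (List.finRange (2 * a.n)).map (fun j =>
    (rawLab T S (Sum.inl (T.str ⟨none, j⟩)), U.str ⟨none, j⟩)) ++
  (List.finRange T.m).flatMap fun i => (List.finRange (S i).m).flatMap fun l =>
    (List.finRange (2 * c.n)).map fun j =>
      (rawLab T S (Sum.inr ⟨i, (S i).str ⟨some l, j⟩⟩), U.str ⟨some (σ i l), j⟩)

/-- The string of the glued tangle which contains a given string; a closed string is the last one. -/
def strMap (x : Raw T S) : Fin (U.k + 1) :=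
  (((anchors T S U σ).find? fun q => q.1 == rawLab T S x).map Prod.snd).getD (Fin.last _)

/-- The edge of the glued tangle corresponding to an edge of the outer tangle which is not on an
input disc. -/
def keepEdge : T.Ed → U.Ed
  | Sum.inl ⟨none, j⟩ => Sum.inl ⟨none, j⟩
  | Sum.inl ⟨some _, _⟩ => Sum.inl ⟨none, 0⟩
  | Sum.inr (s, x) => Sum.inr (strMap T S U σ (Sum.inl s), x)

def isKept : T.Ed → Bool
  | Sum.inl ⟨some _, _⟩ => false
  | _ => true

/-- An erased interval has no counterpart in `U`. Its region is located through another edge of the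
same region that survives. -/
def findEdge (i : Fin T.m) (j : Fin (2 * b.n + 1)) : Option T.Ed :=
  T.edges.find? fun e => T.isKept e && T.lab e == T.lab (Sum.inl ⟨some i, j⟩)

/-- An edge of the glued tangle on the region which contains an erased interval. -/
def eraseEdge (i : Fin T.m) (j : Fin (2 * b.n + 1)) : U.Ed :=
  ((T.findEdge i j).map (keepEdge T S U σ)).getD (Sum.inl ⟨none, 0⟩)

def outerEdge : T.Ed → U.Ed
  | Sum.inl ⟨none, j⟩ => Sum.inl ⟨none, j⟩
  | Sum.inl ⟨some i, j⟩ => eraseEdge T S U σ i j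
  | Sum.inr (s, x) => Sum.inr (strMap T S U σ (Sum.inl s), x)

def innerEdge (i : Fin T.m) : (S i).Ed → U.Ed
  | Sum.inl ⟨none, j⟩ => eraseEdge T S U σ i j
  | Sum.inl ⟨some l, j⟩ => Sum.inl ⟨some (σ i l), j⟩
  | Sum.inr (s, x) => Sum.inr (strMap T S U σ (Sum.inr ⟨i, s⟩), x)

/-- The check that `U` is obtained by gluing the tangles `S i` into `T`, where `σ` renumbers the
input discs. -/
def Glues : Prop :=
  (∀ i, (S i).k < 16) ∧
  (∀ v, ∃ i l, σ i l = v) ∧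
  (∀ i l i' l', σ i l = σ i' l' → i = i' ∧ l.val = l'.val) ∧
  (∀ j, strMap T S U σ (Sum.inl (T.str ⟨none, j⟩)) = U.str ⟨none, j⟩) ∧
  (∀ i l j, strMap T S U σ (Sum.inr ⟨i, (S i).str ⟨some l, j⟩⟩) = U.str ⟨some (σ i l), j⟩) ∧
  (∀ u, ∃ x ∈ raws T S, strMap T S U σ x = u) ∧
  (∀ x ∈ raws T S, ∀ y ∈ raws T S, strMap T S U σ x = strMap T S U σ y →
    rawLab T S x = rawLab T S y) ∧
  (∀ q ∈ T.corners ++ T.same, U.lab (outerEdge T S U σ q.1) = U.lab (outerEdge T S U σ q.2)) ∧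
  (∀ i, ∀ q ∈ (S i).corners ++ (S i).same,
    U.lab (innerEdge T S U σ i q.1) = U.lab (innerEdge T S U σ i q.2)) ∧
  (∀ i j, (T.findEdge i j).isSome) ∧
  -- This clause prevents `U` from identifying regions that gluing keeps apart: each identification
  -- must already hold inside `T` or inside a single `S i`.
  (∀ q ∈ U.same,
    (∃ e ∈ T.edges, U.circ (outerEdge T S U σ e) = U.circ q.1 ∧
      ∃ e' ∈ T.edges, U.circ (outerEdge T S U σ e') = U.circ q.2 ∧ T.lab e = T.lab e') ∨
    ∃ i, ∃ e ∈ (S i).edges, U.circ (innerEdge T S U σ i e) = U.circ q.1 ∧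
      ∃ e' ∈ (S i).edges, U.circ (innerEdge T S U σ i e') = U.circ q.2 ∧
        (S i).lab e = (S i).lab e')

instance : Decidable (Glues T S U σ) := by unfold Glues; infer_instance

/-- The check for gluing as a Boolean. -/
def glues : Bool := decide (Glues T S U σ)

variable {T S U σ}

theorem rawEnc_injective (h : ∀ i, (S i).k < 16) : Function.Injective (rawEnc T S) := by
  rintro (s | ⟨i, s⟩) (s' | ⟨i', s'⟩) hx <;> simp only [rawEnc] at hx
  · rw [Fin.ext hx]
  · have := s.2; omega
  · have := s'.2; omega
  · have h1 := s.2
    have h2 := s'.2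
    have h3 := h i
    have h4 := h i'
    have hi : i = i' := Fin.ext (by omega)
    subst hi
    have : s = s' := Fin.ext (by omega)
    rw [this]

theorem rawEnc_lt (h : ∀ i, (S i).k < 16) (x : Raw T S) : rawEnc T S x < T.k + 1 + 16 * T.m := by
  rcases x with s | ⟨i, s⟩ <;> simp only [rawEnc]
  · have := s.2; omega
  · have h1 := s.2
    have h2 := h i
    have h3 := i.2
    omega

theorem rawLab_iff (h : ∀ i, (S i).k < 16) (x y : Raw T S) :
    rawLab T S x = rawLab T S y ↔
      EqvGen (Tangle.StrGlue T.tangle fun i => (S i).tangle) x y := by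
  rw [rawLab, rawLab, labels_iff (rawEnc_injective h) (rawEnc_lt h)]
  have : (fun u v => (u, v) ∈ joins T S) = Tangle.StrGlue T.tangle fun i => (S i).tangle := by
    ext u v
    constructor
    · intro h
      obtain ⟨i, -, h⟩ := List.mem_flatMap.1 h
      obtain ⟨j, -, h⟩ := List.mem_map.1 h
      obtain ⟨rfl, rfl⟩ := Prod.mk.inj h
      exact Tangle.StrGlue.mk (T := T.tangle) (S := fun i => (S i).tangle) i j
    · rintro ⟨i, j⟩
      exact List.mem_flatMap.2 ⟨i, List.mem_finRange _,
        List.mem_map.2 ⟨j, List.mem_finRange _, rfl⟩⟩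
  exact iff_of_eq (congrArg (fun r => EqvGen r x y) this)

theorem strMap_eq_of_rawLab {x y : Raw T S} (h : rawLab T S x = rawLab T S y) :
    strMap T S U σ x = strMap T S U σ y := by
  rw [strMap, strMap, h]

/-- Regions of a glued tangle. -/
abbrev GlueReg (T : Code b a) (S : Fin T.m → Code c b) : Type :=
  Quot (Tangle.RegGlue T.tangle fun i => (S i).tangle)

def glueOut (T : Code b a) (S : Fin T.m → Code c b) (e : T.Ed) : GlueReg T S :=
  Quot.mk _ (Sum.inl (T.tangle.reg e))

def glueIn (T : Code b a) (S : Fin T.m → Code c b) (i : Fin T.m) (e : (S i).Ed) : GlueReg T S :=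
  Quot.mk _ (Sum.inr ⟨i, (S i).tangle.reg e⟩)

theorem glueOut_eq (i : Fin T.m) (j : Fin (2 * b.n + 1)) :
    glueOut T S (Sum.inl ⟨some i, j⟩) = glueIn T S i (Sum.inl ⟨none, j⟩) :=
  Quot.sound (Tangle.RegGlue.mk (T := T.tangle) (S := fun i => (S i).tangle) i j)

theorem glueOut_congr {e e' : T.Ed} (h : T.Rel e e') : glueOut T S e = glueOut T S e' := by
  unfold glueOut
  rw [show T.tangle.reg e = T.tangle.reg e' from Quot.sound h]

theorem glueIn_congr {i : Fin T.m} {e e' : (S i).Ed} (h : (S i).Rel e e') :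
    glueIn T S i e = glueIn T S i e' := by
  unfold glueIn
  rw [show (S i).tangle.reg e = (S i).tangle.reg e' from Quot.sound h]

/-- The side of a string, after gluing. -/
def glueSide (T : Code b a) (S : Fin T.m → Code c b) (x : Bool) : Raw T S → GlueReg T S
  | Sum.inl s => glueOut T S (Sum.inr (s, x))
  | Sum.inr ⟨i, s⟩ => glueIn T S i (Sum.inr (s, x))

/-- Where two strings are joined, one of the two adjacent intervals has shade `x`. Through it the
sides of shade `x` are joined by corners on either side of the erased disc. -/
theorem glueSide_congr {x : Bool} {u v : Raw T S}
    (h : EqvGen (Tangle.StrGlue T.tangle fun i => (S i).tangle) u v) :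
    glueSide T S x u = glueSide T S x v := by
  induction h with
  | rel u v h =>
    obtain ⟨i, j⟩ := h
    let p : T.Pt := ⟨some i, j⟩
    let q : (S i).Pt := ⟨none, j⟩
    have key : x = p.before.shade ∨ x = p.after.shade := by
      rw [Point.shade_after]
      cases x <;> cases p.before.shade <;> simp
    change glueOut T S (Sum.inr (T.str p, x)) = glueIn T S i (Sum.inr ((S i).str q, x))
    rcases key with rfl | rfl
    · rw [← glueOut_congr (Or.inl (Corner.before (str := T.str) p))]
      exact (glueOut_eq i j.castSucc).trans
        (glueIn_congr (Or.inl (Corner.before (str := (S i).str) q)))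
    · rw [← glueOut_congr (Or.inl (Corner.after (str := T.str) p))]
      exact (glueOut_eq i j.succ).trans
        (glueIn_congr (Or.inl (Corner.after (str := (S i).str) q)))
  | refl => rfl
  | symm _ _ _ ih => exact ih.symm
  | trans _ _ _ _ _ ih1 ih2 => exact ih1.trans ih2

theorem Glues.bijective (h : Glues T S U σ) :
    Function.Bijective fun p : Σ i, Fin (S i).m => σ p.1 p.2 := by
  obtain ⟨-, h1, h2, -⟩ := h
  constructor
  · rintro ⟨i, l⟩ ⟨i', l'⟩ hp
    obtain ⟨rfl, hl⟩ := h2 i l i' l' hp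
    rw [Fin.ext hl]
  · intro v
    obtain ⟨i, l, hl⟩ := h1 v
    exact ⟨⟨i, l⟩, hl⟩

/-- The renumbering of the input discs. -/
noncomputable def Glues.equiv (h : Glues T S U σ) : (Σ i, Fin (S i).m) ≃ Fin U.m :=
  Equiv.ofBijective _ h.bijective

/-- The regions of `T` and of all `S i` map to those of `U` by `outerEdge` and `innerEdge`. Fibres
are identified by constructing a map back from the regions of `U` to the glued regions. -/
theorem Glues.isGluing (h : Glues T S U σ) :
    Tangle.IsGluing T.tangle (fun i => (S i).tangle) (U.tangle.reindex h.equiv) := by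
  have h' := h
  obtain ⟨c0, -, -, c2, c3, c4, c5, c6, c7, c8, c9⟩ := h'
  have hσ : ∀ i l, h.equiv ⟨i, l⟩ = σ i l := fun _ _ => rfl
  have hsurj : Function.Surjective (strMap T S U σ) := fun u => by
    obtain ⟨x, -, hx⟩ := c4 u
    exact ⟨x, hx⟩
  have hf : ∀ x y, strMap T S U σ x = strMap T S U σ y ↔
      EqvGen (Tangle.StrGlue T.tangle fun i => (S i).tangle) x y := by
    intro x y
    rw [← rawLab_iff c0]
    exact ⟨c5 x (mem_raws T S x) y (mem_raws T S y), strMap_eq_of_rawLab⟩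
  have hside : ∀ x u, glueSide T S x (Function.surjInv hsurj (strMap T S U σ u)) =
      glueSide T S x u := fun x u =>
    glueSide_congr ((hf _ _).1 (Function.surjInv_eq hsurj _))
  -- The map back, on edges. For a side of a string any preimage of the string may be chosen, since
  -- `hside` shows that the glued side does not depend on the choice.
  let η : U.Ed → GlueReg T S := fun e => match e with
    | Sum.inl ⟨none, j⟩ => glueOut T S (Sum.inl ⟨none, j⟩)
    | Sum.inl ⟨some v, j⟩ =>
      glueIn T S (h.equiv.symm v).1 (Sum.inl ⟨some (h.equiv.symm v).2, j⟩)
    | Sum.inr (s, x) => glueSide T S x (Function.surjInv hsurj s)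
  have ηin : ∀ i l j, η (Sum.inl ⟨some (σ i l), j⟩) = glueIn T S i (Sum.inl ⟨some l, j⟩) := by
    intro i l j
    have key : ∀ p : Σ i, Fin (S i).m, p = ⟨i, l⟩ →
        glueIn T S p.1 (Sum.inl ⟨some p.2, j⟩) = glueIn T S i (Sum.inl ⟨some l, j⟩) := by
      rintro _ rfl; rfl
    exact key _ (by rw [← hσ, Equiv.symm_apply_apply])
  have ηside : ∀ x u, η (Sum.inr (strMap T S U σ u, x)) = glueSide T S x u := hside
  have ηstr : ∀ j x, η (Sum.inr (U.str ⟨none, j⟩, x)) =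
      glueOut T S (Sum.inr (T.str ⟨none, j⟩, x)) := fun j x =>
    (congrArg (fun s => η (Sum.inr (s, x))) (c2 j).symm).trans (ηside x _)
  have ηstr' : ∀ i l j x, η (Sum.inr (U.str ⟨some (σ i l), j⟩, x)) =
      glueIn T S i (Sum.inr ((S i).str ⟨some l, j⟩, x)) := fun i l j x =>
    (congrArg (fun s => η (Sum.inr (s, x))) (c3 i l j).symm).trans (ηside x _)
  have ηcorner : ∀ e e', Corner U.str e e' → η e = η e' := by
    rintro e e' (⟨_ | v, j⟩ | ⟨_ | v, j⟩ | (_ | v))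
    · exact (glueOut_congr (Or.inl (Corner.before (str := T.str) ⟨none, j⟩))).trans (ηstr j _).symm
    · obtain ⟨⟨i, l⟩, rfl⟩ := h.equiv.surjective v
      exact (ηin i l _).trans ((glueIn_congr
        (Or.inl (Corner.before (str := (S i).str) ⟨some l, j⟩))).trans (ηstr' i l j _).symm)
    · exact (glueOut_congr (Or.inl (Corner.after (str := T.str) ⟨none, j⟩))).trans (ηstr j _).symm
    · obtain ⟨⟨i, l⟩, rfl⟩ := h.equiv.surjective v
      exact (ηin i l _).trans ((glueIn_congr
        (Or.inl (Corner.after (str := (S i).str) ⟨some l, j⟩))).trans (ηstr' i l j _).symm)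
    · exact glueOut_congr (Or.inl (Corner.close (str := T.str) none))
    · obtain ⟨⟨i, l⟩, rfl⟩ := h.equiv.surjective v
      exact (ηin i l _).trans ((glueIn_congr (Or.inl (Corner.close (str := (S i).str)
        (some l)))).trans (ηin i l _).symm)
  have ηcirc : ∀ e e', U.circ e = U.circ e' → η e = η e' := by
    intro e e' he
    rw [circ_iff] at he
    induction he with
    | rel u v h => exact ηcorner u v h
    | refl => rfl
    | symm _ _ _ ih => exact ih.symm
    | trans _ _ _ _ _ ih1 ih2 => exact ih1.trans ih2
  have ηout : ∀ e, η (outerEdge T S U σ e) = glueOut T S e := by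
    have keep : ∀ e, T.isKept e = true → η (keepEdge T S U σ e) = glueOut T S e := by
      rintro (⟨_ | i, j⟩ | ⟨s, x⟩) he
      · rfl
      · simp [isKept] at he
      · exact ηside x (Sum.inl s)
    rintro (⟨_ | i, j⟩ | ⟨s, x⟩)
    · rfl
    · obtain ⟨e, he⟩ := Option.isSome_iff_exists.1 (c8 i j)
      change η (eraseEdge T S U σ i j) = _
      have he2 := List.find?_some he
      simp only [Bool.and_eq_true, beq_iff_eq] at he2
      have he3 : eraseEdge T S U σ i j = keepEdge T S U σ e := by
        unfold eraseEdge
        rw [he]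
        rfl
      rw [he3, keep e he2.1]
      unfold glueOut
      rw [(T.reg_eq_iff _ _).2 he2.2]
    · exact ηside x (Sum.inl s)
  have ηinner : ∀ i e, η (innerEdge T S U σ i e) = glueIn T S i e := by
    rintro i (⟨_ | l, j⟩ | ⟨s, x⟩)
    · exact (ηout (Sum.inl ⟨some i, j⟩)).trans (glueOut_eq i j)
    · exact ηin i l j
    · exact ηside x (Sum.inr ⟨i, s⟩)
  have ηrel : ∀ e e', U.Rel e e' → η e = η e' := by
    rintro e e' (he | he)
    · exact ηcorner e e' he
    · rcases c9 _ he with ⟨q, -, h1, q', -, h2, hq⟩ | ⟨i, q, -, h1, q', -, h2, hq⟩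
      · rw [← ηcirc _ _ h1, ← ηcirc _ _ h2, ηout, ηout]
        unfold glueOut
        rw [(T.reg_eq_iff _ _).2 hq]
      · rw [← ηcirc _ _ h1, ← ηcirc _ _ h2, ηinner, ηinner]
        unfold glueIn
        rw [((S i).reg_eq_iff _ _).2 hq]
  -- Since `H` undoes `g`, equal images under `g` come from regions that are joined by gluing.
  let H : Quot U.Rel → GlueReg T S := Quot.lift η ηrel
  have ulab : ∀ {e e' : U.Ed}, U.lab e = U.lab e' → Quot.mk U.Rel e = Quot.mk U.Rel e' :=
    fun h => (U.reg_eq_iff _ _).2 h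
  let gT : Quot T.Rel → Quot U.Rel := Quot.lift (fun e => Quot.mk _ (outerEdge T S U σ e))
    fun e e' he => ulab (c6 (e, e') (List.mem_append.2 (he.imp_left (T.mem_corners e e').2)))
  let gS : ∀ i, Quot (S i).Rel → Quot U.Rel := fun i =>
    Quot.lift (fun e => Quot.mk _ (innerEdge T S U σ i e))
    fun e e' he => ulab (c7 i (e, e')
      (List.mem_append.2 (he.imp_left ((S i).mem_corners e e').2)))
  let g : T.tangle.Reg ⊕ (Σ i, (S i).tangle.Reg) → Quot U.Rel :=
    Sum.elim gT fun p => gS p.1 p.2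
  have Hg : ∀ x, H (g x) = Quot.mk _ x := by
    rintro (r | ⟨i, r⟩)
    · exact Quot.ind (β := fun r => H (g (Sum.inl r)) = Quot.mk _ (Sum.inl r)) ηout r
    · exact Quot.ind (β := fun r => H (g (Sum.inr ⟨i, r⟩)) = Quot.mk _ (Sum.inr ⟨i, r⟩))
        (ηinner i) r
  refine ⟨strMap T S U σ, g, hsurj, hf, ?_, ?_, ?_, ?_, ?_, ?_, ?_, ?_⟩
  · rintro ⟨⟨_ | v, j⟩ | ⟨s, x⟩⟩
    · exact ⟨Sum.inl (Quot.mk _ (Sum.inl ⟨none, j⟩)), rfl⟩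
    · obtain ⟨⟨i, l⟩, rfl⟩ := h.equiv.surjective v
      exact ⟨Sum.inr ⟨i, Quot.mk _ (Sum.inl ⟨some l, j⟩)⟩, rfl⟩
    · obtain ⟨s | ⟨i, s⟩, rfl⟩ := hsurj s
      · exact ⟨Sum.inl (Quot.mk _ (Sum.inr (s, x))), rfl⟩
      · exact ⟨Sum.inr ⟨i, Quot.mk _ (Sum.inr (s, x))⟩, rfl⟩
  · intro x y
    constructor
    · intro hxy
      exact Quot.eqvGen_exact ((Hg x).symm.trans ((congrArg H hxy).trans (Hg y)))
    · intro hxy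
      induction hxy with
      | rel u v h =>
        obtain ⟨i, j⟩ := h
        rfl
      | refl => rfl
      | symm _ _ _ ih => exact ih.symm
      | trans _ _ _ _ _ ih1 ih2 => exact ih1.trans ih2
  · exact fun j => (c2 j).symm
  · exact fun i l j => (c3 i l j).symm
  · exact fun j => rfl
  · exact fun i l j => rfl
  · exact fun s x => rfl
  · exact fun i s x => rfl

end gluing

end Code

-- Evaluation of tables; comparison of tables under isotopy, reflection and sphericality

universe u

namespace PlanarStarAlgebra

variable {V : Color → Type u} [∀ a, AddCommGroup (V a)] [∀ a, Module ℂ (V a)]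
  (S : PlanarStarAlgebra V)

/-- The action of a tangle given by tables. -/
noncomputable def ev {a b : Color} (C : Code b a) : MultilinearMap ℂ (fun _ : Fin C.m => V b) (V a) :=
  S.eval C.tangle

theorem eval_eq_act {ι : Type} {c : ι → Color} {c₀ : Color} {T : Tangle c c₀} (h : T.IsPlanar) :
    S.eval T = S.act T h := dif_pos h

/-- The workhorse for diagrammatic identities: nested operations equal one operation once the
Boolean test `glues` succeeds. The values `y` are left free so that they can be supplied as already
named elements, such as products. -/
theorem ev_glue {a b c : Color} {T : Code b a} {R : Fin T.m → Code c b} {U : Code c a}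
    {σ : ∀ i, Fin (R i).m → Fin U.m} (hT : T.Check) (hR : ∀ i, (R i).Check) (hU : U.Check)
    (h : Code.glues T R U σ = true) (x : Fin U.m → V c) (y : Fin T.m → V b)
    (hy : ∀ i, S.ev (R i) (fun l => x (σ i l)) = y i) : S.ev T y = S.ev U x := by
  have h : Code.Glues T R U σ := of_decide_eq_true h
  have hU' := Tangle.IsPlanar.of_isotopic h.equiv (U.isPlanar hU)
    (U.tangle.reindex_isIsotopic h.equiv)
  rw [ev, ev, S.eval_eq_act (U.isPlanar hU), S.eval_eq_act (T.isPlanar hT)]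
  rw [← S.act_isotopic h.equiv _ _ hU' (U.isPlanar hU) (U.tangle.reindex_isIsotopic h.equiv) x,
    S.act_gluing T.tangle (fun i => (R i).tangle) _ (T.isPlanar hT)
      (fun i => (R i).isPlanar (hR i)) hU' h.isGluing]
  congr 1
  funext i
  rw [← hy, ev, S.eval_eq_act ((R i).isPlanar (hR i))]
  rfl

end PlanarStarAlgebra

namespace Code

variable {a b c : Color}

/-- The bridge from the tangles in the definitions to tables. The two lists of identifications need
only generate the same regions. -/
theorem ofStrings_isIsotopic {ι : Type} {Str : Type} {str : Point (fun _ : ι => b) a → Str}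
    {same : Interval (fun _ : ι => b) a → Interval (fun _ : ι => b) a → Prop} {C : Code b a}
    (σ : ι ≃ Fin C.m) (φ : Str ≃ Fin (C.k + 1))
    (hstr : ∀ p, φ (str p) = C.str (pointMap (c := fun _ : Fin C.m => b) σ p))
    (hsame : ∀ I I', same I I' →
      C.lab (edgeMap (c := fun _ : Fin C.m => b) σ φ (Sum.inl I)) =
        C.lab (edgeMap (c := fun _ : Fin C.m => b) σ φ (Sum.inl I')))
    (hsame' : ∀ q ∈ C.same, ∃ I I', same I I' ∧
      edgeMap (c := fun _ : Fin C.m => b) σ φ (Sum.inl I) = q.1 ∧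
      edgeMap (c := fun _ : Fin C.m => b) σ φ (Sum.inl I') = q.2) :
    Tangle.IsIsotopic (c := fun _ : Fin C.m => b) σ (Tangle.ofStrings Str str same) C.tangle := by
  obtain ⟨g, hg⟩ := exists_quot_equiv (r := C.Rel) (r' := fun e e' : Edge (fun _ : ι => b) a Str =>
      Corner str e e' ∨ ∃ I I', e = Sum.inl I ∧ e' = Sum.inl I' ∧ same I I')
    (edgeMap_bijective (c := fun _ : Fin C.m => b) (c₀ := a) σ φ.bijective) (by
      rintro u v (h | ⟨I, I', rfl, rfl, h⟩)
      · exact EqvGen.rel _ _ (Or.inl (corner_edgeMap (c := fun _ : Fin C.m => b) σ hstr h))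
      · exact (C.lab_iff _ _).1 (hsame I I' h)) (by
      rintro e e' (h | h)
      · obtain ⟨u, u', h1, h2, h3⟩ := exists_corner_edgeMap (c := fun _ : Fin C.m => b) σ hstr h
        exact ⟨u, u', h1, h2, EqvGen.rel _ _ (Or.inl h3)⟩
      · obtain ⟨I, I', h1, h2, h3⟩ := hsame' _ h
        exact ⟨_, _, h2, h3, EqvGen.rel _ _ (Or.inr ⟨I, I', rfl, rfl, h1⟩)⟩)
  exact ⟨φ, g, fun j => hstr ⟨none, j⟩, fun i j => hstr ⟨some i, j⟩,
    fun j => hg (Sum.inl ⟨none, j⟩), fun i j => hg (Sum.inl ⟨some i, j⟩),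
    fun s x => hg (Sum.inr (s, x))⟩

/-- The reflected tables. -/
def mirror (C : Code b a) : Code b a where
  m := C.m
  k := C.k
  out := List.ofFn fun j : Fin (2 * a.n) => C.out.getD j.rev 0
  inp := List.ofFn fun i : Fin C.m => List.ofFn fun j : Fin (2 * b.n) =>
    (C.inp.getD i []).getD j.rev 0
  same := C.same.map (Prod.map Edge.refl Edge.refl)

theorem mirror_str (C : Code b a) (p : C.Pt) : C.mirror.str p = C.str p.refl := by
  rcases p with ⟨_ | i, j⟩
  · simp only [str, mirror, Point.refl]
    congr 1
    rw [List.getD_eq_getElem _ _ (by rw [List.length_ofFn]; exact j.2), List.getElem_ofFn]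
    rfl
  · simp only [str, mirror, Point.refl]
    congr 1
    rw [List.getD_eq_getElem (List.ofFn _) _ (by rw [List.length_ofFn]; exact i.2), List.getElem_ofFn,
      List.getD_eq_getElem (List.ofFn _) _ (by rw [List.length_ofFn]; exact j.2), List.getElem_ofFn]
    rfl

theorem mirror_isIsotopic (C : Code b a) :
    Tangle.IsIsotopic (c := fun _ : Fin C.m => b) (Equiv.refl (Fin C.m)) C.mirror.tangle
      C.tangle.mirror := by
  have hstr : (fun p : C.Pt => C.str p.refl) = C.mirror.str := funext fun p => (C.mirror_str p).symm
  obtain ⟨g, hg⟩ := exists_quot_equiv (r := C.Rel) (r' := C.mirror.Rel)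
    (ψ := (Edge.refl : C.Ed → C.Ed)) (Function.Involutive.bijective Edge.refl_refl) (by
      rintro u v (h | h)
      · have h : Corner (fun p : C.Pt => C.str p.refl) u v := by rw [hstr]; exact h
        exact EqvGen.mono (fun _ _ => Or.inl) _ _ (corner_refl h)
      · obtain ⟨q, hq, h⟩ := List.mem_map.1 h
        obtain ⟨rfl, rfl⟩ := Prod.mk.inj h
        rw [Edge.refl_refl, Edge.refl_refl]
        exact EqvGen.rel _ _ (Or.inr hq)) (by
      rintro e e' (h | h)
      · refine ⟨e.refl, e'.refl, e.refl_refl, e'.refl_refl,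
          EqvGen.mono (fun _ _ => Or.inl) _ _ (corner_refl (str := C.mirror.str) ?_)⟩
        have : (fun p : C.Pt => C.mirror.str p.refl) = C.str :=
          funext fun p => (C.mirror_str p.refl).trans (congrArg C.str p.refl_refl)
        exact (congrArg (fun f => Corner f e e') this).mpr h
      · exact ⟨e.refl, e'.refl, e.refl_refl, e'.refl_refl, EqvGen.rel _ _ (Or.inr
          (List.mem_map.2 ⟨_, h, rfl⟩))⟩)
  exact ⟨Equiv.refl _, g, fun j => C.mirror_str ⟨none, j⟩, fun i j => C.mirror_str ⟨some i, j⟩,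
    fun j => hg (Sum.inl ⟨none, j⟩), fun i j => hg (Sum.inl ⟨some i, j⟩),
    fun s x => hg (Sum.inr (s, x))⟩

/-- The same tables with other identifications of regions. -/
def withSame (C : Code b a) (L : List (C.Ed × C.Ed)) : Code b a where
  m := C.m
  k := C.k
  out := C.out
  inp := C.inp
  same := L

theorem withSame_isIsotopic (C : Code b a) (L : List (C.Ed × C.Ed))
    (h : ∀ q ∈ L, C.lab q.1 = C.lab q.2)
    (h' : ∀ q ∈ C.same, (C.withSame L).lab q.1 = (C.withSame L).lab q.2) :
    Tangle.IsIsotopic (c := fun _ : Fin C.m => b) (Equiv.refl (Fin C.m)) (C.withSame L).tangle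
      C.tangle := by
  have hstr : (C.withSame L).str = C.str := by
    funext p
    rcases p with ⟨_ | i, j⟩ <;> rfl
  obtain ⟨g, hg⟩ := exists_quot_equiv (r := C.Rel) (r' := (C.withSame L).Rel)
    (ψ := (id : C.Ed → C.Ed)) Function.bijective_id (by
      rintro u v (h1 | h1)
      · exact EqvGen.rel _ _ (Or.inl ((congrArg (fun f => Corner f u v) hstr).mp h1))
      · exact (C.lab_iff _ _).1 (h _ h1)) (by
      rintro e e' (h1 | h1)
      · exact ⟨e, e', rfl, rfl, EqvGen.rel _ _
          (Or.inl ((congrArg (fun f => Corner f e e') hstr).mpr h1))⟩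
      · exact ⟨e, e', rfl, rfl, ((C.withSame L).lab_iff _ _).1 (h' _ h1)⟩)
  exact ⟨Equiv.refl _, g, fun j => congrFun hstr ⟨none, j⟩, fun i j => congrFun hstr ⟨some i, j⟩,
    fun j => hg (Sum.inl ⟨none, j⟩), fun i j => hg (Sum.inl ⟨some i, j⟩),
    fun s x => hg (Sum.inr (s, x))⟩

/-- Inner edges of a diagram. -/
abbrev Inner (b : Color) (m k : ℕ) : Type := (Fin m × Fin (2 * b.n + 1)) ⊕ (Fin (k + 1) × Bool)

/-- The edge of a diagram given by an inner edge. -/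
def Inner.toEdge (m k : ℕ) : Inner b m k → Edge (fun _ : Fin m => b) a (Fin (k + 1))
  | Sum.inl (i, j) => Sum.inl ⟨some i, j⟩
  | Sum.inr x => Sum.inr x

/-- A diagram without outer boundary points, with the outer disc in the region of `e`. -/
def closed (b : Color) (x : Bool) (m k : ℕ) (inp : List (List ℕ)) (e : Inner b m k) :
    Code b ⟨0, x⟩ where
  m := m
  k := k
  out := []
  inp := inp
  same := [(Sum.inl ⟨none, 0⟩, e.toEdge m k)]

/-- An outer disc without points contributes a single interval, which is attached to one inner edge
and creates no further relation between inner edges. Hence moving it to another region leaves the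
inner regions alone. -/
theorem closed_map {b : Color} {x y : Bool} {m k : ℕ} {inp : List (List ℕ)} (e e' : Inner b m k) :
    ∃ g : Quot (closed b x m k inp e).Rel → Quot (closed b y m k inp e').Rel,
      ∀ u : Inner b m k, g (Quot.mk _ (u.toEdge m k)) = Quot.mk _ (u.toEdge m k) := by
  let F : (closed b x m k inp e).Ed → Quot (closed b y m k inp e').Rel := fun u => match u with
    | Sum.inl ⟨none, _⟩ => Quot.mk _ (e.toEdge m k)
    | Sum.inl ⟨some i, j⟩ => Quot.mk _ (Sum.inl ⟨some i, j⟩)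
    | Sum.inr x => Quot.mk _ (Sum.inr x)
  have hF : ∀ u : Inner b m k, F (u.toEdge m k) = Quot.mk _ (u.toEdge m k) := by
    rintro (⟨i, j⟩ | x) <;> rfl
  refine ⟨Quot.lift F ?_, hF⟩
  rintro u v (h | h)
  · rcases h with ⟨_ | i, j⟩ | ⟨_ | i, j⟩ | (_ | i)
    · exact j.elim0
    · exact Quot.sound (Or.inl (Corner.before (str := (closed b y m k inp e').str) ⟨some i, j⟩))
    · exact j.elim0
    · exact Quot.sound (Or.inl (Corner.after (str := (closed b y m k inp e').str) ⟨some i, j⟩))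
    · rfl
    · exact Quot.sound (Or.inl (Corner.close (str := (closed b y m k inp e').str) (some i)))
  · obtain ⟨rfl, rfl⟩ := Prod.mk.inj (List.mem_singleton.1 h)
    exact (hF e).symm

theorem closed_isSphericallyIsotopic {b : Color} {x y : Bool} {m k : ℕ} {inp : List (List ℕ)}
    (e e' : Inner b m k) :
    Tangle.IsSphericallyIsotopic (closed b x m k inp e).tangle (closed b y m k inp e').tangle := by
  obtain ⟨g, hg⟩ := closed_map (x := x) (y := y) (inp := inp) e e'
  obtain ⟨g', hg'⟩ := closed_map (x := y) (y := x) (inp := inp) e' e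
  -- The outer interval lies on the region of `e`, so every region is represented by an inner edge;
  -- this makes the two maps inverse to each other.
  have surj : ∀ (x : Bool) (e : Inner b m k) (r : Quot (closed b x m k inp e).Rel),
      ∃ u : Inner b m k, Quot.mk _ (u.toEdge m k) = r := by
    intro x e r
    induction r using Quot.ind with
    | mk u =>
      rcases u with ⟨_ | i, j⟩ | u
      · have h : (closed b x m k inp e).Rel (Sum.inl ⟨none, (0 : Fin 1)⟩) (e.toEdge m k) :=
          Or.inr List.mem_cons_self
        obtain rfl : j = (0 : Fin 1) := Subsingleton.elim (α := Fin 1) _ _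
        exact ⟨e, (Quot.sound h).symm⟩
      · exact ⟨Sum.inl (i, j), rfl⟩
      · exact ⟨Sum.inr u, rfl⟩
  let G : Quot (closed b x m k inp e).Rel ≃ Quot (closed b y m k inp e').Rel :=
    { toFun := g
      invFun := g'
      left_inv := fun r => by
        obtain ⟨u, rfl⟩ := surj x e r
        exact (congrArg g' (hg u)).trans (hg' u)
      right_inv := fun r => by
        obtain ⟨u, rfl⟩ := surj y e' r
        exact (congrArg g (hg' u)).trans (hg u) }
  exact ⟨Equiv.refl _, G, fun i j => rfl, fun i j => hg (Sum.inl (i, j)),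
    fun s x => hg (Sum.inr (s, x))⟩

end Code

/-! ### The empty diagram and the circle -/

/-- The tangle without strings and input discs, with an arbitrary colour function. -/
def emptyTangle (col : Empty → Color) (x : Bool) : Tangle col ⟨0, x⟩ where
  Str := Empty
  Reg := Unit
  str p := match p with
    | ⟨none, j⟩ => (Nat.not_lt_zero _ j.2).elim
    | ⟨some i, _⟩ => i.elim
  reg _ := ()

theorem empty_eq_emptyTangle (x : Bool) :
    Tangle.empty x = emptyTangle (fun i => i.elim) x := by
  unfold Tangle.empty emptyTangle
  congr 1
  funext p
  rcases p with ⟨_ | i, j⟩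
  · exact j.elim0
  · exact i.elim

theorem emptyTangle_isPlanar (col : Empty → Color) (x : Bool) : (emptyTangle col x).IsPlanar where
  finite_discs := inferInstance
  finite_str := inferInstanceAs (Finite Empty)
  finite_reg := inferInstanceAs (Finite Unit)
  ends s := s.elim
  corner _ _ _ := rfl
  shading := ⟨fun _ => x, by
    rintro (⟨_ | i, j⟩ | ⟨s, -⟩)
    · obtain rfl : j = 0 := Subsingleton.elim (α := Fin 1) _ _
      simp [Edge.shade, Interval.shade, discColor]
    · exact i.elim
    · exact s.elim⟩
  connected _ _ := EqvGen.refl _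
  euler := by
    have h1 : Nat.card (emptyTangle col x).Reg = 1 := Nat.card_unique (α := Unit)
    have h2 : Nat.card {s : (emptyTangle col x).Str // ∃ p, (emptyTangle col x).str p = s} = 0 := by
      have : IsEmpty {s : (emptyTangle col x).Str // ∃ p, (emptyTangle col x).str p = s} :=
        ⟨fun s => Empty.elim s.1⟩
      exact Nat.card_of_isEmpty
    have h3 : Nat.card (Quot (Corner (emptyTangle col x).str)) = 1 := by
      have hu : ∀ e : Edge col ⟨0, x⟩ Empty, e = Sum.inl ⟨none, (0 : Fin 1)⟩ := by
        rintro (⟨_ | i, j⟩ | ⟨s, -⟩)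
        · obtain rfl : j = 0 := Subsingleton.elim (α := Fin 1) _ _
          rfl
        · exact i.elim
        · exact s.elim
      rw [Nat.card_eq_one_iff_unique]
      constructor
      · constructor
        rintro ⟨e⟩ ⟨e'⟩
        rw [hu e, hu e']
      · exact ⟨Quot.mk _ (Sum.inl ⟨none, (0 : Fin 1)⟩)⟩
    rw [h1, h2, h3]
    simp

/-- A diagram with one input disc without boundary points, on the region of the edge `z`. -/
def Code.pierce {a c : Color} (x : Bool) (k : ℕ) (out : List ℕ)
    (L : List ((Code.mk 0 k out [] [] : Code c a).Ed × (Code.mk 0 k out [] [] : Code c a).Ed))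
    (z : (Code.mk 0 k out [] [] : Code c a).Ed) : Code ⟨0, x⟩ a where
  m := 1
  k := k
  out := out
  inp := []
  same := (Sum.inl ⟨some 0, (0 : Fin 1)⟩, emb z) :: L.map (Prod.map emb emb)
where
  emb : (Code.mk 0 k out [] [] : Code c a).Ed → Edge (fun _ : Fin 1 => ⟨0, x⟩) a (Fin (k + 1))
    | Sum.inl ⟨none, j⟩ => Sum.inl ⟨none, j⟩
    | Sum.inl ⟨some i, _⟩ => i.elim0
    | Sum.inr s => Sum.inr s

/-- A table has at least one string, so the empty tangle has no table and `Glues` does not apply.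
The gluing is verified directly, with `ret` sending the erased interval to the edge `z` of its
region. -/
theorem Code.pierce_isGluing {a c : Color} (x : Bool) (k : ℕ) (out : List ℕ)
    (L : List ((Code.mk 0 k out [] [] : Code c a).Ed × (Code.mk 0 k out [] [] : Code c a).Ed))
    (z : (Code.mk 0 k out [] [] : Code c a).Ed) (σ : (Σ _ : Fin 1, Empty) ≃ Fin 0) :
    Tangle.IsGluing (Code.pierce x k out L z).tangle (fun _ => emptyTangle (fun _ => c) x)
      ((Code.mk 0 k out [] L : Code c a).tangle.reindex σ) := by
  let T := Code.pierce x k out L z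
  let U : Code c a := Code.mk 0 k out [] L
  let emb : U.Ed → T.Ed := Code.pierce.emb x k out
  let ret : T.Ed → U.Ed := fun e => match e with
    | Sum.inl ⟨none, j⟩ => Sum.inl ⟨none, j⟩
    | Sum.inl ⟨some _, _⟩ => z
    | Sum.inr s => Sum.inr s
  have hret : ∀ e, ret (emb e) = e := by
    rintro (⟨_ | i, j⟩ | s)
    · rfl
    · exact i.elim0
    · rfl
  have hdisc : T.Rel (Sum.inl ⟨some (0 : Fin 1), (0 : Fin 1)⟩) (emb z) := Or.inr List.mem_cons_self
  have hL : ∀ q ∈ L, T.Rel (emb q.1) (emb q.2) := fun q hq =>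
    Or.inr (List.mem_cons_of_mem _ (List.mem_map.2 ⟨q, hq, rfl⟩))
  let gT : Quot T.Rel → Quot U.Rel := Quot.lift (fun e => Quot.mk _ (ret e)) (by
    rintro e e' (h | h)
    · rcases h with ⟨_ | i, j⟩ | ⟨_ | i, j⟩ | (_ | i)
      · exact Quot.sound (Or.inl (Corner.before (str := U.str) ⟨none, j⟩))
      · exact j.elim0
      · exact Quot.sound (Or.inl (Corner.after (str := U.str) ⟨none, j⟩))
      · exact j.elim0
      · exact Quot.sound (Or.inl (Corner.close (str := U.str) none))
      · rfl
    · rcases List.mem_cons.1 h with h | h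
      · obtain ⟨rfl, rfl⟩ := Prod.mk.inj h
        exact congrArg (Quot.mk _) (hret z).symm
      · obtain ⟨q, hq, h⟩ := List.mem_map.1 h
        obtain ⟨rfl, rfl⟩ := Prod.mk.inj h
        have h1 := hret q.1
        have h2 := hret q.2
        have h3 : Quot.mk U.Rel q.1 = Quot.mk U.Rel q.2 := Quot.sound (Or.inr hq)
        exact (congrArg (Quot.mk U.Rel) h1).trans (h3.trans (congrArg (Quot.mk U.Rel) h2.symm)))
  let R := Tangle.RegGlue T.tangle fun _ : Fin 1 => emptyTangle (fun _ => c) x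
  let H : Quot U.Rel → Quot R := Quot.lift (fun e => Quot.mk R (Sum.inl (T.tangle.reg (emb e)))) (by
    have key : ∀ {e e'}, T.Rel e e' →
        Quot.mk R (Sum.inl (T.tangle.reg e)) = Quot.mk R (Sum.inl (T.tangle.reg e')) := by
      intro e e' h
      rw [show T.tangle.reg e = T.tangle.reg e' from Quot.sound h]
    rintro e e' (h | h)
    · rcases h with ⟨_ | i, j⟩ | ⟨_ | i, j⟩ | (_ | i)
      · exact key (Or.inl (Corner.before (str := T.str) ⟨none, j⟩))
      · exact i.elim0
      · exact key (Or.inl (Corner.after (str := T.str) ⟨none, j⟩))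
      · exact i.elim0
      · exact key (Or.inl (Corner.close (str := T.str) none))
      · exact i.elim0
    · exact key (hL _ h))
  let g : T.tangle.Reg ⊕ (Σ _ : Fin 1, Unit) → Quot U.Rel :=
    Sum.elim gT fun _ => Quot.mk _ z
  have hz : Quot.mk R (Sum.inl (T.tangle.reg (emb z))) =
      Quot.mk R (Sum.inl (T.tangle.reg (Sum.inl ⟨some (0 : Fin 1), (0 : Fin 1)⟩))) := by
    rw [show T.tangle.reg (Sum.inl ⟨some (0 : Fin 1), (0 : Fin 1)⟩) = T.tangle.reg (emb z) from
      Quot.sound hdisc]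
  have Hg : ∀ r, H (g r) = Quot.mk _ r := by
    rintro (r | ⟨i, -⟩)
    · refine Quot.ind (β := fun r => H (g (Sum.inl r)) = Quot.mk _ (Sum.inl r)) ?_ r
      rintro (⟨_ | i, j⟩ | s)
      · rfl
      · obtain rfl : i = (0 : Fin 1) := Subsingleton.elim (α := Fin 1) _ _
        obtain rfl : j = (0 : Fin 1) := Subsingleton.elim (α := Fin 1) _ _
        exact hz
      · rfl
    · obtain rfl : i = 0 := Subsingleton.elim (α := Fin 1) _ _
      exact hz.trans (Quot.sound (Tangle.RegGlue.mk (T := T.tangle)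
        (S := fun _ : Fin 1 => emptyTangle (fun _ => c) x) (0 : Fin 1) (0 : Fin 1)))
  refine ⟨Sum.elim id fun p => Empty.elim p.2, g, fun s => ⟨Sum.inl s, rfl⟩, ?_, ?_, ?_, ?_, ?_, ?_,
    ?_, ?_, ?_⟩
  · rintro (s | ⟨_, ⟨⟩⟩) (s' | ⟨_, ⟨⟩⟩)
    constructor
    · intro h
      rw [show s = s' from h]
      exact EqvGen.refl _
    · intro h
      have key : ∀ u v, EqvGen (Tangle.StrGlue T.tangle
          fun _ : Fin 1 => emptyTangle (fun _ => c) x) u v → u = v := by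
        intro u v h
        induction h with
        | rel u v h => obtain ⟨i, j⟩ := h; exact j.elim0
        | refl => rfl
        | symm _ _ _ ih => exact ih.symm
        | trans _ _ _ _ _ ih1 ih2 => exact ih1.trans ih2
      exact Sum.inl_injective (key _ _ h)
  · rintro ⟨⟨_ | i, j⟩ | s⟩
    · exact ⟨Sum.inl (Quot.mk _ (Sum.inl ⟨none, j⟩)), rfl⟩
    · exact i.elim0
    · exact ⟨Sum.inl (Quot.mk _ (Sum.inr s)), rfl⟩
  · intro r r'
    constructor
    · intro hxy
      exact Quot.eqvGen_exact ((Hg r).symm.trans ((congrArg H hxy).trans (Hg r')))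
    · intro hxy
      induction hxy with
      | rel u v h => obtain ⟨i, j⟩ := h; rfl
      | refl => rfl
      | symm _ _ _ ih => exact ih.symm
      | trans _ _ _ _ _ ih1 ih2 => exact ih1.trans ih2
  · exact fun j => rfl
  · rintro i ⟨⟩
  · exact fun j => rfl
  · rintro i ⟨⟩
  · exact fun s x => rfl
  · rintro i ⟨⟩

/-- A closed circle, with an arbitrary colour function. -/
def circleTangle (col : Empty → Color) : Tangle col ⟨0, false⟩ where
  Str := Unit
  Reg := Bool
  str _ := ()
  reg
    | Sum.inl _ => false
    | Sum.inr x => x.2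

/-- The tables of a closed circle. -/
def Code.circle (c : Color) : Code c ⟨0, false⟩ where
  m := 0
  k := 0
  out := []
  inp := []
  same := [(Sum.inl ⟨none, (0 : Fin 1)⟩, Sum.inr (0, false))]

theorem circle_eq_circleTangle : Tangle.circle = circleTangle fun i => i.elim := by
  unfold Tangle.circle circleTangle
  congr 1
  funext e
  rcases e with I | x <;> rfl

theorem circleTangle_isIsotopic (c : Color) (σ : Empty ≃ Fin 0) :
    Tangle.IsIsotopic (c := fun _ : Fin 0 => c) σ (circleTangle fun _ => c)
      (Code.circle c).tangle := by
  let F : Bool → Quot (Code.circle c).Rel := fun x => Quot.mk _ (Sum.inr (0, x))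
  have h0 : ∀ j : Fin 1, Quot.mk (Code.circle c).Rel (Sum.inl ⟨none, j⟩) = F false := by
    intro j
    obtain rfl : j = 0 := Subsingleton.elim _ _
    exact Quot.sound (Or.inr List.mem_cons_self)
  have hF : Function.Bijective F := by
    constructor
    · intro x y h
      have key : ∀ e e', (Code.circle c).Rel e e' → e.shade = e'.shade := by
        rintro e e' (h | h)
        · exact Code.Corner.shade_eq h
        · obtain ⟨rfl, rfl⟩ := Prod.mk.inj (List.mem_singleton.1 h)
          simp [Edge.shade, Interval.shade, discColor]
      exact congrArg (Quot.lift Edge.shade key) h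
    · rintro ⟨⟨_ | i, j⟩ | ⟨s, x⟩⟩
      · exact ⟨false, (h0 j).symm⟩
      · exact i.elim0
      · obtain rfl : s = 0 := Subsingleton.elim (α := Fin 1) _ _
        exact ⟨x, rfl⟩
  refine ⟨⟨fun _ => (0 : Fin 1), fun _ => (), fun _ => rfl, fun _ => Subsingleton.elim (α := Fin 1) _ _⟩,
    Equiv.ofBijective F hF, fun j => rfl, fun i => i.elim, fun j => (h0 j).symm,
    fun i => i.elim, fun s x => rfl⟩

/-! ### Invariance of the action, and diagrams without inputs -/

namespace PlanarStarAlgebra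

variable {V : Color → Type u} [∀ a, AddCommGroup (V a)] [∀ a, Module ℂ (V a)]
  (S : PlanarStarAlgebra V)

theorem eval_isotopic {ι ι' : Type} {c : ι → Color} {c₀ : Color} (σ : ι' ≃ ι)
    {T' : Tangle (fun i => c (σ i)) c₀} {T : Tangle c c₀} (hT : T.IsPlanar)
    (h : Tangle.IsIsotopic σ T' T) (x : ∀ i, V (c i)) :
    S.eval T' (fun i => x (σ i)) = S.eval T x := by
  rw [S.eval_eq_act hT, S.eval_eq_act (hT.of_isotopic σ h)]
  exact S.act_isotopic σ T' T _ hT h x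

theorem star_ev {a b : Color} {C : Code b a} (hC : C.Check) (x : Fin C.m → V b) :
    S.star (S.ev C x) = S.ev C.mirror fun i => S.star (x i) := by
  rw [ev, S.eval_eq_act (C.isPlanar hC), S.star_act _ _ (C.isPlanar hC).mirror, ev,
    ← S.eval_eq_act]
  exact (S.eval_isotopic (Equiv.refl _) (C.isPlanar hC).mirror C.mirror_isIsotopic _).symm

theorem ev_withSame {a b : Color} {C : Code b a} (hC : C.Check) (L : List (C.Ed × C.Ed))
    (h : ∀ q ∈ L, C.lab q.1 = C.lab q.2)
    (h' : ∀ q ∈ C.same, (C.withSame L).lab q.1 = (C.withSame L).lab q.2) (x : Fin C.m → V b) :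
    S.ev (C.withSame L) x = S.ev C x :=
  S.eval_isotopic (Equiv.refl _) (C.isPlanar hC) (C.withSame_isIsotopic L h h') x

/-- Functions on `Empty` are equal, but not definitionally. Keeping the colour function as a
variable makes the substitution possible. -/
theorem eval_colour_congr {c₀ : Color} (F : ∀ col : Empty → Color, Tangle col c₀)
    {col col' : Empty → Color} (x : ∀ i, V (col i)) (x' : ∀ i, V (col' i)) :
    S.eval (F col) x = S.eval (F col') x' := by
  obtain rfl : col = col' := funext fun i => i.elim
  obtain rfl : x = x' := funext fun i => i.elim
  rfl

theorem emptyBox_eq (c : Color) (x : Bool) (y : Empty → V c) :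
    S.eval (emptyTangle (fun _ => c) x) y = S.emptyBox x := by
  rw [emptyBox, empty_eq_emptyTangle]
  exact S.eval_colour_congr (fun col => emptyTangle col x) _ _

/-- Writes a diagram without inputs as a linear function of an empty diagram sitting in one of its
regions. Thus a closed component can be replaced by a scalar, and an empty diagram equal to zero
would kill the whole diagram. -/
theorem ev_pierce {a c : Color} (x : Bool) (k : ℕ) (out : List ℕ)
    (L : List ((Code.mk 0 k out [] [] : Code c a).Ed × (Code.mk 0 k out [] [] : Code c a).Ed))
    (z : (Code.mk 0 k out [] [] : Code c a).Ed) (hT : (Code.pierce x k out L z).Check)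
    (hU : (Code.mk 0 k out [] L : Code c a).Check) (y : Fin 0 → V c) :
    S.ev (Code.mk 0 k out [] L : Code c a) y = S.ev (Code.pierce x k out L z)
      fun _ => S.emptyBox x := by
  let σ : (Σ _ : Fin 1, Empty) ≃ Fin 0 := ⟨fun p => p.2.elim, fun i => i.elim0, fun p => p.2.elim,
    fun i => i.elim0⟩
  have hU' := (Code.isPlanar _ hU).of_isotopic σ (Tangle.reindex_isIsotopic σ _)
  rw [ev, ev, ← S.eval_isotopic σ (Code.isPlanar _ hU) (Tangle.reindex_isIsotopic σ _) y,
    S.eval_eq_act hU', S.eval_eq_act (Code.isPlanar _ hT)]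
  refine (S.act_gluing (κ := fun _ => Empty) (d := fun _ _ => c) (Code.pierce x k out L z).tangle
    (fun _ => emptyTangle (fun _ => c) x) _ (Code.isPlanar _ hT)
    (fun _ => emptyTangle_isPlanar _ _) hU' (Code.pierce_isGluing x k out L z σ) _).trans ?_
  congr 1
  funext i
  rw [← S.emptyBox_eq c x fun k => y (σ ⟨i, k⟩), S.eval_eq_act (emptyTangle_isPlanar _ _)]
  rfl

theorem circle_eq {c : Color} (hC : (Code.circle c).Check) (y : Fin 0 → V c) :
    S.eval Tangle.circle (fun i => i.elim) = S.ev (Code.circle c) y := by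
  rw [circle_eq_circleTangle,
    S.eval_colour_congr circleTangle (col' := fun _ => c) _ (fun i => i.elim)]
  let σ : Empty ≃ Fin 0 := ⟨fun p => p.elim, fun i => i.elim0, fun p => p.elim, fun i => i.elim0⟩
  refine Eq.trans ?_ (S.eval_isotopic σ (Code.isPlanar _ hC) (circleTangle_isIsotopic c σ) y)
  congr 1
  funext i
  exact i.elim

theorem scalar_spherical (hS : S.IsIrreducibleSubfactor) {b : Color} {x y : Bool} {m k : ℕ}
    {inp : List (List ℕ)} {e e' : Code.Inner b m k} (h : (Code.closed b x m k inp e).Check)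
    (h' : (Code.closed b y m k inp e').Check) (v : Fin m → V b) :
    S.scalar (S.ev (Code.closed b x m k inp e) v) =
      S.scalar (S.ev (Code.closed b y m k inp e') v) := by
  rw [ev, ev, S.eval_eq_act (Code.isPlanar _ h), S.eval_eq_act (Code.isPlanar _ h')]
  exact hS.spherical _ _ _ _ (Code.closed_isSphericallyIsotopic e e') v

end PlanarStarAlgebra

/-! ### Tables of the standard tangles, and their agreement with the definitions -/

namespace Code

/-- Assignment of inputs by a table. -/
def sig {m : ℕ} {k : Fin m → ℕ} {n : ℕ} (L : List (List ℕ)) (i : Fin m) (l : Fin (k i)) :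
    Fin (n + 1) := Fin.ofNat (n + 1) ((L.getD i []).getD l 0)

/-- Assignment of inputs, when there are none. -/
def noInputs {m : ℕ} {k : Fin m → ℕ} (h : ∀ i, k i = 0) {n : ℕ} (i : Fin m) (l : Fin (k i)) :
    Fin n := absurd l.2 (by have := h i; omega)

def tops (n i : ℕ) : List ℕ := (List.range n).map (i * n + ·)

def bots (n i : ℕ) : List ℕ := (List.range n).map fun j => i * n + (n - 1 - j)

/-- The product of `r` boxes, the input `0` below. -/
def stack (n r : ℕ) : Code ⟨n, false⟩ ⟨n, false⟩ where
  m := r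
  -- The strings are numbered by level · n + column for the levels 0, …, r, and `k` is the last
  -- index, not the number of strings.
  k := (r + 1) * n - 1
  out := tops n r ++ bots n 0
  inp := (List.range r).map fun i => tops n (i + 1) ++ bots n i
  same := []

theorem stack_card (n r : ℕ) : (r + 1) * (n + 1) = (stack (n + 1) r).k + 1 := by
  have : 0 < (r + 1) * (n + 1) := by positivity
  simp only [stack]; omega

/-- Vertical strings. -/
def strings (c : Color) (n : ℕ) : Code c ⟨n, false⟩ := ⟨0, n - 1, tops n 0 ++ bots n 0, [], []⟩

/-- The Markov trace. -/
def trace (n : ℕ) : Code ⟨n, false⟩ ⟨0, false⟩ :=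
  closed ⟨n, false⟩ false 1 (n - 1) [tops n 0 ++ bots n 0] (Sum.inl (0, 0))

def contra : Code ⟨2, false⟩ ⟨2, false⟩ := ⟨1, 3, [0, 1, 2, 3], [[2, 3, 0, 1]], []⟩

def coprod : Code ⟨2, false⟩ ⟨2, false⟩ := ⟨2, 5, [0, 1, 2, 3], [[0, 4, 5, 3], [4, 1, 2, 5]], []⟩

def box : Code ⟨2, false⟩ ⟨3, false⟩ := ⟨1, 4, [4, 1, 2, 3, 0, 4], [[0, 1, 2, 3]], []⟩

/-- A cap above a cup. -/
def cupcap : Code ⟨2, false⟩ ⟨2, false⟩ := ⟨0, 1, [0, 0, 1, 1], [], []⟩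

theorem check_stack_one_one : (stack 1 1).Check := by decide +kernel
theorem check_stack_one_two : (stack 1 2).Check := by decide +kernel
theorem check_stack_two_one : (stack 2 1).Check := by decide +kernel
theorem check_stack_two_two : (stack 2 2).Check := by decide +kernel
theorem check_stack_two_three : (stack 2 3).Check := by decide +kernel
theorem check_stack_three_one : (stack 3 1).Check := by decide +kernel
theorem check_stack_three_two : (stack 3 2).Check := by decide +kernel
theorem check_stack_three_three : (stack 3 3).Check := by decide +kernel
theorem check_strings_one_one : (strings ⟨1, false⟩ 1).Check := by decide +kernel
theorem check_strings_two_two : (strings ⟨2, false⟩ 2).Check := by decide +kernel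
theorem check_strings_two_three : (strings ⟨2, false⟩ 3).Check := by decide +kernel
theorem check_strings_three_three : (strings ⟨3, false⟩ 3).Check := by decide +kernel
theorem check_trace_one : (trace 1).Check := by decide +kernel
theorem check_trace_two : (trace 2).Check := by decide +kernel
theorem check_trace_three : (trace 3).Check := by decide +kernel
theorem check_contra : contra.Check := by decide +kernel
theorem check_coprod : coprod.Check := by decide +kernel
theorem check_box : box.Check := by decide +kernel
theorem check_cupcap : cupcap.Check := by decide +kernel
theorem check_circle_one : (circle ⟨1, false⟩).Check := by decide +kernel
theorem check_circle_two : (circle ⟨2, false⟩).Check := by decide +kernel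

/-- The equivalence of `Unit` and `Fin 1`. -/
def unitEquiv : Unit ≃ Fin 1 := ⟨fun _ => 0, fun _ => (), fun _ => rfl, fun _ => Subsingleton.elim _ _⟩

theorem sameBase_isIsotopic {a b : Color} {ι Str : Type} {str : Point (fun _ : ι => b) a → Str}
    {C : Code b a} (σ : ι ≃ Fin C.m) (φ : Str ≃ Fin (C.k + 1))
    (h0 : ∀ q ∈ C.same, ∃ d d', q = (Sum.inl ⟨d, 0⟩, Sum.inl ⟨d', 0⟩))
    (h0' : ∀ d ∈ C.discs, C.lab (Sum.inl ⟨d, 0⟩) = C.lab (Sum.inl ⟨none, 0⟩))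
    (h1 : ∀ j, φ (str ⟨none, j⟩) = C.str ⟨none, j⟩)
    (h2 : ∀ i j, φ (str ⟨some i, j⟩) = C.str ⟨some (σ i), j⟩) :
    Tangle.IsIsotopic (c := fun _ : Fin C.m => b) σ (Tangle.ofStrings Str str Tangle.sameBase)
      C.tangle := by
  refine Code.ofStrings_isIsotopic σ φ ?_ ?_ ?_
  · rintro ⟨_ | i, j⟩
    · exact h1 j
    · exact h2 i j
  · have key : ∀ I : Interval (fun _ : ι => b) a, I.2.val = 0 →
        C.lab (edgeMap (c := fun _ : Fin C.m => b) σ φ (Sum.inl I)) =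
          C.lab (Sum.inl ⟨none, 0⟩) := by
      rintro ⟨_ | i, j⟩ hj
      · obtain rfl : j = 0 := Fin.ext hj
        rfl
      · obtain rfl : j = 0 := Fin.ext hj
        exact h0' (some (σ i)) (C.mem_discs _)
    rintro I I' ⟨h, h'⟩
    rw [key I h, key I' h']
  · intro q hq
    obtain ⟨d, d', rfl⟩ := h0 q hq
    have key : ∀ d : Option (Fin C.m), ∃ I : Interval (fun _ : ι => b) a, I.2.val = 0 ∧
        edgeMap (c := fun _ : Fin C.m => b) σ φ (Sum.inl I) = Sum.inl ⟨d, 0⟩ := by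
      rintro (_ | i)
      · exact ⟨⟨none, 0⟩, rfl, rfl⟩
      · obtain ⟨i, rfl⟩ := σ.surjective i
        exact ⟨⟨some i, 0⟩, rfl, rfl⟩
    obtain ⟨I, hI, h1⟩ := key d
    obtain ⟨I', hI', h2⟩ := key d'
    exact ⟨I, I', ⟨hI, hI'⟩, h1, h2⟩

end Code

namespace PlanarStarAlgebra

variable {V : Color → Type u} [∀ a, AddCommGroup (V a)] [∀ a, Module ℂ (V a)]
  (S : PlanarStarAlgebra V)

theorem eval_sameNone {a b : Color} {ι Str : Type} {str : Point (fun _ : ι => b) a → Str}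
    {C : Code b a} (hC : C.Check) (σ : ι ≃ Fin C.m) (φ : Str ≃ Fin (C.k + 1)) (h0 : C.same = [])
    (h1 : ∀ j, φ (str ⟨none, j⟩) = C.str ⟨none, j⟩)
    (h2 : ∀ i j, φ (str ⟨some i, j⟩) = C.str ⟨some (σ i), j⟩) (v : Fin C.m → V b) :
    S.eval (Tangle.ofStrings Str str Tangle.sameNone) (fun i => v (σ i)) = S.ev C v := by
  refine S.eval_isotopic σ (C.isPlanar hC) (Code.ofStrings_isIsotopic σ φ ?_ ?_ ?_) v
  · rintro ⟨_ | i, j⟩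
    · exact h1 j
    · exact h2 i j
  · intro I I' h
    exact h.elim
  · intro q hq
    rw [h0] at hq
    simp at hq

theorem eval_sameBase {a b : Color} {ι Str : Type} {str : Point (fun _ : ι => b) a → Str}
    {C : Code b a} (hC : C.Check) (σ : ι ≃ Fin C.m) (φ : Str ≃ Fin (C.k + 1))
    (h0 : ∀ q ∈ C.same, ∃ d d', q = (Sum.inl ⟨d, 0⟩, Sum.inl ⟨d', 0⟩))
    (h0' : ∀ d ∈ C.discs, C.lab (Sum.inl ⟨d, 0⟩) = C.lab (Sum.inl ⟨none, 0⟩))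
    (h1 : ∀ j, φ (str ⟨none, j⟩) = C.str ⟨none, j⟩)
    (h2 : ∀ i j, φ (str ⟨some i, j⟩) = C.str ⟨some (σ i), j⟩) (v : Fin C.m → V b) :
    S.eval (Tangle.ofStrings Str str Tangle.sameBase) (fun i => v (σ i)) = S.ev C v :=
  S.eval_isotopic σ (C.isPlanar hC) (Code.sameBase_isIsotopic σ φ h0 h0' h1 h2) v

theorem contra_eq (v : Fin 1 → V ⟨2, false⟩) : S.ev Code.contra v = S.contra (v 0) :=
  (S.eval_sameNone Code.check_contra Code.unitEquiv (Equiv.refl (Fin 4)) rfl (by decide +kernel)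
    (by decide +kernel) v).symm

theorem box_eq (v : Fin 1 → V ⟨2, false⟩) : S.ev Code.box v = S.box (v 0) :=
  (S.eval_sameNone Code.check_box Code.unitEquiv (Equiv.refl (Fin 5)) rfl (by decide +kernel)
    (by decide +kernel) v).symm

theorem vec_two {α : Type*} (v : Fin 2 → α) : ![v 0, v 1] = v := by
  funext i; fin_cases i <;> rfl

theorem coprod_eq (v : Fin 2 → V ⟨2, false⟩) : S.ev Code.coprod v = S.coprod (v 0) (v 1) := by
  rw [coprod, vec_two]
  exact (S.eval_sameNone Code.check_coprod (Equiv.refl (Fin 2)) (Equiv.refl (Fin 6)) rfl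
    (by decide +kernel) (by decide +kernel) v).symm

/-- `finProdFinEquiv` numbers a pair (level, column) in the order used by `stack`, so the two
descriptions have the same strings. -/
theorem mul_eq_of_check {n : ℕ} (h : (Code.stack (n + 1) 2).Check)
    (h0' : ∀ d ∈ (Code.stack (n + 1) 2).discs, (Code.stack (n + 1) 2).lab (Sum.inl ⟨d, 0⟩) =
      (Code.stack (n + 1) 2).lab (Sum.inl ⟨none, 0⟩))
    (h1 : ∀ j, ((finProdFinEquiv (m := 3) (n := n + 1)).trans (finCongr (Code.stack_card n 2)))
      ((Tangle.mul ⟨n + 1, false⟩).str ⟨none, j⟩) = (Code.stack (n + 1) 2).str ⟨none, j⟩)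
    (h2 : ∀ i j, ((finProdFinEquiv (m := 3) (n := n + 1)).trans (finCongr (Code.stack_card n 2)))
      ((Tangle.mul ⟨n + 1, false⟩).str ⟨some i, j⟩) = (Code.stack (n + 1) 2).str ⟨some i, j⟩)
    (v : Fin 2 → V ⟨n + 1, false⟩) : S.ev (Code.stack (n + 1) 2) v = S.mul (v 0) (v 1) := by
  rw [mul, vec_two]
  exact (S.eval_sameBase h (Equiv.refl (Fin 2))
    (finProdFinEquiv.trans (finCongr (Code.stack_card n 2))) (fun q hq => absurd hq List.not_mem_nil) h0' h1 h2 v).symm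

theorem mul_eq_one (v : Fin 2 → V ⟨1, false⟩) : S.ev (Code.stack 1 2) v = S.mul (v 0) (v 1) :=
  S.mul_eq_of_check Code.check_stack_one_two (by decide +kernel) (by decide +kernel)
    (by decide +kernel) v

theorem mul_eq_two (v : Fin 2 → V ⟨2, false⟩) : S.ev (Code.stack 2 2) v = S.mul (v 0) (v 1) :=
  S.mul_eq_of_check Code.check_stack_two_two (by decide +kernel) (by decide +kernel)
    (by decide +kernel) v

theorem mul_eq_three (v : Fin 2 → V ⟨3, false⟩) : S.ev (Code.stack 3 2) v = S.mul (v 0) (v 1) :=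
  S.mul_eq_of_check Code.check_stack_three_two (by decide +kernel) (by decide +kernel)
    (by decide +kernel) v

end PlanarStarAlgebra

/-! ### Identities between product, coproduct, involution and quarter turn -/

namespace Code

/-- The turned coproduct of two inputs, with a vertical string on its left. -/
def boxCoprod : Code ⟨2, false⟩ ⟨3, false⟩ :=
  ⟨2, 6, [6, 1, 2, 3, 0, 6], [[0, 4, 5, 3], [4, 1, 2, 5]], []⟩

/-- The product of two inputs, turned by a half turn. -/
def contraMul : Code ⟨2, false⟩ ⟨2, false⟩ :=
  ⟨2, 5, [1, 0, 4, 5], [[2, 3, 1, 0], [4, 5, 3, 2]], []⟩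

theorem check_boxCoprod : boxCoprod.Check := by decide +kernel
theorem check_contraMul : contraMul.Check := by decide +kernel

end Code

namespace PlanarStarAlgebra

open Code

variable {V : Color → Type u} [∀ a, AddCommGroup (V a)] [∀ a, Module ℂ (V a)]
  (S : PlanarStarAlgebra V)

/-- Diagrams without inputs do not depend on the colour of the inputs. -/
theorem ev_nullary {a c c' : Color} {k : ℕ} {out : List ℕ}
    (h : (Code.mk 0 k out [] [] : Code c a).Check) (h' : (Code.mk 0 k out [] [] : Code c' a).Check)
    (y : Fin 0 → V c) (y' : Fin 0 → V c') :
    S.ev (Code.mk 0 k out [] [] : Code c a) y = S.ev (Code.mk 0 k out [] [] : Code c' a) y' := by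
  let str : ∀ col : Empty → Color, Point col a → Fin (k + 1) := fun col p => match p with
    | ⟨none, j⟩ => (Code.mk 0 k out [] [] : Code c a).str ⟨none, j⟩
    | ⟨some i, _⟩ => i.elim
  let σ : Empty ≃ Fin 0 := ⟨fun p => p.elim, fun i => i.elim0, fun p => p.elim, fun i => i.elim0⟩
  have key : ∀ (c : Color) (h : (Code.mk 0 k out [] [] : Code c a).Check) (y : Fin 0 → V c),
      S.eval (Tangle.ofStrings (Fin (k + 1)) (str fun _ => c) Tangle.sameNone) (fun i => y (σ i)) =
        S.ev (Code.mk 0 k out [] [] : Code c a) y := fun c h y =>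
    S.eval_sameNone h σ (Equiv.refl _) rfl (fun j => rfl) (fun i => i.elim) y
  rw [← key c h, ← key c' h']
  exact S.eval_colour_congr
    (fun col => Tangle.ofStrings (Fin (k + 1)) (str col) Tangle.sameNone) _ _

theorem tr_eq_of_check {n : ℕ} (h : (Code.trace (n + 1)).Check)
    (h0' : ∀ d ∈ (Code.trace (n + 1)).discs, (Code.trace (n + 1)).lab (Sum.inl ⟨d, 0⟩) =
      (Code.trace (n + 1)).lab (Sum.inl ⟨none, 0⟩))
    (h2 : ∀ j : Fin (2 * (n + 1)), (column (n := n + 1) j).val =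
      ((Code.trace (n + 1)).str ⟨some (0 : Fin 1), j⟩).val) (v : Fin 1 → V ⟨n + 1, false⟩) :
    S.tr (v 0) = S.scalar (S.ev (Code.trace (n + 1)) v) :=
  congrArg S.scalar (S.eval_sameBase h Code.unitEquiv (Equiv.refl (Fin (n + 1)))
    (fun _ hq => ⟨none, some (0 : Fin 1), List.mem_singleton.1 hq⟩) h0' (fun j => j.elim0)
    (fun _ j => Fin.ext (h2 j)) v)

theorem tr_eq_one (v : Fin 1 → V ⟨1, false⟩) : S.tr (v 0) = S.scalar (S.ev (Code.trace 1) v) :=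
  S.tr_eq_of_check check_trace_one (by decide +kernel) (by decide +kernel) v

theorem tr_eq_two (v : Fin 1 → V ⟨2, false⟩) : S.tr (v 0) = S.scalar (S.ev (Code.trace 2) v) :=
  S.tr_eq_of_check check_trace_two (by decide +kernel) (by decide +kernel) v

theorem tr_eq_three (v : Fin 1 → V ⟨3, false⟩) : S.tr (v 0) = S.scalar (S.ev (Code.trace 3) v) :=
  S.tr_eq_of_check check_trace_three (by decide +kernel) (by decide +kernel) v

/-- A stack of height one is the identity tangle with its strings renumbered. It serves as the
filler for inputs that a gluing leaves untouched. -/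
theorem ident_eq_of_check {n : ℕ} (h : (Code.stack (n + 1) 1).Check)
    (h0' : ∀ d ∈ (Code.stack (n + 1) 1).discs, (Code.stack (n + 1) 1).lab (Sum.inl ⟨d, 0⟩) =
      (Code.stack (n + 1) 1).lab (Sum.inl ⟨none, 0⟩))
    (φ : Fin (2 * (n + 1)) ≃ Fin ((Code.stack (n + 1) 1).k + 1))
    (h1 : ∀ j, φ j = (Code.stack (n + 1) 1).str ⟨none, j⟩)
    (h2 : ∀ j, φ j = (Code.stack (n + 1) 1).str ⟨some (0 : Fin 1), j⟩)
    (v : Fin 1 → V ⟨n + 1, false⟩) : S.ev (Code.stack (n + 1) 1) v = v 0 := by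
  have hi : Tangle.IsIsotopic (c := fun _ : Fin 1 => (⟨n + 1, false⟩ : Color)) Code.unitEquiv
      (Tangle.ident ⟨n + 1, false⟩) (Code.stack (n + 1) 1).tangle :=
    Code.sameBase_isIsotopic (C := Code.stack (n + 1) 1) Code.unitEquiv φ
      (fun q hq => absurd hq List.not_mem_nil) h0' h1 (fun _ j => h2 j)
  have hp := (Code.isPlanar _ h).of_isotopic _ hi
  rw [← S.act_ident _ hp (v 0), ← S.eval_eq_act hp]
  exact (S.eval_isotopic Code.unitEquiv (Code.isPlanar _ h) hi v).symm

theorem ident_eq_one (v : Fin 1 → V ⟨1, false⟩) : S.ev (Code.stack 1 1) v = v 0 :=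
  S.ident_eq_of_check check_stack_one_one (by decide +kernel) ⟨![1, 0], ![1, 0], by decide, by decide⟩
    (by decide +kernel) (by decide +kernel) v

theorem ident_eq_two (v : Fin 1 → V ⟨2, false⟩) : S.ev (Code.stack 2 1) v = v 0 :=
  S.ident_eq_of_check check_stack_two_one (by decide +kernel) ⟨![2, 3, 1, 0], ![3, 2, 0, 1], by decide, by decide⟩
    (by decide +kernel) (by decide +kernel) v

theorem ident_eq_three (v : Fin 1 → V ⟨3, false⟩) : S.ev (Code.stack 3 1) v = v 0 :=
  S.ident_eq_of_check check_stack_three_one (by decide +kernel) ⟨![3, 4, 5, 2, 1, 0], ![5, 4, 3, 0, 1, 2], by decide, by decide⟩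
    (by decide +kernel) (by decide +kernel) v

/-- Both sides glue to the stack of three boxes. The later identities follow the same pattern:
translate into tables, glue to a common table, translate back. -/
theorem mul_assoc_two (x y z : V ⟨2, false⟩) : S.mul (S.mul x y) z = S.mul x (S.mul y z) :=
  (S.mul_eq_two ![S.mul x y, z]).symm.trans <|
    (S.ev_glue (T := stack 2 2) (R := ![stack 2 2, stack 2 1]) (U := stack 2 3)
      (σ := sig [[0, 1], [2]]) check_stack_two_two
      (Fin.forall_fin_two.2 ⟨check_stack_two_two, check_stack_two_one⟩) check_stack_two_three
      (by decide +kernel) ![x, y, z] ![S.mul x y, z]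
      (Fin.forall_fin_two.2 ⟨S.mul_eq_two _, S.ident_eq_two _⟩)).trans <|
    (S.ev_glue (T := stack 2 2) (R := ![stack 2 1, stack 2 2]) (U := stack 2 3)
      (σ := sig [[0], [1, 2]]) check_stack_two_two
      (Fin.forall_fin_two.2 ⟨check_stack_two_one, check_stack_two_two⟩) check_stack_two_three
      (by decide +kernel) ![x, y, z] ![x, S.mul y z]
      (Fin.forall_fin_two.2 ⟨S.ident_eq_two _, S.mul_eq_two _⟩)).symm.trans
    (S.mul_eq_two ![x, S.mul y z])

/-- The unit of the algebra of `n`-boxes. -/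
noncomputable def one (n : ℕ) : V ⟨n, false⟩ := S.ev (strings ⟨n, false⟩ n) fun i => i.elim0

/-- A multiple of the first Jones projection. -/
noncomputable def jones : V ⟨2, false⟩ := S.ev cupcap fun i => i.elim0

theorem one_eq {n : ℕ} (y : Fin 0 → V ⟨n, false⟩) : S.ev (strings ⟨n, false⟩ n) y = S.one n :=
  congrArg (S.ev (strings ⟨n, false⟩ n)) (funext fun i : Fin 0 => i.elim0)

theorem jones_eq (y : Fin 0 → V ⟨2, false⟩) : S.ev cupcap y = S.jones :=
  congrArg (S.ev cupcap) (funext fun i : Fin 0 => i.elim0)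

theorem one_mul_one (x : V ⟨1, false⟩) : S.mul (S.one 1) x = x :=
  (S.mul_eq_one ![S.one 1, x]).symm.trans <|
    (S.ev_glue (T := stack 1 2) (R := ![strings ⟨1, false⟩ 1, stack 1 1]) (U := stack 1 1)
      (σ := sig [[], [0]]) check_stack_one_two
      (Fin.forall_fin_two.2 ⟨check_strings_one_one, check_stack_one_one⟩) check_stack_one_one
      (by decide +kernel) ![x] ![S.one 1, x]
      (Fin.forall_fin_two.2 ⟨S.one_eq _, S.ident_eq_one _⟩)).trans (S.ident_eq_one ![x])

theorem one_mul_two (x : V ⟨2, false⟩) : S.mul (S.one 2) x = x :=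
  (S.mul_eq_two ![S.one 2, x]).symm.trans <|
    (S.ev_glue (T := stack 2 2) (R := ![strings ⟨2, false⟩ 2, stack 2 1]) (U := stack 2 1)
      (σ := sig [[], [0]]) check_stack_two_two
      (Fin.forall_fin_two.2 ⟨check_strings_two_two, check_stack_two_one⟩) check_stack_two_one
      (by decide +kernel) ![x] ![S.one 2, x]
      (Fin.forall_fin_two.2 ⟨S.one_eq _, S.ident_eq_two _⟩)).trans (S.ident_eq_two ![x])

theorem mul_one_two (x : V ⟨2, false⟩) : S.mul x (S.one 2) = x :=
  (S.mul_eq_two ![x, S.one 2]).symm.trans <|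
    (S.ev_glue (T := stack 2 2) (R := ![stack 2 1, strings ⟨2, false⟩ 2]) (U := stack 2 1)
      (σ := sig [[0], []]) check_stack_two_two
      (Fin.forall_fin_two.2 ⟨check_stack_two_one, check_strings_two_two⟩) check_stack_two_one
      (by decide +kernel) ![x] ![x, S.one 2]
      (Fin.forall_fin_two.2 ⟨S.ident_eq_two _, S.one_eq _⟩)).trans (S.ident_eq_two ![x])

theorem one_mul_three (x : V ⟨3, false⟩) : S.mul (S.one 3) x = x :=
  (S.mul_eq_three ![S.one 3, x]).symm.trans <|
    (S.ev_glue (T := stack 3 2) (R := ![strings ⟨3, false⟩ 3, stack 3 1]) (U := stack 3 1)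
      (σ := sig [[], [0]]) check_stack_three_two
      (Fin.forall_fin_two.2 ⟨check_strings_three_three, check_stack_three_one⟩)
      check_stack_three_one (by decide +kernel) ![x] ![S.one 3, x]
      (Fin.forall_fin_two.2 ⟨S.one_eq _, S.ident_eq_three _⟩)).trans (S.ident_eq_three ![x])

theorem mul_assoc_three (x y z : V ⟨3, false⟩) : S.mul (S.mul x y) z = S.mul x (S.mul y z) :=
  (S.mul_eq_three ![S.mul x y, z]).symm.trans <|
    (S.ev_glue (T := stack 3 2) (R := ![stack 3 2, stack 3 1]) (U := stack 3 3)
      (σ := sig [[0, 1], [2]]) check_stack_three_two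
      (Fin.forall_fin_two.2 ⟨check_stack_three_two, check_stack_three_one⟩) check_stack_three_three
      (by decide +kernel) ![x, y, z] ![S.mul x y, z]
      (Fin.forall_fin_two.2 ⟨S.mul_eq_three _, S.ident_eq_three _⟩)).trans <|
    (S.ev_glue (T := stack 3 2) (R := ![stack 3 1, stack 3 2]) (U := stack 3 3)
      (σ := sig [[0], [1, 2]]) check_stack_three_two
      (Fin.forall_fin_two.2 ⟨check_stack_three_one, check_stack_three_two⟩) check_stack_three_three
      (by decide +kernel) ![x, y, z] ![x, S.mul y z]
      (Fin.forall_fin_two.2 ⟨S.ident_eq_three _, S.mul_eq_three _⟩)).symm.trans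
    (S.mul_eq_three ![x, S.mul y z])

theorem star_mul_two (x y : V ⟨2, false⟩) :
    S.star (S.mul x y) = S.mul (S.star y) (S.star x) :=
  (congrArg S.star (S.mul_eq_two ![x, y])).symm.trans <|
    (S.star_ev check_stack_two_two ![x, y]).trans <|
    (S.ev_glue (T := stack 2 1) (R := ![stack 2 2]) (U := (stack 2 2).mirror)
      (σ := sig [[1, 0]]) check_stack_two_one (Fin.forall_fin_one.2 check_stack_two_two)
      (by decide +kernel) (by decide +kernel) (fun i => S.star (![x, y] i))
      ![S.mul (S.star y) (S.star x)] (Fin.forall_fin_one.2 (S.mul_eq_two _))).symm.trans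
    (S.ident_eq_two _)

theorem star_mul_three (x y : V ⟨3, false⟩) :
    S.star (S.mul x y) = S.mul (S.star y) (S.star x) :=
  (congrArg S.star (S.mul_eq_three ![x, y])).symm.trans <|
    (S.star_ev check_stack_three_two ![x, y]).trans <|
    (S.ev_glue (T := stack 3 1) (R := ![stack 3 2]) (U := (stack 3 2).mirror)
      (σ := sig [[1, 0]]) check_stack_three_one (Fin.forall_fin_one.2 check_stack_three_two)
      (by decide +kernel) (by decide +kernel) (fun i => S.star (![x, y] i))
      ![S.mul (S.star y) (S.star x)] (Fin.forall_fin_one.2 (S.mul_eq_three _))).symm.trans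
    (S.ident_eq_three _)

theorem star_contra (a : V ⟨2, false⟩) : S.star (S.contra a) = S.contra (S.star a) :=
  (congrArg S.star (S.contra_eq ![a])).symm.trans <|
    (S.star_ev check_contra ![a]).trans <|
    (S.ev_glue (T := stack 2 1) (R := ![Code.contra]) (U := Code.contra.mirror)
      (σ := sig [[0]]) check_stack_two_one (Fin.forall_fin_one.2 check_contra)
      (by decide +kernel) (by decide +kernel) (fun i => S.star (![a] i))
      ![S.contra (S.star a)] (Fin.forall_fin_one.2 (S.contra_eq _))).symm.trans
    (S.ident_eq_two _)

theorem star_coprod (a b : V ⟨2, false⟩) :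
    S.star (S.coprod a b) = S.coprod (S.star a) (S.star b) :=
  (congrArg S.star (S.coprod_eq ![a, b])).symm.trans <|
    (S.star_ev check_coprod ![a, b]).trans <|
    (S.ev_glue (T := stack 2 1) (R := ![Code.coprod]) (U := Code.coprod.mirror)
      (σ := sig [[0, 1]]) check_stack_two_one (Fin.forall_fin_one.2 check_coprod)
      (by decide +kernel) (by decide +kernel) (fun i => S.star (![a, b] i))
      ![S.coprod (S.star a) (S.star b)] (Fin.forall_fin_one.2 (S.coprod_eq _))).symm.trans
    (S.ident_eq_two _)

/-- Reflecting a box that was turned by a quarter is the same as turning the reflected box a quarter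
the other way, which differs by a half turn. -/
theorem star_box (a : V ⟨2, false⟩) : S.star (S.box a) = S.box (S.contra (S.star a)) :=
  (congrArg S.star (S.box_eq ![a])).symm.trans <|
    (S.star_ev check_box ![a]).trans <|
    (S.ev_glue (T := Code.box) (R := ![Code.contra]) (U := Code.box.mirror)
      (σ := sig [[0]]) check_box (Fin.forall_fin_one.2 check_contra)
      (by decide +kernel) (by decide +kernel) (fun i => S.star (![a] i))
      ![S.contra (S.star a)] (Fin.forall_fin_one.2 (S.contra_eq _))).symm.trans
    (S.box_eq _)

theorem star_one_two : S.star (S.one 2) = S.one 2 :=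
  (S.star_ev check_strings_two_two _).trans (S.one_eq _)

theorem star_one_one : S.star (S.one 1) = S.one 1 :=
  (S.star_ev check_strings_one_one _).trans (S.one_eq _)

theorem star_jones : S.star S.jones = S.jones :=
  (S.star_ev check_cupcap _).trans <|
    (S.ev_glue (T := stack 2 1) (R := ![cupcap]) (U := cupcap.mirror)
      (σ := noInputs (Fin.forall_fin_one.2 rfl)) check_stack_two_one
      (Fin.forall_fin_one.2 check_cupcap) (by decide +kernel) (by decide +kernel) _
      ![S.jones] (Fin.forall_fin_one.2 (S.jones_eq _))).symm.trans
    (S.ident_eq_two _)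

/-- A quarter turn makes the cap and the cup into two vertical strings. This is why `jones` is the
unit of the coproduct. -/
theorem box_jones : S.box S.jones = S.one 3 :=
  (S.box_eq ![S.jones]).symm.trans <|
    (S.ev_glue (T := Code.box) (R := ![cupcap]) (U := strings ⟨2, false⟩ 3)
      (σ := noInputs (Fin.forall_fin_one.2 rfl)) check_box
      (Fin.forall_fin_one.2 check_cupcap) check_strings_two_three (by decide +kernel)
      (fun i => i.elim0) ![S.jones] (Fin.forall_fin_one.2 (S.jones_eq _))).trans <|
    (S.ev_nullary check_strings_two_three check_strings_three_three _ _)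

/-- The quarter turn exchanges horizontal and vertical composition. -/
theorem box_mul (a b : V ⟨2, false⟩) : S.mul (S.box a) (S.box b) = S.box (S.coprod a b) :=
  (S.mul_eq_three ![S.box a, S.box b]).symm.trans <|
    (S.ev_glue (T := stack 3 2) (R := ![Code.box, Code.box]) (U := boxCoprod)
      (σ := sig [[0], [1]]) check_stack_three_two
      (Fin.forall_fin_two.2 ⟨check_box, check_box⟩) check_boxCoprod
      (by decide +kernel) ![a, b] ![S.box a, S.box b]
      (Fin.forall_fin_two.2 ⟨S.box_eq _, S.box_eq _⟩)).trans <|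
    (S.ev_glue (T := Code.box) (R := ![Code.coprod]) (U := boxCoprod) (σ := sig [[0, 1]])
      check_box (Fin.forall_fin_one.2 check_coprod) check_boxCoprod (by decide +kernel)
      ![a, b] ![S.coprod a b] (Fin.forall_fin_one.2 (S.coprod_eq _))).symm.trans
    (S.box_eq ![S.coprod a b])

theorem contra_contra (a : V ⟨2, false⟩) : S.contra (S.contra a) = a :=
  (S.contra_eq ![S.contra a]).symm.trans <|
    (S.ev_glue (T := Code.contra) (R := ![Code.contra]) (U := stack 2 1) (σ := sig [[0]])
      check_contra (Fin.forall_fin_one.2 check_contra) check_stack_two_one (by decide +kernel)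
      ![a] ![S.contra a] (Fin.forall_fin_one.2 (S.contra_eq _))).trans
    (S.ident_eq_two _)

theorem contra_mul (a b : V ⟨2, false⟩) :
    S.contra (S.mul a b) = S.mul (S.contra b) (S.contra a) :=
  (S.contra_eq ![S.mul a b]).symm.trans <|
    (S.ev_glue (T := Code.contra) (R := ![stack 2 2]) (U := contraMul)
      (σ := sig [[0, 1]]) check_contra (Fin.forall_fin_one.2 check_stack_two_two)
      check_contraMul (by decide +kernel) ![a, b] ![S.mul a b]
      (Fin.forall_fin_one.2 (S.mul_eq_two _))).trans <|
    (S.ev_glue (T := stack 2 2) (R := ![Code.contra, Code.contra]) (U := contraMul)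
      (σ := sig [[1], [0]]) check_stack_two_two
      (Fin.forall_fin_two.2 ⟨check_contra, check_contra⟩) check_contraMul (by decide +kernel) ![a, b] ![S.contra b, S.contra a]
      (Fin.forall_fin_two.2 ⟨S.contra_eq _, S.contra_eq _⟩)).symm.trans
    (S.mul_eq_two ![S.contra b, S.contra a])

end PlanarStarAlgebra

/-! ### Trace identities and extraction of circles -/

namespace Code

theorem check_closedStack : (closed ⟨2, false⟩ false 2 3 [[2, 3, 1, 0], [0, 1, 3, 2]]
  (Sum.inl (0, 0))).Check := by decide +kernel

/-- The conditional expectation of `2`-boxes onto `1`-boxes. -/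
def expect : Code ⟨2, false⟩ ⟨1, false⟩ := ⟨1, 2, [0, 1], [[0, 2, 2, 1]], []⟩

/-- A vertical string added on the right of a `1`-box. -/
def incl : Code ⟨1, false⟩ ⟨2, false⟩ := ⟨1, 2, [0, 2, 2, 1], [[0, 1]], []⟩

/-- The conditional expectation with a vertical string on the right. -/
def inclExpect : Code ⟨2, false⟩ ⟨2, false⟩ := ⟨1, 3, [0, 3, 3, 1], [[0, 2, 2, 1]], []⟩

/-- A vertical string to the right of a `0`-box. -/
abbrev pierceOne : Code ⟨0, false⟩ ⟨1, false⟩ := pierce (c := ⟨1, false⟩) false 0 [0, 0] [] (Sum.inl ⟨none, 0⟩)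

/-- A cap above a cup, with a `0`-box between them. -/
abbrev pierceTwo : Code ⟨0, false⟩ ⟨2, false⟩ := pierce (c := ⟨2, false⟩) false 1 [0, 0, 1, 1] [] (Sum.inl ⟨none, 0⟩)

/-- A cap above a cup, with a circle between them. -/
def cupcapCircle (c : Color) : Code c ⟨2, false⟩ :=
  ⟨0, 2, [0, 0, 1, 1], [], [(Sum.inl ⟨none, 0⟩, Sum.inr (2, false))]⟩

theorem check_expect : expect.Check := by decide +kernel
theorem check_incl : incl.Check := by decide +kernel
theorem check_inclExpect : inclExpect.Check := by decide +kernel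
theorem check_pierceOne : pierceOne.Check := by decide +kernel
theorem check_pierceTwo : pierceTwo.Check := by decide +kernel
theorem check_cupcapCircle : (cupcapCircle ⟨2, false⟩).Check := by decide +kernel

end Code

namespace PlanarStarAlgebra

open Code

variable {V : Color → Type u} [∀ a, AddCommGroup (V a)] [∀ a, Module ℂ (V a)]
  (S : PlanarStarAlgebra V)

theorem vec_one {α : Type*} (v : Fin 1 → α) : ![v 0] = v := by
  funext i; fin_cases i; rfl

theorem tr_mul_comm_two (a b : V ⟨2, false⟩) : S.tr (S.mul a b) = S.tr (S.mul b a) :=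
  (S.tr_eq_two ![S.mul a b]).trans <| (congrArg S.scalar <|
    (S.ev_glue (T := Code.trace 2) (R := ![stack 2 2]) (U := _) (σ := sig [[0, 1]])
      check_trace_two (Fin.forall_fin_one.2 check_stack_two_two) check_closedStack
      (by decide +kernel) ![a, b] ![S.mul a b] (Fin.forall_fin_one.2 (S.mul_eq_two _))).trans
    (S.ev_glue (T := Code.trace 2) (R := ![stack 2 2]) (U := _) (σ := sig [[1, 0]])
      check_trace_two (Fin.forall_fin_one.2 check_stack_two_two) check_closedStack
      (by decide +kernel) ![a, b] ![S.mul b a] (Fin.forall_fin_one.2 (S.mul_eq_two _))).symm).trans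
    (S.tr_eq_two ![S.mul b a]).symm

/-- Joining two vertical strings to the right of `a` closes its right side and leaves one free
string. -/
theorem ev_incl_expect (a : V ⟨2, false⟩) :
    S.ev incl ![S.ev expect ![a]] = S.coprod a (S.one 2) :=
  (S.ev_glue (T := incl) (R := ![expect]) (U := inclExpect) (σ := sig [[0]])
      check_incl (Fin.forall_fin_one.2 check_expect) check_inclExpect
      (by decide +kernel) ![a] ![S.ev expect ![a]]
      (Fin.forall_fin_one.2 (congrArg (S.ev expect) (vec_one _).symm))).trans <|
    (S.ev_glue (T := Code.coprod) (R := ![stack 2 1, strings ⟨2, false⟩ 2]) (U := inclExpect)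
      (σ := sig [[0], []]) check_coprod
      (Fin.forall_fin_two.2 ⟨check_stack_two_one, check_strings_two_two⟩) check_inclExpect
      (by decide +kernel) ![a] ![a, S.one 2]
      (Fin.forall_fin_two.2 ⟨S.ident_eq_two _, S.one_eq _⟩)).symm.trans
    (S.coprod_eq ![a, S.one 2])

theorem tr_expect (a : V ⟨2, false⟩) : S.tr (S.ev expect ![a]) = S.tr a :=
  (S.tr_eq_one ![S.ev expect ![a]]).trans <| (congrArg S.scalar <|
    (S.ev_glue (T := Code.trace 1) (R := ![expect]) (U := Code.trace 2) (σ := sig [[0]])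
      check_trace_one (Fin.forall_fin_one.2 check_expect) check_trace_two
      (by decide +kernel) ![a] ![S.ev expect ![a]]
      (Fin.forall_fin_one.2 (congrArg (S.ev expect) (vec_one _).symm)))).trans
    (S.tr_eq_two ![a]).symm

theorem ev_incl_one : S.ev incl ![S.one 1] = S.one 2 :=
  (S.ev_glue (T := incl) (R := ![strings ⟨1, false⟩ 1]) (U := strings ⟨1, false⟩ 2)
      (σ := noInputs (Fin.forall_fin_one.2 rfl)) check_incl
      (Fin.forall_fin_one.2 check_strings_one_one) (by decide +kernel) (by decide +kernel)
      (fun i => i.elim0) ![S.one 1] (Fin.forall_fin_one.2 (S.one_eq _))).trans <|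
    (S.ev_nullary (by decide +kernel) check_strings_two_two _ _)

theorem tr_one_one : S.tr (S.one 1) = S.δ :=
  (S.tr_eq_one ![S.one 1]).trans <| congrArg S.scalar <|
    (S.ev_glue (T := Code.trace 1) (R := ![strings ⟨1, false⟩ 1]) (U := Code.circle ⟨1, false⟩)
      (σ := noInputs (Fin.forall_fin_one.2 rfl)) check_trace_one
      (Fin.forall_fin_one.2 check_strings_one_one) check_circle_one (by decide +kernel)
      (fun i => i.elim0) ![S.one 1] (Fin.forall_fin_one.2 (S.one_eq _))).trans
    (S.circle_eq check_circle_one _).symm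

theorem tr_jones : S.tr S.jones = S.δ :=
  (S.tr_eq_two ![S.jones]).trans <| congrArg S.scalar <|
    (S.ev_glue (T := Code.trace 2) (R := ![cupcap]) (U := Code.circle ⟨2, false⟩)
      (σ := noInputs (Fin.forall_fin_one.2 rfl)) check_trace_two
      (Fin.forall_fin_one.2 check_cupcap) check_circle_two (by decide +kernel)
      (fun i => i.elim0) ![S.jones] (Fin.forall_fin_one.2 (S.jones_eq _))).trans
    (S.circle_eq check_circle_two _).symm

/-- The unit depends linearly on the unshaded empty diagram, which therefore cannot vanish. -/
theorem one_eq_pierce : S.one 1 = S.ev pierceOne fun _ => S.emptyBox false :=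
  S.ev_pierce _ _ _ _ _ check_pierceOne check_strings_one_one _

theorem jones_eq_pierce : S.jones = S.ev pierceTwo fun _ => S.emptyBox false :=
  S.ev_pierce _ _ _ _ _ check_pierceTwo check_cupcap _

/-- Stacking two cap-cup diagrams leaves a circle in the middle, which becomes an input of the
pierced diagram and will be replaced by a scalar. -/
theorem jones_mul_jones_eq :
    S.mul S.jones S.jones = S.ev pierceTwo fun _ => S.eval Tangle.circle fun i => i.elim :=
  (S.mul_eq_two ![S.jones, S.jones]).symm.trans <|
    (S.ev_glue (T := stack 2 2) (R := ![cupcap, cupcap]) (U := cupcapCircle ⟨2, false⟩)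
      (σ := noInputs (Fin.forall_fin_two.2 ⟨rfl, rfl⟩)) check_stack_two_two
      (Fin.forall_fin_two.2 ⟨check_cupcap, check_cupcap⟩) check_cupcapCircle
      (by decide +kernel) (fun i => i.elim0) ![S.jones, S.jones]
      (Fin.forall_fin_two.2 ⟨S.jones_eq _, S.jones_eq _⟩)).trans
    (S.ev_glue (T := pierceTwo) (R := ![Code.circle ⟨2, false⟩]) (U := cupcapCircle ⟨2, false⟩)
      (σ := noInputs (Fin.forall_fin_one.2 rfl)) check_pierceTwo
      (Fin.forall_fin_one.2 check_circle_two) check_cupcapCircle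
      (by decide +kernel) (fun i => i.elim0) _
      (Fin.forall_fin_one.2 (S.circle_eq check_circle_two _).symm)).symm

theorem star_emptyBox (x : Bool) : S.star (S.emptyBox x) = S.emptyBox x := by
  have h := emptyTangle_isPlanar (fun i => i.elim) x
  have hm : (emptyTangle (fun i => i.elim) x).mirror = emptyTangle (fun i => i.elim) x := by
    unfold Tangle.mirror emptyTangle
    congr 1
    funext p
    rcases p with ⟨_ | i, j⟩
    · exact j.elim0
    · exact i.elim
  have h' : (emptyTangle (fun i => i.elim) x).mirror.IsPlanar := hm.symm ▸ h
  rw [emptyBox, empty_eq_emptyTangle, S.eval_eq_act h, S.star_act _ h h', ← S.eval_eq_act h',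
    ← S.eval_eq_act h, hm]
  congr 1
  funext i
  exact i.elim

/-- Reflection attaches the outer disc to the last interval of the input instead of the interval
`0`. These are two names of the distinguished interval, so the regions are unchanged. -/
theorem star_trace_two (a : V ⟨2, false⟩) :
    S.star (S.ev (Code.trace 2) ![a]) = S.ev (Code.trace 2) ![S.star a] :=
  (S.star_ev check_trace_two ![a]).trans <|
    (S.ev_withSame (C := (Code.trace 2).mirror) (by decide +kernel) (Code.trace 2).same
      (List.forall_mem_singleton.2 (by decide +kernel))
      (List.forall_mem_singleton.2 (by decide +kernel)) _).symm.trans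
    (congrArg (S.ev (Code.trace 2)) (vec_one _).symm)

theorem star_trace_three (a : V ⟨3, false⟩) :
    S.star (S.ev (Code.trace 3) ![a]) = S.ev (Code.trace 3) ![S.star a] :=
  (S.star_ev check_trace_three ![a]).trans <|
    (S.ev_withSame (C := (Code.trace 3).mirror) (by decide +kernel) (Code.trace 3).same
      (List.forall_mem_singleton.2 (by decide +kernel))
      (List.forall_mem_singleton.2 (by decide +kernel)) _).symm.trans
    (congrArg (S.ev (Code.trace 3)) (vec_one _).symm)

end PlanarStarAlgebra

/-! ### The trace of turned boxes, and triangles of `2`-boxes -/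

namespace Code

/-- A disc inside of a circle. -/
abbrev pierceCircle : Code ⟨0, true⟩ ⟨0, false⟩ :=
  pierce (c := ⟨2, false⟩) true 0 [] [(Sum.inl ⟨none, (0 : Fin 1)⟩, Sum.inr (0, false))]
    (Sum.inr (0, true))

/-- The input with the left points and the right points joined to each other by arcs. -/
def sideTrace : Code ⟨2, false⟩ ⟨0, true⟩ :=
  closed ⟨2, false⟩ true 1 1 [[0, 0, 1, 1]] (Sum.inl (0, 1))

/-- The previous tangle, inside of a circle. -/
def sideTraceCircle : Code ⟨2, false⟩ ⟨0, false⟩ :=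
  ⟨1, 2, [], [[0, 0, 1, 1]], [(Sum.inl ⟨none, (0 : Fin 1)⟩, Sum.inr (2, false)),
    (Sum.inr (2, true), Sum.inl ⟨some 0, 1⟩)]⟩

/-- The product of two inputs, the first turned by a half turn. -/
def mulContra : Code ⟨2, false⟩ ⟨2, false⟩ := ⟨2, 5, [4, 5, 1, 0], [[1, 0, 2, 3], [4, 5, 3, 2]], []⟩

/-- The pairing of two inputs. -/
def pairing (x : Bool) (e : Inner ⟨2, false⟩ 2 3) : Code ⟨2, false⟩ ⟨0, x⟩ :=
  closed ⟨2, false⟩ x 2 3 [[0, 2, 3, 1], [2, 0, 1, 3]] e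

theorem check_pierceCircle : pierceCircle.Check := by decide +kernel
theorem check_sideTrace : sideTrace.Check := by decide +kernel
theorem check_sideTraceCircle : sideTraceCircle.Check := by decide +kernel
theorem check_mulContra : mulContra.Check := by decide +kernel
theorem check_pairing_true : (pairing true (Sum.inl (0, 1))).Check := by decide +kernel
theorem check_pairing_false : (pairing false (Sum.inl (1, 0))).Check := by decide +kernel

/-- Three `2`-boxes joined to each other in a triangle, each with two outer boundary points. -/
def triangle : Code ⟨2, false⟩ ⟨3, false⟩ :=
  ⟨3, 8, [0, 1, 2, 3, 4, 5], [[6, 8, 4, 5], [8, 7, 2, 3], [0, 1, 7, 6]], []⟩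

/-- The product of a reflected triangle and a triangle. -/
def triangleMul : Code ⟨2, false⟩ ⟨3, false⟩ :=
  ⟨6, 14, [0, 1, 2, 12, 13, 14], [[5, 4, 11, 9], [3, 12, 10, 11], [9, 10, 13, 14], [6, 8, 4, 5],
    [8, 7, 2, 3], [0, 1, 7, 6]], []⟩

/-- The trace of the product of a reflected triangle and a triangle. -/
def triangleTrace (e : Inner ⟨2, false⟩ 6 11) : Code ⟨2, false⟩ ⟨0, false⟩ :=
  closed ⟨2, false⟩ false 6 11 [[5, 4, 11, 9], [3, 2, 10, 11], [9, 10, 1, 0], [6, 8, 4, 5],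
    [8, 7, 2, 3], [0, 1, 7, 6]] e

/-- The coproduct of two products. -/
def coprodMul : Code ⟨2, false⟩ ⟨2, false⟩ :=
  ⟨4, 9, [0, 8, 9, 5], [[2, 3, 4, 5], [0, 1, 3, 2], [6, 7, 9, 4], [1, 8, 7, 6]], []⟩

/-- The product of a coproduct of two products and a product. -/
def coprodMulMul : Code ⟨2, false⟩ ⟨2, false⟩ :=
  ⟨6, 13, [12, 13, 9, 5], [[2, 3, 4, 5], [0, 1, 3, 2], [6, 7, 9, 4], [1, 8, 7, 6],
    [10, 11, 8, 0], [12, 13, 11, 10]], []⟩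

theorem check_triangle : triangle.Check := by decide +kernel
theorem check_triangle_mirror : triangle.mirror.Check := by decide +kernel
theorem check_triangleMul : triangleMul.Check := by decide +kernel
theorem check_triangleTrace_five : (triangleTrace (Sum.inl (5, 0))).Check := by decide +kernel
theorem check_triangleTrace_three : (triangleTrace (Sum.inl (3, 0))).Check := by decide +kernel
theorem check_coprodMul : coprodMul.Check := by decide +kernel
theorem check_coprodMulMul : coprodMulMul.Check := by decide +kernel

end Code

namespace PlanarStarAlgebra

open Code

variable {V : Color → Type u} [∀ a, AddCommGroup (V a)] [∀ a, Module ℂ (V a)]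
  (S : PlanarStarAlgebra V)

theorem circle_eq_pierce :
    S.eval Tangle.circle (fun i => i.elim) = S.ev pierceCircle fun _ => S.emptyBox true :=
  (S.circle_eq check_circle_two fun i => i.elim0).trans <|
    S.ev_pierce _ _ _ _ _ check_pierceCircle check_circle_two _

/-- Under the trace, the added left string closes to a circle around the rest, so the rest sits in a
shaded region and can be evaluated separately. -/
theorem tr_box (a : V ⟨2, false⟩) :
    S.tr (S.box a) = S.scalar (S.ev pierceCircle fun _ => S.ev sideTrace ![a]) :=
  (S.tr_eq_three ![S.box a]).trans <| congrArg S.scalar <|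
    (S.ev_glue (T := Code.trace 3) (R := ![Code.box]) (U := sideTraceCircle) (σ := sig [[0]])
      check_trace_three (Fin.forall_fin_one.2 check_box) check_sideTraceCircle (by decide +kernel)
      ![a] ![S.box a] (Fin.forall_fin_one.2 (S.box_eq _))).trans
    (S.ev_glue (T := pierceCircle) (R := ![sideTrace]) (U := sideTraceCircle) (σ := sig [[0]])
      check_pierceCircle (Fin.forall_fin_one.2 check_sideTrace) check_sideTraceCircle
      (by decide +kernel) ![a] _
      (Fin.forall_fin_one.2 (congrArg (S.ev sideTrace) (vec_one _).symm))).symm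

/-- The two closed diagrams agree on the sphere and differ in the region that contains the outer
disc: shaded on one side, unshaded on the other. -/
theorem scalar_sideTrace_coprod (hS : S.IsIrreducibleSubfactor) (a b : V ⟨2, false⟩) :
    S.scalar (S.ev sideTrace ![S.coprod a b]) = S.tr (S.mul (S.contra a) b) :=
  (congrArg S.scalar <| S.ev_glue (T := sideTrace) (R := ![Code.coprod])
      (U := pairing true (Sum.inl (0, 1))) (σ := sig [[0, 1]])
      check_sideTrace (Fin.forall_fin_one.2 check_coprod) check_pairing_true (by decide +kernel)
      ![a, b] ![S.coprod a b] (Fin.forall_fin_one.2 (S.coprod_eq _))).trans <|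
    (S.scalar_spherical hS check_pairing_true check_pairing_false ![a, b]).trans <|
    (congrArg S.scalar <| (S.ev_glue (T := Code.trace 2) (R := ![mulContra])
      (U := pairing false (Sum.inl (1, 0))) (σ := sig [[0, 1]])
      check_trace_two (Fin.forall_fin_one.2 check_mulContra) check_pairing_false
      (by decide +kernel) ![a, b] ![S.mul (S.contra a) b] (Fin.forall_fin_one.2
        ((congrArg (S.ev mulContra) (vec_two _).symm).trans <|
          (S.ev_glue (T := stack 2 2) (R := ![Code.contra, stack 2 1]) (U := mulContra)
            (σ := sig [[0], [1]]) check_stack_two_two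
            (Fin.forall_fin_two.2 ⟨check_contra, check_stack_two_one⟩) check_mulContra
            (by decide +kernel) ![a, b] ![S.contra a, b]
            (Fin.forall_fin_two.2 ⟨S.contra_eq _, S.ident_eq_two _⟩)).symm.trans
          (S.mul_eq_two ![S.contra a, b])))).symm).trans
    (S.tr_eq_two ![S.mul (S.contra a) b]).symm

theorem vec_three {α : Type*} (v : Fin 3 → α) : ![v 0, v 1, v 2] = v := by
  funext i; fin_cases i <;> rfl

theorem vec_six {α : Type*} (v : Fin 6 → α) : ![v 0, v 1, v 2, v 3, v 4, v 5] = v := by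
  funext i; fin_cases i <;> rfl

theorem ev_coprodMul (v : Fin 4 → V ⟨2, false⟩) :
    S.ev coprodMul v = S.coprod (S.mul (v 0) (v 1)) (S.mul (v 2) (v 3)) :=
  (S.ev_glue (T := Code.coprod) (R := ![stack 2 2, stack 2 2]) (U := coprodMul)
    (σ := sig [[0, 1], [2, 3]]) check_coprod
    (Fin.forall_fin_two.2 ⟨check_stack_two_two, check_stack_two_two⟩) check_coprodMul
    (by decide +kernel) v ![S.mul (v 0) (v 1), S.mul (v 2) (v 3)]
    (Fin.forall_fin_two.2 ⟨S.mul_eq_two _, S.mul_eq_two _⟩)).symm.trans (S.coprod_eq _)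

theorem ev_coprodMulMul (v : Fin 6 → V ⟨2, false⟩) :
    S.ev coprodMulMul v =
      S.mul (S.coprod (S.mul (v 0) (v 1)) (S.mul (v 2) (v 3))) (S.mul (v 4) (v 5)) :=
  (S.ev_glue (T := stack 2 2) (R := ![coprodMul, stack 2 2]) (U := coprodMulMul)
    (σ := sig [[0, 1, 2, 3], [4, 5]]) check_stack_two_two
    (Fin.forall_fin_two.2 ⟨check_coprodMul, check_stack_two_two⟩) check_coprodMulMul
    (by decide +kernel) v ![_, S.mul (v 4) (v 5)]
    (Fin.forall_fin_two.2 ⟨S.ev_coprodMul _, S.mul_eq_two _⟩)).symm.trans (S.mul_eq_two _)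

/-- The inner product of two triangles is a closed diagram of six boxes. Moving the outer disc to
the region at another box lets one read it as a trace of `2`-boxes. Positivity and Cauchy–Schwarz
for `3`-boxes thereby become inequalities about coproducts. -/
theorem tr_triangle (hS : S.IsIrreducibleSubfactor) (s x v s' x' v' : V ⟨2, false⟩) :
    S.tr (S.mul (S.star (S.ev triangle ![s', x', v'])) (S.ev triangle ![s, x, v])) =
      S.tr (S.mul (S.coprod (S.mul (S.star s') s) (S.mul (S.star x') x)) (S.mul v (S.star v'))) :=
  (S.tr_eq_three ![S.mul (S.star (S.ev triangle ![s', x', v'])) (S.ev triangle ![s, x, v])]).trans <|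
    (congrArg S.scalar <| S.ev_glue (T := Code.trace 3) (R := ![triangleMul])
      (U := triangleTrace (Sum.inl (5, 0))) (σ := sig [[0, 1, 2, 3, 4, 5]]) check_trace_three
      (Fin.forall_fin_one.2 check_triangleMul) check_triangleTrace_five (by decide +kernel)
      ![S.star s', S.star x', S.star v', s, x, v]
      ![S.mul (S.star (S.ev triangle ![s', x', v'])) (S.ev triangle ![s, x, v])]
      (Fin.forall_fin_one.2 <| (congrArg (S.ev triangleMul) (vec_six _).symm).trans <|
        (S.ev_glue (T := stack 3 2) (R := ![triangle.mirror, triangle]) (U := triangleMul)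
          (σ := sig [[0, 1, 2], [3, 4, 5]]) check_stack_three_two
          (Fin.forall_fin_two.2 ⟨check_triangle_mirror, check_triangle⟩) check_triangleMul
          (by decide +kernel) ![S.star s', S.star x', S.star v', s, x, v]
          ![S.star (S.ev triangle ![s', x', v']), S.ev triangle ![s, x, v]]
          (Fin.forall_fin_two.2 ⟨((S.star_ev check_triangle ![s', x', v']).trans
            (congrArg (S.ev triangle.mirror) (funext fun i : Fin 3 => by
              fin_cases i <;> rfl))).symm,
            congrArg (S.ev triangle) (vec_three _).symm⟩)).symm.trans
        (S.mul_eq_three _))).trans <|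
    (S.scalar_spherical hS check_triangleTrace_five check_triangleTrace_three _).trans <|
    (congrArg S.scalar <| (S.ev_glue (T := Code.trace 2) (R := ![coprodMulMul])
      (U := triangleTrace (Sum.inl (3, 0))) (σ := sig [[0, 3, 1, 4, 5, 2]]) check_trace_two
      (Fin.forall_fin_one.2 check_coprodMulMul) check_triangleTrace_three (by decide +kernel)
      ![S.star s', S.star x', S.star v', s, x, v]
      ![S.mul (S.coprod (S.mul (S.star s') s) (S.mul (S.star x') x)) (S.mul v (S.star v'))]
      (Fin.forall_fin_one.2 (S.ev_coprodMulMul _))).symm).trans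
    (S.tr_eq_two _).symm

end PlanarStarAlgebra

/-! ### Two lemmas on finite-dimensional Hilbert spaces -/

section Hilbert

variable {H : Type*} [NormedAddCommGroup H] [InnerProductSpace ℂ H] [FiniteDimensional ℂ H]

/-- In an algebra acting on itself by left multiplication, compatibly with adjoints, positive
operators have a self-adjoint square root. -/
theorem exists_mul_self_of_nonneg (m : H →ₗ[ℂ] H →ₗ[ℂ] H) (u : H) (f : H → H)
    (assoc : ∀ x y z, m (m x y) z = m x (m y z)) (left_unit : ∀ x, m u x = x)
    (right_unit : ∀ x, m x u = x)
    (adj : ∀ a x y, inner ℂ (m a x) y = inner ℂ x (m (f a) y)) {a : H}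
    (h : ∀ v, 0 ≤ inner ℂ (m a v) v) : ∃ s, f s = s ∧ m s s = a := by
  have := FiniteDimensional.complete ℂ H
  let L : H →L[ℂ] H := LinearMap.toContinuousLinearMap (m a)
  have hL : 0 ≤ L := by
    rw [ContinuousLinearMap.nonneg_iff_isPositive, ContinuousLinearMap.isPositive_iff_complex]
    intro x
    obtain ⟨h1, h2⟩ := Complex.nonneg_iff.1 (h x)
    exact ⟨Complex.ext rfl h2, h1⟩
  have hmul : CFC.sqrt L * CFC.sqrt L = L := CFC.sqrt_mul_sqrt_self L hL
  have hsa : IsSelfAdjoint (CFC.sqrt L) := IsSelfAdjoint.of_nonneg (CFC.sqrt_nonneg L)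
  -- The square root commutes with everything that commutes with `L`, in particular with right
  -- multiplications. Hence it is left multiplication by its value at the unit.
  have comm : ∀ v b, CFC.sqrt L (m v b) = m (CFC.sqrt L v) b := by
    intro v b
    let R : H →L[ℂ] H := LinearMap.toContinuousLinearMap (m.flip b)
    have hc : Commute L R := by
      ext v
      exact (assoc a v b).symm
    have hc' : Commute (CFC.sqrt L) R := hc.cfcₙ_nnreal _
    exact congrArg (fun F : H →L[ℂ] H => F v) hc'.eq
  have hs : ∀ v, m (CFC.sqrt L u) v = CFC.sqrt L v := fun v => by rw [← comm, left_unit]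
  refine ⟨CFC.sqrt L u, ?_, ?_⟩
  · rw [← right_unit (f _)]
    refine ext_inner_left ℂ fun x => ?_
    rw [← adj, hs]
    exact (ContinuousLinearMap.isSelfAdjoint_iff_isSymmetric.1 hsa) x u
  · rw [hs]
    exact (congrArg (fun F : H →L[ℂ] H => F u) hmul).trans (right_unit a)

/-- The projection onto the fixed points of a symmetric contraction. -/
theorem exists_fixed_of_contraction {f : H →ₗ[ℂ] H} (hf : f.IsSymmetric) (hf' : ∀ x, ‖f x‖ ≤ ‖x‖)
    (x : H) : ∃ p k, f p = p ∧ x - p = f k - k ∧ ∀ N : Set H, IsClosed N → 0 ∈ N →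
      (∀ y ∈ N, ∀ z ∈ N, y + z ∈ N) → (∀ r : ℝ, 0 ≤ r → ∀ y ∈ N, (r : ℂ) • y ∈ N) →
      (∀ y ∈ N, f y ∈ N) → x ∈ N → p ∈ N := by
  have := FiniteDimensional.complete ℂ H
  -- By the mean ergodic theorem the averages of the iterates converge to the orthogonal projection
  -- of `x` onto the fixed points.
  let F : H →L[ℂ] H := LinearMap.toContinuousLinearMap f
  have hF : ‖F‖ ≤ 1 := F.opNorm_le_bound zero_le_one fun y => by rw [one_mul]; exact hf' y
  have hlim := F.tendsto_birkhoffAverage_orthogonalProjection hF x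
  set p := (F.eqLocus (1 : H →L[ℂ] H)).orthogonalProjectionOnto x with hp
  -- For symmetric `f` the range of f - 1 is the orthogonal complement of the fixed points.
  have hmem : x - p ∈ LinearMap.range (f - 1) := by
    have h1 : (LinearMap.range (f - 1))ᗮ = LinearMap.ker (f - 1) :=
      LinearMap.IsSymmetric.orthogonal_range (hf.sub LinearMap.IsSymmetric.one)
    rw [← Submodule.orthogonal_orthogonal (LinearMap.range (f - 1)), h1]
    have h2 : LinearMap.ker (f - 1) = F.eqLocus (1 : H →L[ℂ] H) := by
      ext y
      exact sub_eq_zero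
    rw [h2]
    exact Submodule.sub_starProjection_mem_orthogonal (K := F.eqLocus (1 : H →L[ℂ] H)) x
  obtain ⟨k, hk⟩ := hmem
  refine ⟨p, k, p.2, hk.symm, fun N hN h0 hadd hsmul hfN hx => ?_⟩
  refine hN.mem_of_tendsto hlim (Filter.Eventually.of_forall fun n => ?_)
  -- Each average is built by operations under which `N` is stable, and `N` is closed, so the limit
  -- lies in `N`.
  have horb : ∀ k, F^[k] x ∈ N := by
    intro k
    induction k with
    | zero => exact hx
    | succ k ih => rw [Function.iterate_succ_apply']; exact hfN _ ih
  have hsum : ∀ n, birkhoffSum F _root_.id n x ∈ N := by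
    intro n
    induction n with
    | zero => rw [birkhoffSum_zero]; exact h0
    | succ n ih => rw [birkhoffSum_succ]; exact hadd _ ih _ (horb n)
  have := hsmul (n : ℝ)⁻¹ (by positivity) _ (hsum n)
  simpa [birkhoffAverage] using this

end Hilbert

/-! ### The algebra of `2`-boxes -/

/-- The structure on the Hilbert space of `2`-boxes which comes from multiplication and coproduct.
Here `⟪x, y⟫ = tr (x^* y)`, so that `tr x = ⟪1, x⟫`. -/
structure BoxAlgebra (H : Type*) [NormedAddCommGroup H] [InnerProductSpace ℂ H] where
  mul : H →ₗ[ℂ] H →ₗ[ℂ] H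
  co : H →ₗ[ℂ] H →ₗ[ℂ] H
  st : H →ₗ⋆[ℂ] H
  ct : H →ₗ[ℂ] H
  one : H
  jones : H
  δ : ℝ
  δ_pos : 0 < δ
  mul_assoc : ∀ x y z, mul (mul x y) z = mul x (mul y z)
  one_mul : ∀ x, mul one x = x
  mul_one : ∀ x, mul x one = x
  st_st : ∀ x, st (st x) = x
  st_mul : ∀ x y, st (mul x y) = mul (st y) (st x)
  inner_mul_left : ∀ a x y, inner ℂ (mul a x) y = inner ℂ x (mul (st a) y)
  inner_mul_right : ∀ a x y, inner ℂ (mul x a) y = inner ℂ x (mul y (st a))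
  co_assoc : ∀ x y z, co (co x y) z = co x (co y z)
  jones_co : ∀ x, co jones x = x
  co_jones : ∀ x, co x jones = x
  ct_ct : ∀ x, ct (ct x) = x
  ct_mul : ∀ x y, ct (mul x y) = mul (ct y) (ct x)
  st_ct : ∀ x, st (ct x) = ct (st x)
  st_co : ∀ x y, st (co x y) = co (st x) (st y)
  ct_co : ∀ x y, ct (co x y) = co (ct y) (ct x)
  inner_co_left : ∀ a x y, inner ℂ (co a x) y = inner ℂ x (co (ct (st a)) y)
  co_one : ∀ a, co a one = (inner ℂ one a / δ : ℂ) • one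
  inner_one_jones : inner ℂ one jones = (δ : ℂ)
  jones_mul_jones : mul jones jones = (δ : ℂ) • jones
  st_jones : st jones = jones
  cauchy : ∀ s x v s' x' v',
    ‖(inner ℂ one (mul (co (mul (st s') s) (mul (st x') x)) (mul v (st v'))) : ℂ)‖ ^ 2 ≤
      (inner ℂ one (mul (co (mul (st s) s) (mul (st x) x)) (mul v (st v))) : ℂ).re *
      (inner ℂ one (mul (co (mul (st s') s') (mul (st x') x')) (mul v' (st v'))) : ℂ).re
  schur : ∀ s x v,
    0 ≤ (inner ℂ one (mul (co (mul (st s) s) (mul (st x) x)) (mul v (st v))) : ℂ)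

namespace BoxAlgebra

variable {H : Type*} [NormedAddCommGroup H] [InnerProductSpace ℂ H] (S : BoxAlgebra H)

/-- The trace. -/
noncomputable def tr (x : H) : ℂ := inner ℂ S.one x

/-- The trace, divided by the trace of the unit of the coproduct. -/
noncomputable def wt (x : H) : ℝ := (S.tr x).re / S.δ

/-- Positive semidefinite operators. -/
def Nonneg (a : H) : Prop := ∀ v, 0 ≤ (inner ℂ (S.mul a v) v : ℂ)

theorem inner_eq_tr (x y : H) : inner ℂ x y = S.tr (S.mul (S.st x) y) := by
  rw [tr, ← S.inner_mul_left, S.mul_one]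

theorem inner_eq_tr' (x y : H) : inner ℂ x y = S.tr (S.mul y (S.st x)) := by
  rw [tr, ← S.inner_mul_right, S.one_mul]

theorem inner_st_st (x y : H) : inner ℂ (S.st x) (S.st y) = inner ℂ y x := by
  rw [S.inner_eq_tr, S.inner_eq_tr', S.st_st]

theorem norm_st (x : H) : ‖S.st x‖ = ‖x‖ := by
  rw [norm_eq_sqrt_re_inner (𝕜 := ℂ), S.inner_st_st, ← norm_eq_sqrt_re_inner]

theorem st_one : S.st S.one = S.one := by
  rw [← S.mul_one (S.st S.one)]
  nth_rw 2 [← S.st_st S.one]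
  rw [← S.st_mul, S.mul_one, S.st_st]

theorem ct_one : S.ct S.one = S.one := by
  rw [← S.mul_one (S.ct S.one)]
  nth_rw 2 [← S.ct_ct S.one]
  rw [← S.ct_mul, S.mul_one, S.ct_ct]

theorem one_ne_zero : S.one ≠ 0 := by
  intro h
  have := S.inner_one_jones
  rw [h, inner_zero_left] at this
  exact S.δ_pos.ne (by exact_mod_cast this)

theorem tr_st (x : H) : S.tr (S.st x) = (starRingEnd ℂ) (S.tr x) := by
  rw [tr, tr, inner_conj_symm, ← S.inner_st_st, S.st_st, S.st_one]

theorem tr_mul_comm (x y : H) : S.tr (S.mul x y) = S.tr (S.mul y x) := by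
  rw [← S.st_st x, ← S.inner_eq_tr, S.inner_eq_tr', S.st_st]

/-- Adjointness of convolution, tested on the unit of the product: both sides are multiples of ⟪1,
1⟫, and the coefficients are the two traces divided by δ. -/
theorem tr_ct (x : H) : S.tr (S.ct x) = S.tr x := by
  have h := S.inner_co_left (S.st x) S.one S.one
  rw [S.co_one, S.co_one, S.st_st, inner_smul_left, inner_smul_right, map_div₀,
    Complex.conj_ofReal] at h
  have h1 : (inner ℂ S.one S.one : ℂ) ≠ 0 := inner_self_ne_zero.2 S.one_ne_zero
  have h2 := mul_right_cancel₀ h1 h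
  rw [div_left_inj' (by exact_mod_cast S.δ_pos.ne')] at h2
  rw [tr, ← h2]
  change _ = S.tr x
  rw [← Complex.conj_conj (S.tr x), ← S.tr_st]
  rfl

theorem inner_ct_ct (x y : H) : inner ℂ (S.ct x) (S.ct y) = inner ℂ x y := by
  rw [S.inner_eq_tr, S.inner_eq_tr', S.st_ct, ← S.ct_mul, S.tr_ct]

/-- The map x ↦ (x*)' is antiunitary and reverses coproducts, so it carries the statement for left
convolution to right convolution. -/
theorem inner_co_right (a x y : H) :
    inner ℂ (S.co x a) y = inner ℂ x (S.co y (S.ct (S.st a))) := by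
  have key : ∀ x y, S.co x y = S.ct (S.st (S.co (S.ct (S.st y)) (S.ct (S.st x)))) := by
    intro x y
    rw [S.st_co, S.ct_co, S.st_ct, S.st_ct, S.st_st, S.st_st, S.ct_ct, S.ct_ct]
  rw [key x a, key y, S.st_ct, S.st_st, S.ct_ct]
  calc _ = (inner ℂ (S.ct (S.st (S.co (S.ct (S.st a)) (S.ct (S.st x)))))
        (S.ct (S.st (S.ct (S.st y)))) : ℂ) := by rw [S.st_ct (S.st y), S.st_st, S.ct_ct]
    _ = inner ℂ (S.ct (S.st (S.ct (S.st x)))) (S.ct (S.st (S.co a (S.ct (S.st y))))) := by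
      rw [S.inner_ct_ct, S.inner_ct_ct, S.inner_st_st, S.inner_st_st, S.inner_co_left]
    _ = _ := by rw [S.st_ct (S.st x), S.st_st, S.ct_ct]

theorem one_co (a : H) : S.co S.one a = (S.tr a / S.δ) • S.one := by
  rw [← S.ct_ct (S.co S.one a), S.ct_co, S.ct_one, S.co_one, map_smul, S.ct_one]
  exact congrArg (fun z : ℂ => (z / S.δ) • S.one) (S.tr_ct a)

theorem tr_co (a b : H) : S.tr (S.co a b) = S.tr a * S.tr b / S.δ := by
  have := S.inner_co_left (S.ct (S.st a)) S.one b
  rw [S.st_ct, S.st_st, S.ct_ct, S.co_one, inner_smul_left, map_div₀, Complex.conj_ofReal] at this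
  rw [tr, ← this]
  change (starRingEnd ℂ) (S.tr _) / _ * S.tr b = _
  rw [S.tr_ct, S.tr_st, Complex.conj_conj]
  ring

variable {S}

theorem Nonneg.add {a b : H} (ha : S.Nonneg a) (hb : S.Nonneg b) : S.Nonneg (a + b) := by
  intro v
  rw [map_add, LinearMap.add_apply, inner_add_left]
  exact add_nonneg (ha v) (hb v)

theorem Nonneg.smul {a : H} (ha : S.Nonneg a) {r : ℝ} (hr : 0 ≤ r) : S.Nonneg ((r : ℂ) • a) := by
  intro v
  rw [map_smul, LinearMap.smul_apply, inner_smul_left, Complex.conj_ofReal]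
  exact mul_nonneg (by exact_mod_cast hr) (ha v)

theorem nonneg_sq (S : BoxAlgebra H) (s : H) : S.Nonneg (S.mul (S.st s) s) := by
  intro v
  rw [S.mul_assoc, S.inner_mul_left, S.st_st]
  exact Complex.nonneg_iff.2 ⟨inner_self_nonneg (𝕜 := ℂ), (inner_self_im (𝕜 := ℂ) _).symm⟩

theorem Nonneg.ct_sq (S : BoxAlgebra H) (s : H) :
    S.ct (S.mul (S.st s) s) = S.mul (S.st (S.ct (S.st s))) (S.ct (S.st s)) := by
  rw [S.ct_mul, S.st_ct, S.st_st]

theorem nonneg_of_isProjection {p : H} (h : S.mul p p = p) (h' : S.st p = p) : S.Nonneg p := by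
  have := S.nonneg_sq p
  rwa [h', h] at this

theorem tr_sq (S : BoxAlgebra H) (s : H) : S.tr (S.mul (S.st s) s) = ((‖s‖ ^ 2 : ℝ) : ℂ) := by
  rw [← S.inner_eq_tr, inner_self_eq_norm_sq_to_K]
  push_cast
  rfl

theorem wt_sq (S : BoxAlgebra H) (s : H) : S.wt (S.mul (S.st s) s) = ‖s‖ ^ 2 / S.δ := by
  rw [wt, S.tr_sq, Complex.ofReal_re]

theorem wt_ct (S : BoxAlgebra H) (a : H) : S.wt (S.ct a) = S.wt a := by rw [wt, S.tr_ct, wt]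

theorem norm_ct (S : BoxAlgebra H) (x : H) : ‖S.ct x‖ = ‖x‖ := by
  rw [norm_eq_sqrt_re_inner (𝕜 := ℂ), S.inner_ct_ct, ← norm_eq_sqrt_re_inner]

theorem tr_smul (S : BoxAlgebra H) (z : ℂ) (x : H) : S.tr (z • x) = z * S.tr x :=
  inner_smul_right _ _ _

theorem tr_smul_one_mul_sq (S : BoxAlgebra H) (r : ℝ) (v : H) :
    S.tr (S.mul ((r : ℂ) • S.one) (S.mul v (S.st v))) = ((r * ‖v‖ ^ 2 : ℝ) : ℂ) := by
  rw [map_smul, LinearMap.smul_apply, S.one_mul, tr_smul, S.tr_mul_comm, tr_sq, Complex.ofReal_mul]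

theorem wt_add (S : BoxAlgebra H) (a b : H) : S.wt (a + b) = S.wt a + S.wt b := by
  rw [wt, tr, inner_add_right, Complex.add_re, add_div]
  rfl

/-! ### Equality in contractions -/

/-- The equality case of Cauchy–Schwarz: expanding ‖y - tq‖² with the two hypotheses gives at most
zero. -/
theorem eq_smul_of_re_inner {y q : H} {t : ℝ} (h : ‖y‖ ≤ t * ‖q‖)
    (h' : t * ‖q‖ ^ 2 ≤ (inner ℂ y q : ℂ).re) (ht : 0 ≤ t) : y = (t : ℂ) • q := by
  have h1 := norm_sub_sq (𝕜 := ℂ) y ((t : ℂ) • q)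
  rw [inner_smul_right, norm_smul, Complex.norm_real, Real.norm_of_nonneg ht] at h1
  have h2 : RCLike.re ((t : ℂ) * inner ℂ y q) = t * (inner ℂ y q : ℂ).re := by simp
  rw [h2] at h1
  have h3 : ‖y‖ ^ 2 ≤ (t * ‖q‖) ^ 2 := by gcongr
  have h4 : ‖y - (t : ℂ) • q‖ ^ 2 ≤ 0 := by nlinarith
  exact sub_eq_zero.1 (norm_eq_zero.1 (pow_eq_zero_iff two_ne_zero |>.1
    (le_antisymm h4 (sq_nonneg _))))

/-- Projections for the coproduct. -/
def IsCoproj (S : BoxAlgebra H) (q : H) : Prop := S.co q q = q ∧ S.ct (S.st q) = q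

theorem IsCoproj.inner_left {q : H} (h : S.IsCoproj q) (x : H) :
    inner ℂ (S.co q x) q = inner ℂ x q := by
  rw [S.inner_co_left, h.2, h.1]

theorem IsCoproj.inner_right {q : H} (h : S.IsCoproj q) (x : H) :
    inner ℂ (S.co x q) q = inner ℂ x q := by
  rw [S.inner_co_right, h.2, h.1]

theorem re_inner_smul_self (t : ℝ) (q : H) : (inner ℂ ((t : ℂ) • q) q : ℂ).re = t * ‖q‖ ^ 2 := by
  rw [inner_smul_left, Complex.conj_ofReal, Complex.re_ofReal_mul]
  congr 1
  exact (norm_sq_eq_re_inner (𝕜 := ℂ) q).symm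

theorem IsCoproj.co_co_eq {a q : H} (hq : S.IsCoproj q) {z : ℂ} (h : S.co q a = z • q) :
    S.co (S.co q a) q = z • q := by
  rw [h, map_smul, LinearMap.smul_apply, hq.1]

/-! ### Positive operators -/

variable [FiniteDimensional ℂ H]

theorem Nonneg.exists_sq {a : H} (h : S.Nonneg a) : ∃ s, S.st s = s ∧ S.mul s s = a :=
  exists_mul_self_of_nonneg S.mul S.one S.st S.mul_assoc S.one_mul S.mul_one S.inner_mul_left h

theorem Nonneg.st {a : H} (h : S.Nonneg a) : S.st a = a := by
  obtain ⟨s, hs, rfl⟩ := h.exists_sq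
  rw [S.st_mul, hs]

theorem Nonneg.ct {a : H} (h : S.Nonneg a) : S.Nonneg (S.ct a) := by
  obtain ⟨s, hs, rfl⟩ := h.exists_sq
  nth_rw 1 [← hs]
  rw [Nonneg.ct_sq]
  exact S.nonneg_sq _

/-- The Schur product theorem. With self-adjoint square roots s and x of a and b, the quadratic form
of a * b at v is the squared norm of a triangle, hence nonnegative by `schur`. -/
theorem Nonneg.co {a b : H} (ha : S.Nonneg a) (hb : S.Nonneg b) : S.Nonneg (S.co a b) := by
  obtain ⟨s, hs, rfl⟩ := ha.exists_sq
  obtain ⟨x, hx, rfl⟩ := hb.exists_sq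
  intro v
  have := S.schur s x v
  rw [hs, hx] at this
  have h2 : S.st (S.co (S.mul s s) (S.mul x x)) = S.co (S.mul s s) (S.mul x x) := by
    rw [S.st_co, S.st_mul, S.st_mul, hs, hx]
  rw [S.inner_mul_left, h2, S.inner_eq_tr', S.mul_assoc]
  exact this

theorem Nonneg.wt_nonneg {a : H} (h : S.Nonneg a) : 0 ≤ S.wt a := by
  obtain ⟨s, hs, rfl⟩ := h.exists_sq
  nth_rw 1 [← hs]
  rw [wt_sq]
  exact div_nonneg (sq_nonneg _) S.δ_pos.le

theorem Nonneg.tr_eq {a : H} (h : S.Nonneg a) : S.tr a = ((S.δ * S.wt a : ℝ) : ℂ) := by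
  obtain ⟨s, hs, rfl⟩ := h.exists_sq
  nth_rw 1 3 [← hs]
  rw [wt_sq, tr_sq, mul_div_cancel₀ _ S.δ_pos.ne']

/-- With square roots s and x, cyclicity gives tr(ab) = ‖sx‖², while ab = s(sx)x. A vanishing trace
of a product of positive elements therefore forces the product itself to vanish. -/
theorem Nonneg.mul_eq_norm {a b : H} (ha : S.Nonneg a) (hb : S.Nonneg b) :
    ∃ c : H, S.tr (S.mul a b) = ((‖c‖ ^ 2 : ℝ) : ℂ) ∧ (c = 0 → S.mul a b = 0) := by
  obtain ⟨s, hs, rfl⟩ := ha.exists_sq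
  obtain ⟨x, hx, rfl⟩ := hb.exists_sq
  refine ⟨S.mul s x, ?_, fun h => ?_⟩
  · rw [← tr_sq, S.st_mul, hs, hx, ← S.mul_assoc, S.tr_mul_comm, ← S.mul_assoc, ← S.mul_assoc]
    congr 1
    rw [S.mul_assoc]
  · rw [S.mul_assoc, ← S.mul_assoc s x x, h, map_zero, LinearMap.zero_apply, map_zero]

theorem Nonneg.tr_mul_nonneg {a b : H} (ha : S.Nonneg a) (hb : S.Nonneg b) :
    0 ≤ (S.tr (S.mul a b)).re := by
  obtain ⟨c, h, -⟩ := ha.mul_eq_norm hb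
  rw [h, Complex.ofReal_re]
  positivity

theorem Nonneg.mul_eq_zero {a b : H} (ha : S.Nonneg a) (hb : S.Nonneg b)
    (h0 : (S.tr (S.mul a b)).re = 0) : S.mul a b = 0 := by
  obtain ⟨c, h, h'⟩ := ha.mul_eq_norm hb
  rw [h, Complex.ofReal_re] at h0
  exact h' (norm_eq_zero.1 (pow_eq_zero_iff two_ne_zero |>.1 h0))

theorem Nonneg.co_one {a : H} (h : S.Nonneg a) : S.co a S.one = (S.wt a : ℂ) • S.one := by
  rw [S.co_one]
  change (S.tr a / S.δ) • S.one = _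
  rw [h.tr_eq, ← Complex.ofReal_div, mul_div_cancel_left₀ _ S.δ_pos.ne']

theorem Nonneg.one_co {a : H} (h : S.Nonneg a) : S.co S.one a = (S.wt a : ℂ) • S.one := by
  rw [S.one_co, h.tr_eq, ← Complex.ofReal_div, mul_div_cancel_left₀ _ S.δ_pos.ne']

theorem Nonneg.tr_co_sq {a : H} (h : S.Nonneg a) (x : H) :
    S.tr (S.co a (S.mul (S.st x) x)) = ((S.wt a * ‖x‖ ^ 2 : ℝ) : ℂ) := by
  rw [S.tr_co, h.tr_eq, S.tr_sq, ← Complex.ofReal_mul, ← Complex.ofReal_div]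
  congr 1
  field_simp [S.δ_pos.ne']

/-- Cauchy–Schwarz for two triangles, with a * x itself placed in one of them, gives ‖a * x‖⁴ ≤
w(a)‖x‖² · w(a)‖a * x‖². The factors are known because a * 1 = w(a)1 and the trace is multiplicative
on coproducts up to δ. -/
theorem Nonneg.norm_co_le {a : H} (h : S.Nonneg a) (x : H) : ‖S.co a x‖ ≤ S.wt a * ‖x‖ := by
  obtain ⟨s, hs, ha⟩ := h.exists_sq
  have h2 : S.mul (S.st s) s = a := by rw [hs, ha]
  have h1 : ‖S.tr (S.mul (S.co (S.mul (S.st s) s) (S.mul (S.st S.one) x))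
      (S.mul S.one (S.st (S.co a x))))‖ ^ 2 ≤
      (S.tr (S.mul (S.co (S.mul (S.st s) s) (S.mul (S.st x) x)) (S.mul S.one (S.st S.one)))).re *
      (S.tr (S.mul (S.co (S.mul (S.st s) s) (S.mul (S.st S.one) S.one))
        (S.mul (S.co a x) (S.st (S.co a x))))).re := S.cauchy s x S.one s S.one (S.co a x)
  rw [h2, S.st_one, S.one_mul, S.one_mul, S.mul_one, S.mul_one, h.co_one, S.tr_mul_comm, tr_sq,
    h.tr_co_sq, tr_smul_one_mul_sq, Complex.ofReal_re, Complex.ofReal_re, Complex.norm_real,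
    Real.norm_of_nonneg (by positivity)] at h1
  have hw := h.wt_nonneg
  rcases (norm_nonneg (S.co a x)).eq_or_lt with h0 | h0
  · rw [← h0]
    positivity
  · refine (sq_le_sq₀ (norm_nonneg _) (by positivity)).1 ?_
    have h4 : 0 < ‖S.co a x‖ ^ 2 := by positivity
    refine le_of_mul_le_mul_right ?_ h4
    calc _ = (‖S.co a x‖ ^ 2) ^ 2 := by ring
      _ ≤ _ := h1
      _ = _ := by ring

theorem Nonneg.norm_co_le' {a : H} (h : S.Nonneg a) (x : H) : ‖S.co x a‖ ≤ S.wt a * ‖x‖ := by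
  have := h.ct.norm_co_le (S.ct (S.st x))
  rwa [wt_ct, norm_ct, S.norm_st, ← S.ct_co, norm_ct, ← S.norm_st, S.st_co, S.st_st, h.st] at this

/-- The compression determines ⟪q * a, q⟫ and ⟪a * q, q⟫, which reach the largest value allowed by
the norm bound; the equality case applies to both. -/
theorem Nonneg.co_eq_of_co_co_eq {a q : H} (h : S.Nonneg a) (hq : S.IsCoproj q)
    (h' : S.co (S.co q a) q = (S.wt a : ℂ) • q) :
    S.co q a = (S.wt a : ℂ) • q ∧ S.co a q = (S.wt a : ℂ) • q := by
  constructor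
  · refine eq_smul_of_re_inner (h.norm_co_le' q) ?_ h.wt_nonneg
    rw [← hq.inner_right, h', re_inner_smul_self]
  · refine eq_smul_of_re_inner (h.norm_co_le q) ?_ h.wt_nonneg
    rw [← hq.inner_left, ← S.co_assoc, h', re_inner_smul_self]

theorem Nonneg.tfae_coproj {a q : H} (h : S.Nonneg a) (hq : S.IsCoproj q) :
    S.co (S.co q a) q = (S.wt a : ℂ) • q ↔
      S.co (S.co q (a + S.ct a)) q = (S.wt (a + S.ct a) : ℂ) • q := by
  rw [wt_add, wt_ct]
  constructor
  · intro h'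
    obtain ⟨h1, h2⟩ := h.co_eq_of_co_co_eq hq h'
    have h3 := congrArg (fun x => S.ct (S.st x)) h2
    rw [S.st_co, S.ct_co, hq.2, h.st, map_smulₛₗ, map_smulₛₗ, hq.2, Complex.conj_ofReal] at h3
    refine hq.co_co_eq ?_
    rw [map_add, h1, h3, Complex.ofReal_add, add_smul]
    rfl
  · intro h'
    -- The two real parts are each at most w(a)‖q‖² and add up to twice this value, so the one for a
    -- attains it.
    have h1 : (S.wt a + S.wt a) * ‖q‖ ^ 2 = (inner ℂ (S.co q a) q : ℂ).re +
        (inner ℂ (S.co q (S.ct a)) q : ℂ).re := by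
      rw [← Complex.add_re, ← inner_add_left, ← map_add, ← hq.inner_right, h', re_inner_smul_self]
    have h2 : (inner ℂ (S.co q (S.ct a)) q : ℂ).re ≤ S.wt a * ‖q‖ ^ 2 := by
      have h3 := h.ct.norm_co_le' q
      rw [wt_ct] at h3
      calc _ ≤ ‖(inner ℂ (S.co q (S.ct a)) q : ℂ)‖ := Complex.re_le_norm _
        _ ≤ ‖S.co q (S.ct a)‖ * ‖q‖ := norm_inner_le_norm _ _
        _ ≤ S.wt a * ‖q‖ * ‖q‖ := by gcongr
        _ = _ := by ring
    exact hq.co_co_eq (eq_smul_of_re_inner (h.norm_co_le' q) (by linarith) h.wt_nonneg)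

end BoxAlgebra

/-! ### Biprojections and the largest eigenvalue of convolution -/

namespace BoxAlgebra

variable {H : Type*} [NormedAddCommGroup H] [InnerProductSpace ℂ H] {S : BoxAlgebra H}

theorem co_smul_left (S : BoxAlgebra H) (z : ℂ) (a x : H) : S.co (z • a) x = z • S.co a x := by
  rw [map_smul, LinearMap.smul_apply]

theorem mul_smul_left (S : BoxAlgebra H) (z : ℂ) (a x : H) : S.mul (z • a) x = z • S.mul a x := by
  rw [map_smul, LinearMap.smul_apply]

theorem co_sub_left (S : BoxAlgebra H) (a b x : H) : S.co (a - b) x = S.co a x - S.co b x := by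
  rw [map_sub, LinearMap.sub_apply]

theorem tr_add (S : BoxAlgebra H) (a b : H) : S.tr (a + b) = S.tr a + S.tr b :=
  inner_add_right _ _ _

theorem tr_sub (S : BoxAlgebra H) (a b : H) : S.tr (a - b) = S.tr a - S.tr b :=
  inner_sub_right _ _ _

/-- The contragredient reverses coproducts, so it fixes their unit. -/
theorem ct_jones (S : BoxAlgebra H) : S.ct S.jones = S.jones := by
  rw [← S.co_jones (S.ct S.jones), ← S.ct_ct (S.co _ _), S.ct_co, S.ct_ct, S.co_jones, S.ct_ct]

theorem wt_jones (S : BoxAlgebra H) : S.wt S.jones = 1 := by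
  rw [wt, tr, S.inner_one_jones, Complex.ofReal_re, div_self S.δ_pos.ne']

theorem jones_nonneg (S : BoxAlgebra H) : S.Nonneg S.jones := by
  have h := (S.nonneg_sq S.jones).smul (inv_nonneg.2 S.δ_pos.le)
  rwa [S.st_jones, S.jones_mul_jones, smul_smul, ← Complex.ofReal_mul,
    inv_mul_cancel₀ S.δ_pos.ne', Complex.ofReal_one, one_smul] at h

/-- Biprojections. -/
def IsBiproj (S : BoxAlgebra H) (p : H) : Prop :=
  p ≠ 0 ∧ (S.mul p p = p ∧ S.st p = p) ∧ ∃ (z : ℂ) (r : H), S.IsCoproj r ∧ p = z • r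

theorem IsBiproj.nonneg {p : H} (h : S.IsBiproj p) : S.Nonneg p :=
  nonneg_of_isProjection h.2.1.1 h.2.1.2

theorem IsBiproj.wt_pos {p : H} (h : S.IsBiproj p) : 0 < S.wt p := by
  have := wt_sq S p
  rw [h.2.1.2, h.2.1.1] at this
  rw [this]
  have := norm_pos_iff.2 h.1
  have := S.δ_pos
  positivity

theorem IsBiproj.norm_sq {p : H} (h : S.IsBiproj p) : ‖p‖ ^ 2 = S.δ * S.wt p := by
  have := wt_sq S p
  rw [h.2.1.2, h.2.1.1] at this
  rw [this, mul_div_cancel₀ _ S.δ_pos.ne']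

theorem IsBiproj.mul_eq {p a : H} (h : S.IsBiproj p) (ha : S.mul (S.mul p a) p = a) :
    S.mul p a = a ∧ S.mul a p = a := by
  constructor
  · rw [← ha, ← S.mul_assoc, ← S.mul_assoc, h.2.1.1]
  · rw [← ha, S.mul_assoc, h.2.1.1]

variable [FiniteDimensional ℂ H]

/-- The coproduct square is some multiple of p, and comparing traces identifies the multiple. -/
theorem IsBiproj.co_self {p : H} (h : S.IsBiproj p) : S.co p p = (S.wt p : ℂ) • p := by
  obtain ⟨z, r, hr, hp⟩ := h.2.2
  have h1 : S.co p p = z • p := by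
    rw [hp, S.co_smul_left, map_smul, hr.1]
  have h2 := congrArg S.tr h1
  rw [S.tr_co, tr_smul] at h2
  have h3 : S.tr p ≠ 0 := by
    rw [h.nonneg.tr_eq]
    exact_mod_cast (mul_pos S.δ_pos h.wt_pos).ne'
  rw [h1]
  congr 1
  rw [mul_div_right_comm] at h2
  rw [← mul_right_cancel₀ h3 h2, h.nonneg.tr_eq, ← Complex.ofReal_div,
    mul_div_cancel_left₀ _ S.δ_pos.ne']

theorem IsBiproj.isCoproj {p : H} (h : S.IsBiproj p) : S.IsCoproj (((S.wt p)⁻¹ : ℂ) • p) := by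
  obtain ⟨z, r, hr, hp⟩ := h.2.2
  have hz : z ≠ 0 := by
    rintro rfl
    exact h.1 (by rw [hp, zero_smul])
  have h1 : S.co p p = z • p := by
    rw [hp, S.co_smul_left, map_smul, hr.1]
  rw [h.co_self] at h1
  have h2 : (S.wt p : ℂ) = z := smul_left_injective ℂ h.1 h1
  rw [h2]
  nth_rw 1 [hp]
  rw [smul_smul, inv_mul_cancel₀ hz, one_smul]
  exact hr

theorem IsBiproj.ct_eq {p : H} (h : S.IsBiproj p) : S.ct p = p := by
  have h1 := h.isCoproj.2
  rw [map_smulₛₗ, map_smulₛₗ, h.2.1.2] at h1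
  have h2 : ((S.wt p)⁻¹ : ℂ) ≠ 0 := inv_ne_zero (by exact_mod_cast h.wt_pos.ne')
  refine smul_right_injective H h2 (Eq.trans ?_ h1)
  simp

/-- One has ‖p * a‖² = w(p) tr(p(a * a')) ≤ w(p) tr(a * a') = w(p) δ w(a)², because p ≤ 1 and a * a'
is positive. Since ⟪p * a, p⟫ = w(p) tr(a) and ‖p‖² = δ w(p), this is the equality case of
Cauchy–Schwarz. -/
theorem IsBiproj.co_eq {p a : H} (h : S.IsBiproj p) (ha : S.Nonneg a)
    (hpa : S.mul (S.mul p a) p = a) : S.co p a = (S.wt a : ℂ) • p := by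
  have hpst : S.ct (S.st p) = p := by rw [h.2.1.2, h.ct_eq]
  have hq : S.Nonneg (S.one - p) := by
    refine nonneg_of_isProjection ?_ ?_
    · rw [map_sub, map_sub, LinearMap.sub_apply, LinearMap.sub_apply, S.one_mul, S.mul_one,
        S.one_mul, h.2.1.1, sub_self, sub_zero]
    · rw [map_sub, S.st_one, h.2.1.2]
  have h0 := hq.tr_mul_nonneg (ha.co ha.ct)
  have h1 : ‖S.co p a‖ ^ 2 ≤ S.wt p * (S.δ * S.wt a ^ 2) := by
    have e1 : inner ℂ (S.co p a) (S.co p a) =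
        (S.wt p : ℂ) * S.tr (S.mul p (S.co a (S.ct a))) := by
      have e2 := S.inner_co_left p (S.co p a) a
      rw [hpst] at e2
      rw [← e2, ← S.co_assoc, h.co_self, S.co_smul_left, inner_smul_left, Complex.conj_ofReal,
        S.inner_co_right, S.inner_eq_tr, h.2.1.2, ha.st]
    rw [map_sub, LinearMap.sub_apply, S.one_mul, tr_sub, S.tr_co, S.tr_ct, ha.tr_eq,
      ← Complex.ofReal_mul, ← Complex.ofReal_div, Complex.sub_re, Complex.ofReal_re] at h0
    have e3 : S.δ * S.wt a * (S.δ * S.wt a) / S.δ = S.δ * S.wt a ^ 2 := by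
      field_simp [S.δ_pos.ne']
    rw [e3] at h0
    have e4 : ‖S.co p a‖ ^ 2 = S.wt p * (S.tr (S.mul p (S.co a (S.ct a)))).re := by
      rw [norm_sq_eq_re_inner (𝕜 := ℂ), e1]
      exact Complex.re_ofReal_mul _ _
    rw [e4]
    have := h.wt_pos
    gcongr
    linarith
  have h2 : (inner ℂ (S.co p a) p : ℂ) = ((S.wt p * (S.δ * S.wt a) : ℝ) : ℂ) := by
    rw [S.inner_co_left, hpst, h.co_self, inner_smul_right, S.inner_eq_tr, ha.st,
      (h.mul_eq hpa).2, ha.tr_eq, ← Complex.ofReal_mul]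
  refine eq_smul_of_re_inner ?_ ?_ ha.wt_nonneg
  · refine (sq_le_sq₀ (norm_nonneg _) (mul_nonneg ha.wt_nonneg (norm_nonneg _))).1 ?_
    rw [mul_pow, h.norm_sq]
    linarith
  · rw [h2, h.norm_sq, Complex.ofReal_re]
    linarith

theorem isClosed_nonneg (S : BoxAlgebra H) : IsClosed {a | S.Nonneg a} := by
  have h : {a | S.Nonneg a} = ⋂ v, {a | 0 ≤ (inner ℂ (S.mul a v) v : ℂ)} := by
    ext a
    simp [Nonneg]
  rw [h]
  refine isClosed_iInter fun v => ?_
  have hc : Continuous fun a => (inner ℂ (S.mul a v) v : ℂ) :=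
    Continuous.inner (S.mul.flip v).continuous_of_finiteDimensional continuous_const
  exact isClosed_le continuous_const hc

/-- The coproduct projection onto the eigenspace of the largest possible eigenvalue. -/
theorem exists_coproj {b : H} (hb : S.Nonneg b) (hb' : S.ct b = b) :
    ∃ e k, S.Nonneg e ∧ S.IsCoproj e ∧ S.co b e = (S.wt b : ℂ) • e ∧
      S.jones - e = S.co k ((S.wt b : ℂ) • S.jones - b) ∧
      ∀ x, S.co b x = (S.wt b : ℂ) • x → S.co e x = x := by
  have hw := hb.wt_nonneg
  -- Adding the identity before normalising avoids dividing by w(b), which may be zero. The fixed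
  -- points of f are exactly the eigenvectors of convolution by b for w(b).
  set c : ℝ := (1 + S.wt b)⁻¹ with hc
  have hc0 : 0 < c := by positivity
  have hc1 : (c : ℂ) * (1 + S.wt b) = 1 := by
    rw [hc]
    have : (1 + S.wt b : ℝ) ≠ 0 := by positivity
    exact_mod_cast inv_mul_cancel₀ this
  have hbst : S.ct (S.st b) = b := by rw [hb.st, hb']
  let f : H →ₗ[ℂ] H := (c : ℂ) • (LinearMap.id + S.co b)
  have hf : ∀ x, f x = (c : ℂ) • (x + S.co b x) := fun x => rfl
  have hsym : f.IsSymmetric := by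
    intro x y
    rw [hf, hf, inner_smul_left, inner_smul_right, inner_add_left, inner_add_right,
      S.inner_co_left, hbst, Complex.conj_ofReal]
  have hcontr : ∀ x, ‖f x‖ ≤ ‖x‖ := by
    intro x
    rw [hf, norm_smul, Complex.norm_real, Real.norm_of_nonneg hc0.le]
    calc _ ≤ c * (‖x‖ + S.wt b * ‖x‖) := by
          gcongr
          exact (norm_add_le _ _).trans (by gcongr; exact hb.norm_co_le x)
      _ = c * (1 + S.wt b) * ‖x‖ := by ring
      _ = ‖x‖ := by
        rw [hc, inv_mul_cancel₀ (by positivity), _root_.one_mul]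
  obtain ⟨e, k, he, hk, hN⟩ := exists_fixed_of_contraction hsym hcontr S.jones
  -- Positive operators form a closed convex cone which contains `jones` and is preserved by f, by
  -- the Schur product theorem.
  have heN : S.Nonneg e := hN {a | S.Nonneg a} S.isClosed_nonneg
    (by intro v; simp) (fun _ hy _ hz => hy.add hz) (fun _ hr _ hy => hy.smul hr)
    (fun y hy => (hy.add (hb.co hy)).smul hc0.le) S.jones_nonneg
  have hbe : S.co b e = (S.wt b : ℂ) • e := by
    have h1 : ((1 : ℂ) + S.wt b) • f e = ((1 : ℂ) + S.wt b) • e := by rw [he]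
    rw [hf, smul_smul, mul_comm, hc1, one_smul, add_smul, one_smul] at h1
    exact add_left_cancel h1
  set d : H := (S.wt b : ℂ) • S.jones - b with hd
  have hdst : S.ct (S.st d) = d := by
    rw [hd, map_sub, map_sub, hbst, map_smulₛₗ, map_smulₛₗ, S.st_jones, S.ct_jones]
    simp
  have hde : S.co d e = 0 := by
    rw [hd, map_sub, LinearMap.sub_apply, map_smul, LinearMap.smul_apply, S.jones_co, hbe, sub_self]
  have hek : S.jones - e = S.co d ((-(c : ℂ)) • k) := by
    rw [hk, hf, hd, S.co_sub_left, S.co_smul_left, S.jones_co, map_smul]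
    nth_rw 3 [← one_smul ℂ k]
    rw [← hc1]
    module
  set k' := (-(c : ℂ)) • k with hk'
  have hsharp : ∀ x y, S.ct (S.st (S.co x y)) = S.co (S.ct (S.st y)) (S.ct (S.st x)) := by
    intro x y
    rw [S.st_co, S.ct_co]
  have hed : S.co (S.ct (S.st e)) d = 0 := by
    have := hsharp d e
    rwa [hde, map_zero, map_zero, hdst, eq_comm] at this
  -- Write e♯ for the adjoint (e*)'. Since d * e = 0, also e♯ * d = 0, so e♯ annihilates `jones` - e
  -- = d * k'. Thus e♯ = e♯ * e, which is self-adjoint, so e is a self-adjoint idempotent.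
  have h1 : S.ct (S.st e) = S.co (S.ct (S.st e)) e := by
    have h2 : S.co (S.ct (S.st e)) (S.jones - e) = 0 := by
      rw [hek, ← S.co_assoc, hed, map_zero, LinearMap.zero_apply]
    rwa [map_sub, S.co_jones, sub_eq_zero] at h2
  have h2 : S.ct (S.st e) = e := by
    have h3 := hsharp (S.ct (S.st e)) e
    rw [← h1, ← S.st_ct (S.ct (S.st e)), S.ct_ct, S.st_st, ← h1] at h3
    exact h3.symm
  -- Taking adjoints in `jones` - e = d * k' next puts d on the right, where it can act on an
  -- eigenvector and annihilate it.
  have hcop : S.IsCoproj e := ⟨by rw [h2] at h1; exact h1.symm, h2⟩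
  have h4 : S.jones - e = S.co (S.ct (S.st k')) d := by
    have h5 := congrArg (fun x => S.ct (S.st x)) hek
    rw [hsharp, hdst, map_sub, map_sub, h2, S.st_jones, S.ct_jones] at h5
    exact h5
  refine ⟨e, S.ct (S.st k'), heN, hcop, hbe, h4, fun x hx => ?_⟩
  have h5 : S.co (S.jones - e) x = 0 := by
    rw [h4, S.co_assoc, hd, S.co_sub_left, S.co_smul_left, S.jones_co, hx, sub_self, map_zero]
  rw [map_sub, LinearMap.sub_apply, S.jones_co, sub_eq_zero] at h5
  exact h5.symm

end BoxAlgebra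

/-! ### The extremal coproduct projection and the generated biprojection -/

namespace BoxAlgebra

variable {H : Type*} [NormedAddCommGroup H] [InnerProductSpace ℂ H] {S : BoxAlgebra H}
  [FiniteDimensional ℂ H]

/-- A coproduct projection of norm `‖e‖` satisfies `e ≤ ‖e‖ ^ 2 / δ`. -/
theorem IsCoproj.nonneg_sub {e : H} (he : S.IsCoproj e) (he' : S.Nonneg e) :
    S.Nonneg (((‖e‖ ^ 2 / S.δ : ℝ) : ℂ) • S.one - e) := by
  intro v
  set μ : ℝ := ‖e‖ ^ 2 / S.δ with hμ
  have hμ0 : 0 ≤ μ := div_nonneg (sq_nonneg _) S.δ_pos.le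
  -- Cauchy–Schwarz with e and 1 in crossed positions: the mixed term contains e * e = e, and the
  -- diagonal terms contain e² * 1 and 1 * e², both equal to μ1.
  have h1 : ‖S.tr (S.mul (S.co (S.mul (S.st S.one) e) (S.mul (S.st e) S.one))
      (S.mul v (S.st v)))‖ ^ 2 ≤
      (S.tr (S.mul (S.co (S.mul (S.st e) e) (S.mul (S.st S.one) S.one)) (S.mul v (S.st v)))).re *
      (S.tr (S.mul (S.co (S.mul (S.st S.one) S.one) (S.mul (S.st e) e))
        (S.mul v (S.st v)))).re := S.cauchy e S.one v S.one e v
  rw [S.st_one, S.one_mul, S.mul_one, S.mul_one,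
    (S.nonneg_sq e).co_one, (S.nonneg_sq e).one_co, S.wt_sq, ← hμ, tr_smul_one_mul_sq,
    Complex.ofReal_re, he'.st, he.1] at h1
  have h2 : (inner ℂ (S.mul e v) v : ℂ) = S.tr (S.mul e (S.mul v (S.st v))) := by
    rw [S.inner_mul_left, he'.st, S.inner_eq_tr', S.mul_assoc]
  have h3 := he' v
  rw [h2, Complex.nonneg_iff] at h3
  have h4 : ‖S.tr (S.mul e (S.mul v (S.st v)))‖ ≤ μ * ‖v‖ ^ 2 := by
    refine (sq_le_sq₀ (norm_nonneg _) (by positivity)).1 (h1.trans_eq (by ring))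
  have h5 : (S.tr (S.mul e (S.mul v (S.st v)))).re ≤ μ * ‖v‖ ^ 2 :=
    (Complex.re_le_norm _).trans h4
  rw [map_sub, LinearMap.sub_apply, map_smul, LinearMap.smul_apply, S.one_mul, inner_sub_left,
    inner_smul_left, Complex.conj_ofReal, h2, Complex.nonneg_iff, Complex.sub_re, Complex.sub_im,
    ← h3.2, Complex.re_ofReal_mul, Complex.im_ofReal_mul]
  have h6 : (inner ℂ v v : ℂ).re = ‖v‖ ^ 2 := (norm_sq_eq_re_inner (𝕜 := ℂ) v).symm
  have h7 : (inner ℂ v v : ℂ).im = 0 := inner_self_im (𝕜 := ℂ) v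
  rw [h6, h7]
  exact ⟨by linarith, by ring⟩

/-- The bound e ≤ μ is sharp in trace against e and against b. Hence e(μ - e) = 0 and, for positive
a with a + a' = b, also a(μ - e) = 0. So e/μ is a projection that supports a. -/
theorem IsCoproj.exists_isBiproj {e b : H} (he : S.IsCoproj e) (he' : S.Nonneg e)
    (hw : S.wt e = 1) (hb : S.Nonneg b) (hb' : S.ct b = b)
    (hbe : S.co b e = (S.wt b : ℂ) • e) :
    ∃ (μ : ℝ) (r : H), 0 < μ ∧ S.IsBiproj r ∧ e = (μ : ℂ) • r ∧
      ∀ a, S.Nonneg a → a + S.ct a = b → S.mul (S.mul r a) r = a := by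
  have hn := he.nonneg_sub he'
  set μ : ℝ := ‖e‖ ^ 2 / S.δ with hμ
  have hμδ : μ * S.δ = ‖e‖ ^ 2 := div_mul_cancel₀ _ S.δ_pos.ne'
  have he0 : e ≠ 0 := by
    rintro rfl
    rw [wt, tr, inner_zero_right] at hw
    simp at hw
  have hμ0 : 0 < μ := div_pos (by positivity) S.δ_pos
  have hμc : (μ : ℂ) ≠ 0 := by exact_mod_cast hμ0.ne'
  have expand : ∀ x, S.mul x ((μ : ℂ) • S.one - e) = (μ : ℂ) • x - S.mul x e := by
    intro x
    rw [map_sub, map_smul, S.mul_one]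
  -- Here tr(e(μ - e)) = μ δ w(e) - ‖e‖² vanishes since w(e) = 1.
  have hee : S.mul e e = (μ : ℂ) • e := by
    have h1 := he'.mul_eq_zero hn (by
      have h2 := tr_sq S e
      rw [he'.st] at h2
      rw [expand, tr_sub, tr_smul, h2, he'.tr_eq, hw, ← Complex.ofReal_mul, Complex.sub_re,
        Complex.ofReal_re, Complex.ofReal_re, _root_.mul_one, hμδ, sub_self])
    rw [expand, sub_eq_zero] at h1
    exact h1.symm
  have hje : (inner ℂ S.jones e : ℂ) = ((‖e‖ ^ 2 : ℝ) : ℂ) := by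
    rw [← he.inner_left, S.co_jones, inner_self_eq_norm_sq_to_K]
    push_cast
    rfl
  -- Writing b = b * `jones` and moving b to the other side of the inner product turns the trace
  -- into an eigenvalue times ⟪`jones`, e⟫.
  have hbtr : S.tr (S.mul b e) = ((S.wt b * ‖e‖ ^ 2 : ℝ) : ℂ) := by
    have h1 := S.inner_co_left b S.jones e
    rw [hb.st, hb', S.co_jones, hbe, inner_smul_right, hje, S.inner_eq_tr, hb.st,
      ← Complex.ofReal_mul] at h1
    exact h1
  refine ⟨μ, (μ : ℂ)⁻¹ • e, hμ0, ⟨smul_ne_zero (inv_ne_zero hμc) he0, ⟨?_, ?_⟩,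
    (μ : ℂ)⁻¹, e, he, rfl⟩, by rw [smul_smul, mul_inv_cancel₀ hμc, one_smul], ?_⟩
  · rw [S.mul_smul_left, map_smul, hee, smul_smul _ _ e, inv_mul_cancel₀ hμc, one_smul]
  · rw [map_smulₛₗ, he'.st, map_inv₀, Complex.conj_ofReal]
  · rintro a ha rfl
    -- The contributions of a and a' to this trace are both nonnegative, so each of them vanishes.
    have h0 : (S.tr (S.mul (a + S.ct a) ((μ : ℂ) • S.one - e))).re = 0 := by
      rw [expand, tr_sub, hbtr, tr_smul, hb.tr_eq, ← Complex.ofReal_mul, Complex.sub_re,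
        Complex.ofReal_re, Complex.ofReal_re, ← hμδ]
      ring
    rw [map_add, LinearMap.add_apply, tr_add, Complex.add_re] at h0
    have h1 := ha.tr_mul_nonneg hn
    have h2 := ha.ct.tr_mul_nonneg hn
    have h3 := ha.mul_eq_zero hn (by linarith)
    rw [expand, sub_eq_zero] at h3
    have h4 : S.mul e a = (μ : ℂ) • a := by
      have h5 := congrArg S.st h3
      rw [S.st_mul, he'.st, ha.st, map_smulₛₗ, ha.st, Complex.conj_ofReal] at h5
      exact h5.symm
    rw [S.mul_smul_left, h4, smul_smul, inv_mul_cancel₀ hμc, one_smul, map_smul,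
      ← h3, smul_smul, inv_mul_cancel₀ hμc, one_smul]

/-- The biprojection generated by a positive operator is a multiple of the coproduct projection
onto the eigenspace of the largest eigenvalue. -/
theorem IsBiproj.isCoproj_of_minimal {a p : H} (ha : S.Nonneg a) (hp : S.IsBiproj p)
    (hpa : S.mul (S.mul p a) p = a)
    (hmin : ∀ r, S.IsBiproj r → S.mul (S.mul r a) r = a → S.mul p r = p) :
    (∀ x, S.co (a + S.ct a) x = (S.wt (a + S.ct a) : ℂ) • x → S.co p x = (S.wt p : ℂ) • x) ∧
    S.co (a + S.ct a) p = (S.wt (a + S.ct a) : ℂ) • p ∧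
    ∃ k, S.jones - (S.wt p : ℂ)⁻¹ • p =
      S.co k ((S.wt (a + S.ct a) : ℂ) • S.jones - (a + S.ct a)) := by
  have hb := ha.add ha.ct
  have hb' : S.ct (a + S.ct a) = a + S.ct a := by rw [map_add, S.ct_ct, add_comm]
  have hpst : S.ct (S.st p) = p := by rw [hp.2.1.2, hp.ct_eq]
  have hwp : (S.wt p : ℂ) ≠ 0 := by exact_mod_cast hp.wt_pos.ne'
  obtain ⟨e, k, he', he, hbe, hk, hfix⟩ := exists_coproj hb hb'
  -- The trace is multiplicative on coproducts up to δ, and w(b) `jones` - b has trace zero; so e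
  -- and `jones` have the same trace.
  have hw : S.wt e = 1 := by
    have h1 := congrArg S.tr hk
    rw [tr_sub, S.tr_co, tr_sub, tr_smul, hb.tr_eq, S.jones_nonneg.tr_eq, S.wt_jones, he'.tr_eq,
      ← Complex.ofReal_mul, _root_.mul_one, mul_comm (S.wt _) S.δ, sub_self, mul_zero, zero_div,
      sub_eq_zero, Complex.ofReal_inj] at h1
    exact (mul_eq_left₀ S.δ_pos.ne').1 h1.symm
  obtain ⟨μ, r, hμ, hr, hμr, hra⟩ := he.exists_isBiproj he' hw hb hb' hbe
  have hbp : S.co (a + S.ct a) p = (S.wt (a + S.ct a) : ℂ) • p := by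
    have h1 := congrArg (fun x => S.ct (S.st x)) (hp.co_eq ha hpa)
    have h2 : S.mul (S.mul p (S.ct a)) p = S.ct a := by
      have h3 := congrArg S.ct hpa
      rwa [S.ct_mul, S.ct_mul, hp.ct_eq, ← S.mul_assoc] at h3
    have h3 := congrArg (fun x => S.ct (S.st x)) (hp.co_eq ha.ct h2)
    rw [S.st_co, S.ct_co, hpst, ha.st, map_smulₛₗ, map_smulₛₗ, hpst, Complex.conj_ofReal] at h1
    rw [S.st_co, S.ct_co, hpst, ha.ct.st, S.ct_ct, map_smulₛₗ, map_smulₛₗ, hpst,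
      Complex.conj_ofReal, wt_ct] at h3
    rw [map_add, LinearMap.add_apply, wt_add, wt_ct, Complex.ofReal_add, add_smul]
    exact congrArg₂ (· + ·) h3 h1
  have hpr := hmin r hr (hra a ha rfl)
  have hrp : S.mul r p = p := by
    have h1 := congrArg S.st hpr
    rwa [S.st_mul, hr.2.1.2, hp.2.1.2] at h1
  have h1 := hr.co_eq hp.nonneg (by rw [hrp, hpr])
  have h2 := hfix p hbp
  -- Evaluate e * p in two ways: it is p because p lies in the eigenspace, and it is μ(r * p) = μ
  -- w(p) r = w(p)e because r supports p.
  have hpe : p = (S.wt p : ℂ) • e := by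
    rw [hμr, S.co_smul_left, h1] at h2
    rw [hμr]
    exact h2.symm.trans (smul_comm _ _ _)
  refine ⟨fun x hx => ?_, hbp, k, ?_⟩
  · nth_rw 1 [hpe]
    rw [S.co_smul_left, hfix x hx]
  · rw [← hk]
    nth_rw 2 [hpe]
    rw [smul_smul, inv_mul_cancel₀ hwp, one_smul]

/-- The norm bound for the coproduct operator, in algebraic form. -/
theorem Nonneg.exists_co_sq {b : H} (hb : S.Nonneg b) (hb' : S.ct b = b) :
    ∃ d, S.ct (S.st d) = d ∧ S.co d d = ((S.wt b ^ 2 : ℝ) : ℂ) • S.jones - S.co b b := by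
  have hbst : S.ct (S.st b) = b := by rw [hb.st, hb']
  -- The square root lemma is applied to the coproduct algebra. Positivity is the norm bound ‖b *
  -- v‖² ≤ w(b)²‖v‖².
  refine exists_mul_self_of_nonneg S.co S.jones (fun x => S.ct (S.st x)) S.co_assoc S.jones_co
    S.co_jones S.inner_co_left fun v => ?_
  have h1 := S.inner_co_left b (S.co b v) v
  have h2 := hb.norm_co_le v
  have h3 : ‖S.co b v‖ ^ 2 ≤ (S.wt b * ‖v‖) ^ 2 := by gcongr
  rw [hbst, ← S.co_assoc] at h1
  rw [S.co_sub_left, S.co_smul_left, S.jones_co, inner_sub_left, inner_smul_left,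
    Complex.conj_ofReal, h1, inner_self_eq_norm_sq_to_K, inner_self_eq_norm_sq_to_K]
  have h4 : (0 : ℝ) ≤ S.wt b ^ 2 * ‖v‖ ^ 2 - ‖S.co b v‖ ^ 2 := by nlinarith
  have h5 := Complex.zero_le_real.2 h4
  push_cast at h5 ⊢
  exact h5

/-- The equivalent conditions on a coproduct projection. -/
theorem IsBiproj.tfae {a p : H} (ha : S.Nonneg a) (hp : S.IsBiproj p)
    (hpa : S.mul (S.mul p a) p = a)
    (hmin : ∀ r, S.IsBiproj r → S.mul (S.mul r a) r = a → S.mul p r = p) {q : H}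
    (hq : S.IsCoproj q) :
    List.TFAE
      [ S.co (S.co q p) q = (S.wt p : ℂ) • q,
        S.co (S.co q a) q = (S.wt a : ℂ) • q,
        S.co q a = (S.wt a : ℂ) • q ∧ S.co a q = (S.wt a : ℂ) • q,
        S.co (S.co q (a + S.ct a)) q = (S.wt (a + S.ct a) : ℂ) • q ] := by
  tfae_have 2 → 3 := ha.co_eq_of_co_co_eq hq
  tfae_have 3 → 2 := fun h => hq.co_co_eq h.1
  tfae_have 2 ↔ 4 := ha.tfae_coproj hq
  tfae_have 4 → 1 := by
    intro h
    have hpst : S.ct (S.st p) = p := by rw [hp.2.1.2, hp.ct_eq]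
    have h1 := ((ha.add ha.ct).co_eq_of_co_co_eq hq h).2
    have h2 := congrArg (fun x => S.ct (S.st x)) ((hp.isCoproj_of_minimal ha hpa hmin).1 q h1)
    rw [S.st_co, S.ct_co, hpst, hq.2, map_smulₛₗ, map_smulₛₗ, hq.2, Complex.conj_ofReal] at h2
    exact hq.co_co_eq h2
  tfae_have 1 → 2 := by
    intro h
    have h1 := (hp.nonneg.co_eq_of_co_co_eq hq h).1
    have h2 : (S.wt p : ℂ) • S.co q a = (S.wt p : ℂ) • (S.wt a : ℂ) • q := by
      -- Computes q * p * a in two ways, using q * p = w(p)q and p * a = w(a)p; then w(p) ≠ 0 is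
      -- cancelled.
      rw [← S.co_smul_left, ← h1, S.co_assoc, hp.co_eq ha hpa, map_smul, h1]
      exact smul_comm _ _ _
    exact hq.co_co_eq (smul_right_injective H (by exact_mod_cast hp.wt_pos.ne') h2)
  tfae_finish

end BoxAlgebra

/-! ### From planar algebras to `BoxAlgebra` -/

namespace PlanarStarAlgebra

open Code

/-- A multilinear map in two arguments. -/
def toBilin {E F : Type*} [AddCommGroup E] [Module ℂ E] [AddCommGroup F] [Module ℂ F]
    (f : MultilinearMap ℂ (fun _ : Fin 2 => E) F) : E →ₗ[ℂ] E →ₗ[ℂ] F :=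
  LinearMap.mk₂ ℂ (fun x y => f ![x, y]) (fun x x' y => f.cons_add ![y] x x')
    (fun z x y => f.cons_smul ![y] z x) (fun x y y' => (f.curryLeft x).cons_add ![] y y')
    (fun z x y => (f.curryLeft x).cons_smul ![] z y)

/-- A multilinear map in one argument. -/
def toLin {ι E F : Type*} [Unique ι] [AddCommGroup E] [Module ℂ E] [AddCommGroup F] [Module ℂ F]
    (f : MultilinearMap ℂ (fun _ : ι => E) F) : E →ₗ[ℂ] F :=
  (MultilinearMap.ofSubsingleton ℂ E F default).symm f

variable {V : Color → Type u} [∀ a, AddCommGroup (V a)] [∀ a, Module ℂ (V a)]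
  (S : PlanarStarAlgebra V)

/-- The product as a bilinear map. -/
noncomputable def mulₗ (a : Color) : V a →ₗ[ℂ] V a →ₗ[ℂ] V a := toBilin (S.eval (Tangle.mul a))

/-- The coproduct as a bilinear map. -/
noncomputable def coprodₗ : V ⟨2, false⟩ →ₗ[ℂ] V ⟨2, false⟩ →ₗ[ℂ] V ⟨2, false⟩ :=
  toBilin (S.eval Tangle.coprod)

/-- The contragredient as a linear map. -/
noncomputable def contraₗ : V ⟨2, false⟩ →ₗ[ℂ] V ⟨2, false⟩ := toLin (S.eval Tangle.contra)

/-- The linear map `a ↦ 1 ⊡ a`. -/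
noncomputable def boxₗ : V ⟨2, false⟩ →ₗ[ℂ] V ⟨3, false⟩ := toLin (S.eval Tangle.box)

theorem mulₗ_apply {a : Color} (x y : V a) : S.mulₗ a x y = S.mul x y := rfl
theorem boxₗ_apply (x : V ⟨2, false⟩) : S.boxₗ x = S.box x := rfl

variable {S}

/-! ### Scalars -/

/-- The choice in `scalar` is meaningful only when the empty diagram spans its one-dimensional box
space. -/
theorem scalar_smul_of_ne (hS : S.IsIrreducibleSubfactor) {b : Bool} (hb : S.emptyBox b ≠ 0)
    (v : V ⟨0, b⟩) : S.scalar v • S.emptyBox b = v :=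
  Classical.epsilon_spec ((finrank_eq_one_iff_of_nonzero' _ hb).1 (hS.zero_box b) v)

namespace IsIrreducibleSubfactor

theorem one_ne_zero (hS : S.IsIrreducibleSubfactor) : S.one 1 ≠ 0 := by
  intro h
  have : Nontrivial (V ⟨1, false⟩) :=
    Module.nontrivial_of_finrank_pos (R := ℂ) (by rw [hS.one_box]; exact Nat.one_pos)
  obtain ⟨x, hx⟩ := exists_ne (0 : V ⟨1, false⟩)
  refine hx ?_
  rw [← S.one_mul_one x, h, ← mulₗ_apply, map_zero, LinearMap.zero_apply]

theorem emptyBox_false_ne_zero (hS : S.IsIrreducibleSubfactor) : S.emptyBox false ≠ 0 := by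
  intro h
  refine hS.one_ne_zero ?_
  rw [one_eq_pierce, h]
  exact (S.ev pierceOne).map_coord_zero (0 : Fin 1) rfl

theorem scalar_smul (hS : S.IsIrreducibleSubfactor) (v : V ⟨0, false⟩) :
    S.scalar v • S.emptyBox false = v :=
  scalar_smul_of_ne hS hS.emptyBox_false_ne_zero v

theorem scalar_eq (hS : S.IsIrreducibleSubfactor) {v : V ⟨0, false⟩} {z : ℂ}
    (h : v = z • S.emptyBox false) : S.scalar v = z :=
  smul_left_injective ℂ hS.emptyBox_false_ne_zero ((hS.scalar_smul v).trans h)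

/-- The coefficient of the empty diagram as a linear map. -/
noncomputable def scalarₗ (hS : S.IsIrreducibleSubfactor) : V ⟨0, false⟩ →ₗ[ℂ] ℂ where
  toFun := S.scalar
  map_add' x y := hS.scalar_eq (by rw [add_smul, hS.scalar_smul, hS.scalar_smul])
  map_smul' z x := hS.scalar_eq (by
    rw [smul_eq_mul, mul_smul, hS.scalar_smul, RingHom.id_apply])

/-- The Markov trace as a linear map. -/
noncomputable def trₗ (hS : S.IsIrreducibleSubfactor) (n : ℕ) : V ⟨n, false⟩ →ₗ[ℂ] ℂ :=
  hS.scalarₗ ∘ₗ toLin (S.eval (Tangle.trace ⟨n, false⟩))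

theorem trₗ_apply (hS : S.IsIrreducibleSubfactor) {n : ℕ} (x : V ⟨n, false⟩) :
    hS.trₗ n x = S.tr x := rfl

theorem scalar_star (hS : S.IsIrreducibleSubfactor) (v : V ⟨0, false⟩) :
    S.scalar (S.star v) = (starRingEnd ℂ) (S.scalar v) :=
  hS.scalar_eq (by
    nth_rw 1 [← hS.scalar_smul v]
    rw [map_smulₛₗ, S.star_emptyBox])

theorem tr_star_two (hS : S.IsIrreducibleSubfactor) (x : V ⟨2, false⟩) :
    S.tr (S.star x) = (starRingEnd ℂ) (S.tr x) :=
  (S.tr_eq_two ![S.star x]).trans <| (congrArg S.scalar (S.star_trace_two x).symm).trans <|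
    (hS.scalar_star _).trans (congrArg (starRingEnd ℂ) (S.tr_eq_two ![x]).symm)

theorem tr_star_three (hS : S.IsIrreducibleSubfactor) (x : V ⟨3, false⟩) :
    S.tr (S.star x) = (starRingEnd ℂ) (S.tr x) :=
  (S.tr_eq_three ![S.star x]).trans <| (congrArg S.scalar (S.star_trace_three x).symm).trans <|
    (hS.scalar_star _).trans (congrArg (starRingEnd ℂ) (S.tr_eq_three ![x]).symm)

/-- The value of the circle is the squared norm of the unit `1`-box. -/
theorem δ_pos (hS : S.IsIrreducibleSubfactor) : 0 < S.δ := by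
  have := hS.positive (S.one 1) hS.one_ne_zero
  rwa [S.star_one_one, S.one_mul_one, S.tr_one_one] at this

theorem circle_eq_smul (hS : S.IsIrreducibleSubfactor) :
    S.eval Tangle.circle (fun i => i.elim) = S.δ • S.emptyBox false :=
  (hS.scalar_smul _).symm

/-- The circle has a shaded empty diagram inside, and its value δ is not zero. -/
theorem emptyBox_true_ne_zero (hS : S.IsIrreducibleSubfactor) : S.emptyBox true ≠ 0 := by
  intro h
  have h1 := hS.circle_eq_smul
  rw [circle_eq_pierce, h] at h1
  exact smul_ne_zero hS.δ_pos.ne' hS.emptyBox_false_ne_zero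
    (h1.symm.trans ((S.ev pierceCircle).map_coord_zero (0 : Fin 1) rfl))

/-- Inside the surrounding circle stands a shaded scalar, which sphericality identifies as a trace
of `2`-boxes; the emptied circle contributes the factor δ. -/
theorem tr_box_coprod (hS : S.IsIrreducibleSubfactor) (a b : V ⟨2, false⟩) :
    S.tr (S.box (S.coprod a b)) = S.δ * S.tr (S.mul (S.contra a) b) := by
  rw [tr_box]
  refine hS.scalar_eq ?_
  have h := scalar_smul_of_ne hS hS.emptyBox_true_ne_zero (S.ev sideTrace ![S.coprod a b])
  rw [S.scalar_sideTrace_coprod hS] at h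
  rw [← h]
  refine ((toLin (ι := Fin 1) (S.ev pierceCircle)).map_smul _ (S.emptyBox true)).trans ?_
  refine (congrArg _ S.circle_eq_pierce.symm).trans ?_
  rw [hS.circle_eq_smul, smul_smul, mul_comm]

theorem jones_mul_jones (hS : S.IsIrreducibleSubfactor) :
    S.mul S.jones S.jones = S.δ • S.jones := by
  rw [jones_mul_jones_eq, hS.circle_eq_smul, jones_eq_pierce]
  exact (toLin (ι := Fin 1) (S.ev pierceTwo)).map_smul _ (S.emptyBox false)

/-- By irreducibility the conditional expectation of a onto `1`-boxes is a scalar, and preservation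
of the trace determines it. -/
theorem coprod_one (hS : S.IsIrreducibleSubfactor) (a : V ⟨2, false⟩) :
    S.coprod a (S.one 2) = (S.tr a / S.δ) • S.one 2 := by
  obtain ⟨z, hz⟩ := (finrank_eq_one_iff_of_nonzero' _ hS.one_ne_zero).1 (hS.one_box false)
    (S.ev expect ![a])
  have h1 : S.tr a = z * S.δ := by
    rw [← S.tr_expect, ← hz, ← S.tr_one_one, ← hS.trₗ_apply, map_smul]
    rfl
  rw [h1, mul_div_cancel_right₀ _ hS.δ_pos.ne', ← S.ev_incl_expect, ← hz, ← S.ev_incl_one]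
  exact (S.ev incl).cons_smul ![] z (S.one 1)

/-! ### The inner products -/

theorem tr_star_mul_self_nonneg (hS : S.IsIrreducibleSubfactor) {n : ℕ} (x : V ⟨n, false⟩) :
    0 ≤ S.tr (S.mul (S.star x) x) := by
  rcases eq_or_ne x 0 with rfl | hx
  · rw [← mulₗ_apply, map_zero, ← hS.trₗ_apply, map_zero]
  · exact (hS.positive x hx).le

/-- The inner product given by the Markov trace. -/
@[reducible] noncomputable def core (hS : S.IsIrreducibleSubfactor) {n : ℕ}
    (hm : ∀ x y : V ⟨n, false⟩, S.star (S.mul x y) = S.mul (S.star y) (S.star x))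
    (ht : ∀ x : V ⟨n, false⟩, S.tr (S.star x) = (starRingEnd ℂ) (S.tr x)) :
    InnerProductSpace.Core ℂ (V ⟨n, false⟩) where
  inner x y := S.tr (S.mul (S.star x) y)
  conj_inner_symm x y := by rw [← ht, hm, S.star_star]
  re_inner_nonneg x := (Complex.nonneg_iff.1 (hS.tr_star_mul_self_nonneg x)).1
  add_left x y z := by
    rw [map_add, ← mulₗ_apply, map_add, LinearMap.add_apply, ← hS.trₗ_apply, map_add]
    rfl
  smul_left x y r := by
    rw [map_smulₛₗ, ← mulₗ_apply, map_smul, LinearMap.smul_apply, ← hS.trₗ_apply, map_smul]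
    rfl
  definite x h := by
    by_contra hx
    exact (hS.positive x hx).ne' h

theorem cauchy (hS : S.IsIrreducibleSubfactor) (x y : V ⟨3, false⟩) :
    ‖S.tr (S.mul (S.star x) y)‖ ^ 2 ≤
      (S.tr (S.mul (S.star x) x)).re * (S.tr (S.mul (S.star y) y)).re := by
  let c := hS.core S.star_mul_three hS.tr_star_three
  let : NormedAddCommGroup (V ⟨3, false⟩) := c.toNormedAddCommGroup
  let : InnerProductSpace ℂ (V ⟨3, false⟩) := InnerProductSpace.ofCore c.toCore
  have h : ‖(inner ℂ x y : ℂ)‖ ^ 2 ≤ RCLike.re (inner ℂ x x : ℂ) * RCLike.re (inner ℂ y y : ℂ) := by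
    rw [← norm_sq_eq_re_inner, ← norm_sq_eq_re_inner, ← mul_pow]
    gcongr
    exact norm_inner_le_norm x y
  exact h

theorem tr_star_box_mul (hS : S.IsIrreducibleSubfactor) (a b : V ⟨2, false⟩) :
    S.tr (S.mul (S.star (S.box a)) (S.box b)) = S.δ * S.tr (S.mul (S.star a) b) := by
  rw [S.star_box, S.box_mul, hS.tr_box_coprod, S.contra_contra]

/-- `box` scales the inner product by δ. Through injectivity, properties of the coproduct are
inherited from the product of `3`-boxes. -/
theorem box_injective (hS : S.IsIrreducibleSubfactor) {a b : V ⟨2, false⟩}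
    (h : S.box a = S.box b) : a = b := by
  rw [← sub_eq_zero]
  by_contra hab
  have h1 := hS.tr_star_box_mul (a - b) (a - b)
  have h2 : S.box (a - b) = 0 := by
    rw [← boxₗ_apply, map_sub]
    exact sub_eq_zero.2 h
  rw [h2, ← mulₗ_apply, map_zero, ← hS.trₗ_apply, map_zero] at h1
  exact mul_ne_zero hS.δ_pos.ne' (hS.positive _ hab).ne' h1.symm

theorem coprod_assoc (hS : S.IsIrreducibleSubfactor) (a b c : V ⟨2, false⟩) :
    S.coprod (S.coprod a b) c = S.coprod a (S.coprod b c) := by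
  apply hS.box_injective
  rw [← S.box_mul, ← S.box_mul, ← S.box_mul, ← S.box_mul, S.mul_assoc_three]

theorem jones_coprod (hS : S.IsIrreducibleSubfactor) (a : V ⟨2, false⟩) :
    S.coprod S.jones a = a := by
  apply hS.box_injective
  rw [← S.box_mul, S.box_jones, S.one_mul_three]

/-- The involution of `3`-boxes reverses products, and it corresponds to x ↦ (x*)' on `2`-boxes,
where the star alone preserves the order of coproducts. -/
theorem contra_coprod (hS : S.IsIrreducibleSubfactor) (a b : V ⟨2, false⟩) :
    S.contra (S.coprod a b) = S.coprod (S.contra b) (S.contra a) := by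
  apply hS.box_injective
  have h := S.star_mul_three (S.box (S.star a)) (S.box (S.star b))
  rw [S.box_mul, S.star_box, S.star_box, S.star_box, S.box_mul, S.star_coprod, S.star_star,
    S.star_star] at h
  exact h

theorem coprod_jones (hS : S.IsIrreducibleSubfactor) (a : V ⟨2, false⟩) :
    S.coprod a S.jones = a := by
  have h : ∀ a, S.coprod a (S.contra S.jones) = a := fun a => by
    rw [← S.contra_contra (S.coprod _ _), hS.contra_coprod, S.contra_contra, hS.jones_coprod,
      S.contra_contra]
  have h1 : S.contra S.jones = S.jones := by
    rw [← hS.jones_coprod (S.contra S.jones), h]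
  rw [← h1, h]

theorem tr_star_coprod (hS : S.IsIrreducibleSubfactor) (a x y : V ⟨2, false⟩) :
    S.tr (S.mul (S.star (S.coprod a x)) y) =
      S.tr (S.mul (S.star x) (S.coprod (S.contra (S.star a)) y)) := by
  refine mul_left_cancel₀ hS.δ_pos.ne' ?_
  rw [← hS.tr_star_box_mul, ← hS.tr_star_box_mul, ← S.box_mul, ← S.box_mul, S.star_mul_three,
    S.star_box, S.star_box, S.mul_assoc_three]

theorem δ_eq (hS : S.IsIrreducibleSubfactor) : (S.δ.re : ℂ) = S.δ :=
  Complex.ext rfl (Complex.pos_iff.1 hS.δ_pos).2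

/-- The Hilbert space of `2`-boxes. -/
@[reducible] noncomputable def normed (hS : S.IsIrreducibleSubfactor) :
    NormedAddCommGroup (V ⟨2, false⟩) :=
  (hS.core S.star_mul_two hS.tr_star_two).toNormedAddCommGroup

/-- The Hilbert space of `2`-boxes. -/
@[reducible] noncomputable def innerSpace (hS : S.IsIrreducibleSubfactor) :
    @InnerProductSpace ℂ (V ⟨2, false⟩) _ hS.normed.toSeminormedAddCommGroup :=
  @InnerProductSpace.ofCore ℂ (V ⟨2, false⟩) _ _ _ (hS.core S.star_mul_two hS.tr_star_two).toCore

/-- The algebra of `2`-boxes of an irreducible subfactor planar algebra. -/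
noncomputable def boxAlgebra (hS : S.IsIrreducibleSubfactor) :
    @BoxAlgebra (V ⟨2, false⟩) hS.normed hS.innerSpace :=
  letI := hS.normed
  letI := hS.innerSpace
  { mul := S.mulₗ _
    co := S.coprodₗ
    st := S.star
    ct := S.contraₗ
    one := S.one 2
    jones := S.jones
    δ := S.δ.re
    δ_pos := (Complex.pos_iff.1 hS.δ_pos).1
    mul_assoc := S.mul_assoc_two
    one_mul := S.one_mul_two
    mul_one := S.mul_one_two
    st_st := S.star_star
    st_mul := S.star_mul_two
    inner_mul_left := fun a x y => by
      change S.tr (S.mul (S.star (S.mul a x)) y) = S.tr (S.mul (S.star x) (S.mul (S.star a) y))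
      rw [S.star_mul_two, S.mul_assoc_two]
    inner_mul_right := fun a x y => by
      change S.tr (S.mul (S.star (S.mul x a)) y) = S.tr (S.mul (S.star x) (S.mul y (S.star a)))
      rw [S.star_mul_two, S.mul_assoc_two, S.tr_mul_comm_two, S.mul_assoc_two]
    co_assoc := hS.coprod_assoc
    jones_co := hS.jones_coprod
    co_jones := hS.coprod_jones
    ct_ct := S.contra_contra
    ct_mul := S.contra_mul
    st_ct := S.star_contra
    st_co := S.star_coprod
    ct_co := hS.contra_coprod
    inner_co_left := hS.tr_star_coprod
    co_one := fun a => by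
      change S.coprod a (S.one 2) = (S.tr (S.mul (S.star (S.one 2)) a) / (S.δ.re : ℂ)) • S.one 2
      rw [S.star_one_two, S.one_mul_two, hS.δ_eq, hS.coprod_one]
    inner_one_jones := by
      change S.tr (S.mul (S.star (S.one 2)) S.jones) = S.δ.re
      rw [S.star_one_two, S.one_mul_two, hS.δ_eq, S.tr_jones]
    jones_mul_jones := by
      change S.mul S.jones S.jones = (S.δ.re : ℂ) • S.jones
      rw [hS.δ_eq, hS.jones_mul_jones]
    st_jones := S.star_jones
    cauchy := fun s x v s' x' v' => by
      change ‖S.tr (S.mul (S.star (S.one 2)) (S.mul (S.coprod _ _) _))‖ ^ 2 ≤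
        (S.tr (S.mul (S.star (S.one 2)) (S.mul (S.coprod _ _) _))).re *
        (S.tr (S.mul (S.star (S.one 2)) (S.mul (S.coprod _ _) _))).re
      rw [S.star_one_two, S.one_mul_two, S.one_mul_two, S.one_mul_two]
      have h := hS.cauchy (S.ev triangle ![s', x', v']) (S.ev triangle ![s, x, v])
      rw [S.tr_triangle hS, S.tr_triangle hS, S.tr_triangle hS, mul_comm] at h
      exact h
    schur := fun s x v => by
      change 0 ≤ S.tr (S.mul (S.star (S.one 2)) (S.mul (S.coprod _ _) _))
      rw [S.star_one_two, S.one_mul_two]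
      have h := hS.tr_star_mul_self_nonneg (S.ev triangle ![s, x, v])
      rw [S.tr_triangle hS] at h
      exact h }

end IsIrreducibleSubfactor

end PlanarStarAlgebra

/-! ### Transfer to projections, norms and spectral projections of `3`-boxes -/

namespace PlanarStarAlgebra

variable {V : Color → Type u} [∀ a, AddCommGroup (V a)] [∀ a, Module ℂ (V a)]
  {S : PlanarStarAlgebra V}

namespace IsIrreducibleSubfactor

theorem boxAlgebra_tr (hS : S.IsIrreducibleSubfactor) (x : V ⟨2, false⟩) :
    @BoxAlgebra.tr _ hS.normed hS.innerSpace hS.boxAlgebra x = S.tr x := by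
  change S.tr (S.mul (S.star (S.one 2)) x) = S.tr x
  rw [S.star_one_two, S.one_mul_two]

theorem tr_div_δ (hS : S.IsIrreducibleSubfactor) {x : V ⟨2, false⟩}
    (hx : @BoxAlgebra.Nonneg _ hS.normed hS.innerSpace hS.boxAlgebra x) :
    S.tr x / S.δ = (@BoxAlgebra.wt _ hS.normed hS.innerSpace hS.boxAlgebra x : ℂ) := by
  let := hS.normed
  let := hS.innerSpace
  have : FiniteDimensional ℂ (V ⟨2, false⟩) := hS.finite _
  rw [← hS.boxAlgebra_tr, hx.tr_eq]
  change ((S.δ.re * _ : ℝ) : ℂ) / S.δ = _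
  rw [Complex.ofReal_mul, hS.δ_eq, mul_div_cancel_left₀ _ hS.δ_pos.ne']

theorem isCoproj_iff (hS : S.IsIrreducibleSubfactor) (q : V ⟨2, false⟩) :
    @BoxAlgebra.IsCoproj _ hS.normed hS.innerSpace hS.boxAlgebra q ↔
      S.IsProjection (S.box q) := by
  change S.coprod q q = q ∧ S.contra (S.star q) = q ↔
    S.mul (S.box q) (S.box q) = S.box q ∧ S.star (S.box q) = S.box q
  rw [S.box_mul, S.star_box]
  exact ⟨fun h => ⟨congrArg S.box h.1, congrArg S.box h.2⟩,
    fun h => ⟨hS.box_injective h.1, hS.box_injective h.2⟩⟩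

theorem isBiproj_iff (hS : S.IsIrreducibleSubfactor) (p : V ⟨2, false⟩) :
    @BoxAlgebra.IsBiproj _ hS.normed hS.innerSpace hS.boxAlgebra p ↔ S.IsBiprojection p := by
  refine and_congr Iff.rfl (and_congr Iff.rfl (exists₂_congr fun z r =>
    and_congr (hS.isCoproj_iff r) ?_))
  rw [← boxₗ_apply, ← boxₗ_apply, ← map_smul]
  exact ⟨fun h => congrArg S.boxₗ h, fun h => hS.box_injective h⟩

/-- The operator norm of `1 ⊡ b` is determined by an algebraic norm bound and an eigenvector. -/
theorem opNorm_box (hS : S.IsIrreducibleSubfactor) {b d p : V ⟨2, false⟩} {t : ℝ} (ht : 0 ≤ t)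
    (hb : S.contra (S.star b) = b) (hd : S.contra (S.star d) = d)
    (hdb : S.coprod d d = ((t ^ 2 : ℝ) : ℂ) • S.jones - S.coprod b b) (hp : p ≠ 0)
    (hbp : S.coprod b p = (t : ℂ) • p) : S.opNorm (S.box b) = t := by
  have norm_eq : ∀ c, S.contra (S.star c) = c → ∀ y, S.tr (S.mul (S.star (S.mul (S.box c) y))
      (S.mul (S.box c) y)) = S.tr (S.mul (S.star y) (S.mul (S.box (S.coprod c c)) y)) := by
    intro c hc y
    rw [S.star_mul_three, S.star_box, hc, S.mul_assoc_three, ← S.mul_assoc_three (S.box c),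
      S.box_mul]
  -- The operator norm tests all `3`-boxes y, not only turned `2`-boxes. The square root d gives
  -- t²‖y‖² - ‖(1 ⊡ b)y‖² = ‖(1 ⊡ d)y‖² ≥ 0 for each of them.
  have upper : ∀ y, (S.tr (S.mul (S.star (S.mul (S.box b) y)) (S.mul (S.box b) y))).re ≤
      t ^ 2 * (S.tr (S.mul (S.star y) y)).re := by
    intro y
    have h1 := (Complex.nonneg_iff.1 (hS.tr_star_mul_self_nonneg (S.mul (S.box d) y))).1
    have h2 : S.mul (S.star y) (S.mul (S.box (S.coprod d d)) y) =
        ((t ^ 2 : ℝ) : ℂ) • S.mul (S.star y) y -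
          S.mul (S.star y) (S.mul (S.box (S.coprod b b)) y) := by
      rw [hdb, ← boxₗ_apply, map_sub, map_smul, boxₗ_apply, S.box_jones, ← mulₗ_apply, ← mulₗ_apply,
        map_sub (S.mulₗ _), LinearMap.sub_apply, map_smul (S.mulₗ _), LinearMap.smul_apply,
        mulₗ_apply S (S.one 3), S.one_mul_three, map_sub, map_smul]
      rfl
    rw [norm_eq d hd, h2, ← hS.trₗ_apply, map_sub, map_smul, hS.trₗ_apply, hS.trₗ_apply,
      ← norm_eq b hb, Complex.sub_re, smul_eq_mul, Complex.re_ofReal_mul] at h1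
    linarith
  refine le_antisymm (csInf_le ⟨0, fun C hC => hC.1⟩ ⟨ht, upper⟩)
    (le_csInf ⟨t, ht, upper⟩ fun C hC => ?_)
  -- The turned eigenvector shows that no smaller constant is possible.
  have h1 := hC.2 (S.box p)
  have h2 : S.box p ≠ 0 := fun h => hp (hS.box_injective (h.trans (map_zero S.boxₗ).symm))
  have h3 := (Complex.pos_iff.1 (hS.positive _ h2)).1
  have h4 : S.mul (S.box b) (S.box p) = (t : ℂ) • S.box p := by
    rw [S.box_mul, hbp]
    exact map_smul S.boxₗ _ _
  rw [h4, map_smulₛₗ, Complex.conj_ofReal, ← mulₗ_apply, map_smul, map_smul, LinearMap.smul_apply,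
    ← hS.trₗ_apply, map_smul, map_smul, smul_eq_mul, smul_eq_mul, Complex.re_ofReal_mul,
    Complex.re_ofReal_mul, ← mul_assoc, ← sq] at h1
  exact (sq_le_sq₀ ht hC.1).1 (le_of_mul_le_mul_right h1 h3)

end IsIrreducibleSubfactor

/-- A coproduct projection onto an eigenspace of `b` is a spectral projection of `1 ⊡ b`. -/
theorem isSpectralProjection_box {b e k : V ⟨2, false⟩} {t : ℝ}
    (he : S.IsProjection (S.box e)) (hbe : S.coprod b e = (t : ℂ) • e)
    (hk : S.jones - e = S.coprod k ((t : ℂ) • S.jones - b)) :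
    S.IsSpectralProjection (S.box e) (S.box b) t := by
  refine ⟨he, fun y => ⟨fun hy => ?_, fun hy => ?_⟩⟩
  · rw [← hy, ← S.mul_assoc_three, S.box_mul, hbe, ← boxₗ_apply, map_smul, ← mulₗ_apply, map_smul,
      LinearMap.smul_apply]
    rfl
  -- The factorisation `hk` lets the complement of e act through t - (1 ⊡ b), which annihilates y.
  · have h1 : S.mul (S.box (S.jones - e)) y = y - S.mul (S.box e) y := by
      rw [← boxₗ_apply, map_sub, boxₗ_apply, S.box_jones, ← mulₗ_apply, map_sub,
        LinearMap.sub_apply, mulₗ_apply, S.one_mul_three]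
      rfl
    have h2 : S.mul (S.box ((t : ℂ) • S.jones - b)) y = 0 := by
      rw [← boxₗ_apply, map_sub, map_smul, boxₗ_apply, S.box_jones, ← mulₗ_apply, map_sub,
        LinearMap.sub_apply, map_smul, LinearMap.smul_apply, mulₗ_apply, S.one_mul_three, mulₗ_apply]
      exact sub_eq_zero.2 hy.symm
    rw [hk, ← S.box_mul, S.mul_assoc_three, h2, ← mulₗ_apply, map_zero] at h1
    exact (sub_eq_zero.1 h1.symm).symm

end PlanarStarAlgebra

end SubfactorPA

/-! ### The main theorem -/

theorem theorem4p14 {V : SubfactorPA.Color → Type*} [∀ a, AddCommGroup (V a)]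
    [∀ a, Module ℂ (V a)] (S : SubfactorPA.PlanarStarAlgebra V) (hS : S.IsIrreducibleSubfactor)
    (A P : V ⟨2, false⟩) (hA : S.IsPositive A) (hP : S.IsGeneratedBiprojection P A) :
    (∀ Q : V ⟨2, false⟩, S.IsMinimalBox Q →
      List.TFAE
        [ S.coprod (S.coprod Q P) Q = (S.tr P / S.δ) • Q,
          S.coprod (S.coprod Q A) Q = (S.tr A / S.δ) • Q,
          S.coprod Q A = (S.tr A / S.δ) • Q ∧ S.coprod A Q = (S.tr A / S.δ) • Q,
          S.coprod (S.coprod Q (A + S.contra A)) Q = (S.tr (A + S.contra A) / S.δ) • Q ]) ∧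
    S.IsSpectralProjection ((S.δ / S.tr P) • S.box P) (S.box (A + S.contra A))
      (S.opNorm (S.box (A + S.contra A))) := by
  let := hS.normed
  let := hS.innerSpace
  have : FiniteDimensional ℂ (V ⟨2, false⟩) := hS.finite _
  let B := hS.boxAlgebra
  have hA' : B.Nonneg A := by
    obtain ⟨y, rfl⟩ := hA
    exact B.nonneg_sq y
  have hP' : B.IsBiproj P := (hS.isBiproj_iff P).2 hP.1
  have hmin : ∀ r, B.IsBiproj r → B.mul (B.mul r A) r = A → B.mul P r = P := fun r hr h =>
    hP.2.2 r ((hS.isBiproj_iff r).1 hr) h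
  have hB : B.Nonneg (A + S.contra A) := hA'.add hA'.ct
  have hBc : B.ct (A + S.contra A) = A + S.contra A :=
    (map_add B.ct _ _).trans ((congrArg (S.contra A + ·) (S.contra_contra A)).trans (add_comm _ _))
  refine ⟨fun Q hQ => ?_, ?_⟩
  · rw [hS.tr_div_δ hA', hS.tr_div_δ hB, hS.tr_div_δ hP'.nonneg]
    exact hP'.tfae hA' hP.2.1 hmin ((hS.isCoproj_iff Q).2 hQ.1)
  · obtain ⟨-, hbp, k, hk⟩ := hP'.isCoproj_of_minimal hA' hP.2.1 hmin
    obtain ⟨d, hd, hdb⟩ := hB.exists_co_sq hBc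
    -- The normalisation δ/tr(P) is the inverse of w(P), which makes P a projection for the
    -- coproduct.
    have he : (S.δ / S.tr P) • S.box P = S.box ((B.wt P : ℂ)⁻¹ • P) := by
      rw [← hS.tr_div_δ hP'.nonneg, inv_div]
      exact (map_smul S.boxₗ _ _).symm
    have hbst : S.contra (S.star (A + S.contra A)) = A + S.contra A :=
      (congrArg S.contra hB.st).trans hBc
    rw [hS.opNorm_box hB.wt_nonneg hbst hd hdb hP'.1 hbp, he]
    refine SubfactorPA.PlanarStarAlgebra.isSpectralProjection_box
      ((hS.isCoproj_iff _).1 hP'.isCoproj) ?_ hk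
    exact (map_smul (B.co _) _ _).trans ((congrArg _ hbp).trans (smul_comm _ _ _))
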